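/- **Setting.** Let $n\ge 2$ and let $K\in\mathbb R_{\ge 0}^{n\times n}$ be balanceable, i.e. irreducible: the directed graph $G_K$ on $[n]$ with edges $\{(i,j):K_{ij}>0\}$ is strongly connected. Let $0<\varepsilon\le 1$. Write $m$ for the number of nonzero entries of $K$, $d$ for the diameter of $G_K$, $K_{\max}$ for the largest and $K_{\min}$ for the smallest nonzero entry of $K$, and $\kappa=(\sum_{ij}K_{ij})/K_{\min}$. For a nonnegative matrix $A$ let $r(A)$ and $c(A)$ be its vectors of row and column sums. A vector $x\in\mathbb R^n$ *solves* $\mathrm{ABAL}(K,\varepsilon)$ if $A=\mathrm{diag}(e^x)K\,\mathrm{diag}(e^{-x})$ satisfies $\|r(A)-c(A)\|_1\le\varepsilon\sum_{ij}A_{ij}$. **Algorithms.** Let $[n]=S_1\sqcup\dots\sqcup S_p$. Osborne's algorithm starts from $x=0$ and in each round chooses a block $S_\ell$ and replaces, simultaneously for all $k\in S_\ell$, $x_k$ by $x_k+\frac12\big(\log c_k(A)-\log r_k(A)\big)$, where $A=\mathrm{diag}(e^x)K\,\mathrm{diag}(e^{-x})$. In *Random Block* Osborne the $\ell$'s are independent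 and uniform in $[p]$; in *Cyclic Block* Osborne the algorithm cycles through the blocks, the order in each cycle being an independent uniformly random permutation. In both cases $S_1,\dots,S_p$ are the nonempty classes of a given proper coloring of $G_K$ (loops disregarded). *Random* and *Cyclic* Osborne are the same with $p=n$ and $S_k=\{k\}$. **Implementations.** The machine is a random access machine whose registers and array cells hold integers of absolute value less than $2^b$ ("$b$-bit numbers"; larger results are clamped to this range). It reads a fixed-point number as $a/u$ with two words $a,u$. Its unit-cost operations are integer $+,-,\times$, division, the rounded-down fixed-point functions $(a,u)\mapsto\lfloor u\,e^{a/u}\rfloor$ and $(a,u)\mapsto\lfloor u\log(a/u)\rfloor$, array reads and writes, constants, and sign tests (conditionals and loops). An implementation is a pair of fixed programs, one for preprocessing and one that is run in each round, after the block has been chosen at random, and that also decides when to stop. Every operation is counted, including preprocessing and the stopping test, plus one for each random choice and one for each test of the stopping flag. The iterates $x$ are stored as fixed-point vectors; the first is $0$, and in each round each coordinate in the chosen block is updated to its exact Osborne update from the stored iterate up to an additive error of at most $\varepsilon/n$, while the other coordinates do not change. **Input.** The input consists of $n,m,p$, the integer $\lceil 1/\varepsilon\rceil$, the blocks, and the nonzero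 entries of $K$, listed by rows and by columns. In the *plain* format the entries are given as integers $z_{ij}$ with $K_{ij}=s\,z_{ij}$ for some real $s>0$; put $L=\log\frac n\varepsilon+\log\frac{K_{\max}}{K_{\min}}$. In the *logarithmic* format they are given as integers $z_{ij}$ and a common denominator $q\ge1$ with $\log K_{ij}=s+z_{ij}/q$ on the support of $K$, for some real $s$; put $L=\log\frac n\varepsilon+\log^+\log\frac{K_{\max}}{K_{\min}}$, where $\log^+ t=\max(0,\log t)$ and $\log^+0=0$. The input is assumed to have $O(L)$ bits: $|z_{ij}|,q\le 2^{aL}$ for some constant $a$. The reals $s$ are not part of the input. **Theorem.** For each of the four variants (Random, Cyclic, Random Block, Cyclic Block) and each of the two input formats there are an implementation and a constant $C$ such that for every $a$ there is a constant $B$ for which the following holds for all $n,K,\varepsilon$, all admissible blocks and all inputs as above. On words of $b=\lceil BL\rceil$ bits, that is, of $O(\log\frac n\varepsilon+\log\frac{K_{\max}}{K_{\min}})$ bits in the plain format and of $O(\log\frac n\varepsilon+\log^+\log\frac{K_{\max}}{K_{\min}})$ bits in the logarithmic format, the implementation almost surely stops, its iterates are as described above, and its output solves $\mathrm{ABAL}(K,\varepsilon)$.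 Its number of rounds $R$ and its total number of operations $T$ satisfy the bounds $$\mathbb E[T]\le CW,\qquad \Pr\big(T\le CW\log\tfrac1\delta\big)\ge1-\delta,\qquad \mathbb E[R]\le CV,\qquad \Pr\big(R\le CV\log\tfrac1\delta\big)\ge1-\delta$$ for all $\delta\in(0,\tfrac12]$, where $$W=\frac m\varepsilon\Big(\frac1\varepsilon\wedge d\Big)\log\kappa,\qquad V=\frac p\varepsilon\Big(\frac1\varepsilon\wedge d\Big)\log\kappa$$ for Random and Random Block Osborne, and $$W=\frac{m\sqrt p}\varepsilon\Big(\frac1\varepsilon\wedge d\Big)\log\kappa,\qquad V=\frac{p^{3/2}}\varepsilon\Big(\frac1\varepsilon\wedge d\Big)\log\kappa$$ for Cyclic and Cyclic Block Osborne (with $p=n$ for Random and Cyclic Osborne). -/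

import Mathlib

open MeasureTheory ProbabilityTheory

noncomputable section

namespace Osborne

/-! ### Matrix balancing -/

variable {n : ℕ}

/-- The scaling `diag(e^x) K diag(e^{-x})`. -/
def scaling (K : Matrix (Fin n) (Fin n) ℝ) (x : Fin n → ℝ) : Matrix (Fin n) (Fin n) ℝ :=
  fun i j => Real.exp (x i) * K i j * Real.exp (-(x j))

/-- The `k`-th row sum. -/
def rowSum (A : Matrix (Fin n) (Fin n) ℝ) (k : Fin n) : ℝ := ∑ j, A k j

/-- The `k`-th column sum. -/
def colSum (A : Matrix (Fin n) (Fin n) ℝ) (k : Fin n) : ℝ := ∑ i, A i k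

/-- `x` solves `ABAL(K, ε)`: the scaling of `K` by `x` is `ε`-balanced in the `ℓ₁` sense. -/
def IsApproxBalancing (K : Matrix (Fin n) (Fin n) ℝ) (ε : ℝ) (x : Fin n → ℝ) : Prop :=
  (∑ k, |rowSum (scaling K x) k - colSum (scaling K x) k|) / (∑ i, ∑ j, scaling K x i j) ≤ ε

/-- The value given to coordinate `k` by an exact Osborne update of `x` on `k`. -/
def osborneUpdate (K : Matrix (Fin n) (Fin n) ℝ) (x : Fin n → ℝ) (k : Fin n) : ℝ :=
  x k + (Real.log (colSum (scaling K x) k) - Real.log (rowSum (scaling K x) k)) / 2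

/-- Number of nonzero entries of a nonnegative matrix. -/
def nnz (K : Matrix (Fin n) (Fin n) ℝ) : ℕ := Nat.card {e : Fin n × Fin n // 0 < K e.1 e.2}

/-- Largest entry. -/
def Kmax (K : Matrix (Fin n) (Fin n) ℝ) : ℝ := sSup {v | ∃ i j, K i j = v}

/-- Smallest positive entry. -/
def Kmin (K : Matrix (Fin n) (Fin n) ℝ) : ℝ := sInf {v | 0 < v ∧ ∃ i j, K i j = v}

/-- The condition number `κ = (∑ K_ij) / K_min`. -/
def cond (K : Matrix (Fin n) (Fin n) ℝ) : ℝ := (∑ i, ∑ j, K i j) / Kmin K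

/-- There is a directed walk of length `l` from `u` to `v` in the graph with an edge `i → j`
whenever `0 < K i j`. -/
def HasWalk (K : Matrix (Fin n) (Fin n) ℝ) (u v : Fin n) (l : ℕ) : Prop :=
  ∃ w : ℕ → Fin n, w 0 = u ∧ w l = v ∧ ∀ t < l, 0 < K (w t) (w (t + 1))

/-- The diameter of the directed graph of `K` (used only for strongly connected graphs). -/
def diam (K : Matrix (Fin n) (Fin n) ℝ) : ℕ := sInf {d | ∀ u v, ∃ l ≤ d, HasWalk K u v l}

/-! ### The four variants of Osborne's algorithm -/

inductive Variant
  | random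
  | cyclic
  | randomBlock
  | cyclicBlock

/-- The admissible blocks `S_ℓ = {k | color k = ℓ}`: for Random and Cyclic Osborne they are the
singletons `S_k = {k}`; for the block variants they are the (nonempty) classes of any proper
coloring of the graph of `K`, whose loops are disregarded. -/
def Variant.IsBlocks {p : ℕ} (v : Variant) (K : Matrix (Fin n) (Fin n) ℝ)
    (color : Fin n → Fin p) : Prop :=
  match v with
  | .random | .cyclic => p = n ∧ ∀ k, (color k : ℕ) = (k : ℕ)
  | .randomBlock | .cyclicBlock =>
      Function.Surjective color ∧ ∀ i j, i ≠ j → 0 < K i j → color i ≠ color j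

/-- Independent uniform choices of one of `p` blocks. -/
def IsUniformSelection {p : ℕ} {Ω : Type*} [MeasurableSpace Ω] (μ : Measure Ω)
    (s : ℕ → Ω → Fin p) : Prop :=
  (∀ t, Measurable (s t)) ∧ iIndepFun s μ ∧
    ∀ t l, μ.real {ω | s t ω = l} = 1 / (p : ℝ)

/-- Choices that cycle through the `p` blocks, the order in each cycle being given by an
independent uniformly random permutation. -/
def IsCyclicSelection {p : ℕ} {Ω : Type*} [MeasurableSpace Ω] (μ : Measure Ω)
    (s : ℕ → Ω → Fin p) : Prop :=
  ∃ π : ℕ → Ω → Equiv.Perm (Fin p),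
    (∀ c τ, MeasurableSet {ω | π c ω = τ}) ∧
    iIndepFun (m := fun _ => ⊤) π μ ∧
    (∀ c τ, μ.real {ω | π c ω = τ} = 1 / (p.factorial : ℝ)) ∧
    ∀ c ω (i : Fin p), s (c * p + (i : ℕ)) ω = π c ω i

/-- The law of the sequence `s 0, s 1, …` of blocks to be updated. -/
def Variant.IsSelection {p : ℕ} (v : Variant) {Ω : Type*} [MeasurableSpace Ω] (μ : Measure Ω)
    (s : ℕ → Ω → Fin p) : Prop :=
  match v with
  | .random | .randomBlock => IsUniformSelection μ s
  | .cyclic | .cyclicBlock => IsCyclicSelection μ s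

/-- The factor lost by the cyclic variants. -/
def Variant.slowdown (v : Variant) (p : ℕ) : ℝ :=
  match v with
  | .random | .randomBlock => 1
  | .cyclic | .cyclicBlock => Real.sqrt p

/-- `ε⁻¹ (ε⁻¹ ∧ d) log κ`. -/
def rate (K : Matrix (Fin n) (Fin n) ℝ) (ε : ℝ) : ℝ :=
  (1 / ε) * min (1 / ε) (diam K : ℝ) * Real.log (cond K)

/-- The bound on the total number of arithmetic operations: `m ε⁻¹ (ε⁻¹ ∧ d) log κ` for the
random variants, `√p` times as much for the cyclic ones. -/
def Variant.workBound (v : Variant) (p : ℕ) (K : Matrix (Fin n) (Fin n) ℝ) (ε : ℝ) : ℝ :=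
  (nnz K : ℝ) * v.slowdown p * rate K ε

/-- The bound on the number of rounds (block updates): `p ε⁻¹ (ε⁻¹ ∧ d) log κ` for the
random variants, `√p` times as much for the cyclic ones. -/
def Variant.roundBound (v : Variant) (p : ℕ) (K : Matrix (Fin n) (Fin n) ℝ) (ε : ℝ) : ℝ :=
  (p : ℝ) * v.slowdown p * rate K ε

/-- The random variable `T` is at most `B` in expectation, and at most `B log (1/δ)` with
probability at least `1 - δ`. -/
def Guarantee {Ω : Type*} [MeasurableSpace Ω] (μ : Measure Ω) (T : Ω → ℕ) (B : ℝ) : Prop :=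
  Integrable (fun ω => (T ω : ℝ)) μ ∧ ∫ ω, (T ω : ℝ) ∂μ ≤ B ∧
    ∀ δ : ℝ, 0 < δ → δ ≤ 1 / 2 → 1 - δ ≤ μ.real {ω | (T ω : ℝ) ≤ B * Real.log (1 / δ)}

/-! ### The machine: a random access machine on `b`-bit words

Registers and array cells hold integers of absolute value less than `2 ^ b`; every result is
clamped to that range. All instructions have unit cost. A word `a` together with a scale `u`
stands for the fixed-point number `a / u`. -/

/-- Saturation to a `b`-bit (signed) word. -/
def clamp (b : ℕ) (z : ℤ) : ℤ := max (-(2 ^ b - 1)) (min z (2 ^ b - 1))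

structure State where
  /-- registers -/
  reg : ℕ → ℤ
  /-- arrays: cell `(i, j)` of array number `k` is `mem k i j` -/
  mem : ℕ → ℤ → ℤ → ℤ

def State.setReg (σ : State) (r : ℕ) (z : ℤ) : State :=
  { σ with reg := Function.update σ.reg r z }

def State.setMem (σ : State) (arr : ℕ) (i j z : ℤ) : State :=
  { σ with mem := fun k i' j' => if k = arr ∧ i' = i ∧ j' = j then z else σ.mem k i' j' }

/-- Arithmetic operations: integer arithmetic, and the exponential and the logarithm of a
fixed-point number `a / u`, returned with the same scale and rounded down. -/
inductive Op
  | add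
  | sub
  | mul
  | div
  | exp
  | log

def Op.eval : Op → ℤ → ℤ → ℤ
  | .add, a, c => a + c
  | .sub, a, c => a - c
  | .mul, a, c => a * c
  | .div, a, c => a / c
  | .exp, a, u => ⌊(u : ℝ) * Real.exp ((a : ℝ) / (u : ℝ))⌋
  | .log, a, u => ⌊(u : ℝ) * Real.log ((a : ℝ) / (u : ℝ))⌋

/-- Programs. The arguments of an instruction are register numbers, except for `arr`, which is
an array number, and for the integer `c` of `const`. -/
inductive Cmd
  | const (dst : ℕ) (c : ℤ)
  | op (o : Op) (dst r₁ r₂ : ℕ)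
  | load (dst arr i j : ℕ)
  | store (arr i j src : ℕ)
  | seq (P Q : Cmd)
  | branch (r : ℕ) (P Q : Cmd)
  | loop (r : ℕ) (P : Cmd)

/-- `Exec b P σ t σ'`: on `b`-bit words, the program `P` started in `σ` halts in `σ'` after
`t` operations. A `branch` or a `loop` tests whether its register is positive. -/
inductive Exec (b : ℕ) : Cmd → State → ℕ → State → Prop
  | const (dst : ℕ) (c : ℤ) (σ : State) :
      Exec b (.const dst c) σ 1 (σ.setReg dst (clamp b c))
  | op (o : Op) (dst r₁ r₂ : ℕ) (σ : State) :
      Exec b (.op o dst r₁ r₂) σ 1 (σ.setReg dst (clamp b (o.eval (σ.reg r₁) (σ.reg r₂))))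
  | load (dst arr i j : ℕ) (σ : State) :
      Exec b (.load dst arr i j) σ 1 (σ.setReg dst (σ.mem arr (σ.reg i) (σ.reg j)))
  | store (arr i j src : ℕ) (σ : State) :
      Exec b (.store arr i j src) σ 1 (σ.setMem arr (σ.reg i) (σ.reg j) (σ.reg src))
  | seq {P Q : Cmd} {σ σ₁ σ₂ : State} {t₁ t₂ : ℕ} :
      Exec b P σ t₁ σ₁ → Exec b Q σ₁ t₂ σ₂ → Exec b (.seq P Q) σ (t₁ + t₂) σ₂
  | branch_pos {r : ℕ} {P Q : Cmd} {σ σ₁ : State} {t : ℕ} :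
      0 < σ.reg r → Exec b P σ t σ₁ → Exec b (.branch r P Q) σ (t + 1) σ₁
  | branch_neg {r : ℕ} {P Q : Cmd} {σ σ₁ : State} {t : ℕ} :
      ¬ 0 < σ.reg r → Exec b Q σ t σ₁ → Exec b (.branch r P Q) σ (t + 1) σ₁
  | loop_pos {r : ℕ} {P : Cmd} {σ σ₁ σ₂ : State} {t₁ t₂ : ℕ} :
      0 < σ.reg r → Exec b P σ t₁ σ₁ → Exec b (.loop r P) σ₁ t₂ σ₂ →
      Exec b (.loop r P) σ (t₁ + t₂ + 1) σ₂
  | loop_neg {r : ℕ} {P : Cmd} {σ : State} :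
      ¬ 0 < σ.reg r → Exec b (.loop r P) σ 1 σ

/-! ### Input and output conventions -/

/-- Register through which a block to be updated is announced to the program. -/
abbrev selReg : ℕ := 5

/-- Register by which the program signals that it stops. -/
abbrev doneReg : ℕ := 6

/-- Register holding the scale of the iterate. -/
abbrev scaleReg : ℕ := 7

/-- Array holding the iterate. -/
abbrev iterArr : ℕ := 8

/-- An array with `n` rows, the `i`-th row holding the list `f i` (and zeros elsewhere). -/
def table (n : ℕ) (f : Fin n → List ℤ) (i j : ℤ) : ℤ :=
  if h : 0 ≤ i ∧ i.toNat < n ∧ 0 ≤ j then ((f ⟨i.toNat, h.2.1⟩)[j.toNat]?).getD 0 else 0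

/-- The columns of the nonzero entries in row `k`, in increasing order. -/
def rowSupp (K : Matrix (Fin n) (Fin n) ℝ) (k : Fin n) : List (Fin n) :=
  (Finset.univ.filter fun j => 0 < K k j).sort

/-- The rows of the nonzero entries in column `k`, in increasing order. -/
def colSupp (K : Matrix (Fin n) (Fin n) ℝ) (k : Fin n) : List (Fin n) :=
  (Finset.univ.filter fun i => 0 < K i k).sort

/-- The elements of the block `l`, in increasing order. -/
def block {p : ℕ} (color : Fin n → Fin p) (l : Fin p) : List (Fin n) :=
  (Finset.univ.filter fun k => color k = l).sort

/-- The initial memory. Registers `0` to `4` hold `n`, the number of nonzero entries, `⌈1/ε⌉`,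
the number of blocks and the common denominator `q` of the entries. Arrays `0` to `2` hold, for
each row, the number, the positions and the values of its nonzero entries; arrays `3` to `5`
the same for each column; arrays `6` and `7` the size and the elements of each block. All other
registers and cells are zero. -/
def inputState (b : ℕ) {p : ℕ} (K : Matrix (Fin n) (Fin n) ℝ) (ε : ℝ) (color : Fin n → Fin p)
    (z : Matrix (Fin n) (Fin n) ℤ) (q : ℤ) : State where
  reg r := clamp b (match r with
    | 0 => (n : ℤ)
    | 1 => (nnz K : ℤ)
    | 2 => ⌈1 / ε⌉
    | 3 => (p : ℤ)
    | 4 => q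
    | _ => 0)
  mem k i j := clamp b (match k with
    | 0 => table n (fun k => [((rowSupp K k).length : ℤ)]) i j
    | 1 => table n (fun k => (rowSupp K k).map fun j => ((j : ℕ) : ℤ)) i j
    | 2 => table n (fun k => (rowSupp K k).map fun j => z k j) i j
    | 3 => table n (fun k => [((colSupp K k).length : ℤ)]) i j
    | 4 => table n (fun k => (colSupp K k).map fun i => ((i : ℕ) : ℤ)) i j
    | 5 => table n (fun k => (colSupp K k).map fun i => z i k) i j
    | 6 => table p (fun l => [((block color l).length : ℤ)]) i j
    | 7 => table p (fun l => (block color l).map fun k => ((k : ℕ) : ℤ)) i j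
    | _ => 0)

/-- The iterate `x` stored in a state, a vector of fixed-point numbers. -/
def State.iterate (σ : State) (n : ℕ) : Fin n → ℝ :=
  fun i => (σ.mem iterArr (i : ℕ) 0 : ℝ) / (σ.reg scaleReg : ℝ)

/-- How the entries of `K` are given: by themselves or by their logarithms. -/
inductive InputFormat
  | plain
  | logarithmic

/-- The claimed order of the number of bits. In the logarithmic case, `log log (Kmax / Kmin)` is
replaced by `0` when it is negative or undefined. -/
def InputFormat.bitBound (f : InputFormat) (K : Matrix (Fin n) (Fin n) ℝ) (ε : ℝ) : ℝ :=
  match f with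
  | .plain => Real.log (n / ε) + Real.log (Kmax K / Kmin K)
  | .logarithmic => Real.log (n / ε) + Real.posLog (Real.log (Kmax K / Kmin K))

/-- The integers `z i j`, with common denominator `q`, are the input that represents `K`. They
have at most `a * f.bitBound K ε` bits. Plain format: the entries of `K` are integers up to
a common scale. Logarithmic format: the logarithms of the nonzero entries are `z i j / q`, up to
a common translation (that is, again, up to a common scale of `K`). -/
def InputFormat.Encodes (f : InputFormat) (a : ℝ) (K : Matrix (Fin n) (Fin n) ℝ) (ε : ℝ)
    (z : Matrix (Fin n) (Fin n) ℤ) (q : ℤ) : Prop :=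
  (∀ i j, |(z i j : ℝ)| ≤ (2 : ℝ) ^ (a * f.bitBound K ε)) ∧
  (q : ℝ) ≤ (2 : ℝ) ^ (a * f.bitBound K ε) ∧
  match f with
  | .plain => q = 1 ∧ ∃ c : ℝ, 0 < c ∧ ∀ i j, K i j = c * (z i j : ℝ)
  | .logarithmic =>
      0 < q ∧ ∃ c : ℝ, ∀ i j, 0 < K i j → Real.log (K i j) = c + (z i j : ℝ) / (q : ℝ)

/-! ### Implementations of Osborne's algorithm -/

/-- An implementation consists of a program `init`, run once at the beginning, and a program
`step`, run in each round after the block to be updated has been chosen. -/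
structure Implementation where
  init : Cmd
  step : Cmd

/-- `IsRun b I σ₀ s R T σ`: on `b`-bit words and with the block choices `s`, the implementation
`I` started in `σ₀` stops after exactly `R` rounds and `T` operations; `σ t` is the state after
`t` rounds. Besides the operations of its programs it is charged one operation for each choice
of a block and one for each test of the register `doneReg`. -/
def IsRun (b : ℕ) (I : Implementation) (σ₀ : State) {p : ℕ} (s : ℕ → Fin p) (R T : ℕ)
    (σ : ℕ → State) : Prop :=
  ∃ cost : ℕ → ℕ,
    Exec b I.init σ₀ (cost 0) (σ 0) ∧
    (∀ t < R, (σ t).reg doneReg = 0 ∧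
      Exec b I.step ((σ t).setReg selReg ((s t : ℕ) : ℤ)) (cost (t + 1)) (σ (t + 1))) ∧
    (σ R).reg doneReg ≠ 0 ∧
    T = (∑ t ∈ Finset.range (R + 1), cost t) + R + (R + 1)

/-- `x 0, …, x R` are iterates of Osborne's algorithm in which the blocks `s 0, s 1, …` are
updated, with each updated coordinate computed to accuracy `ε / n`. -/
def IsOsborneTrace {p : ℕ} (K : Matrix (Fin n) (Fin n) ℝ) (ε : ℝ) (color : Fin n → Fin p)
    (s : ℕ → Fin p) (R : ℕ) (x : ℕ → Fin n → ℝ) : Prop :=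
  x 0 = 0 ∧ ∀ t < R, ∀ k,
    (color k = s t → |x (t + 1) k - osborneUpdate K (x t) k| ≤ ε / n) ∧
    (color k ≠ s t → x (t + 1) k = x t k)

end Osborne

end

open Osborne

/-!
Osborne's algorithm is block coordinate descent for the convex function
`F(x) = ∑ᵢⱼ e^(xᵢ - xⱼ) Kᵢⱼ` (`total`), whose minimizers are the exact balancings. An exact update of
`x k` lowers `F` by at least `(√r_k - √c_k) ^ 2`, where `r_k` and `c_k` are the row and column sums of the
scaled matrix. The implementation works with fixed-point numbers, and it stops each move short
of the exact update by the maximal rounding error. Such a `Damped` move never overshoots: it does not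
increase `F`, it loses only the square of the rounding error in the decrease of `F` (relative to
`F`), and it cannot leave a box around a minimizer in the sup norm, because exact updates are
monotone and commute with translations. The box is what bounds the numbers that occur.

*Progress.* A `Sweep`, a sequence of damped moves of distinct coordinates, lowers `F` by a constant
fraction of the sum of `(√r_k - √c_k) ^ 2` over its coordinates, taken at its start, up to rounding
errors. Since
`‖r - c‖₁ ^ 2 ≤ 4 F ∑ (√r_k - √c_k) ^ 2`, and since by convexity the gap `g = log F(x) - min log F` is
at most `2 d log κ · ‖r - c‖₁ / F`, a sweep over all coordinates lowers `g` by at least a constant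
times `max (ε ^ 2) ((g / (d log κ)) ^ 2)` as long as it starts far from balance. Rewritten with a
concave function of `g` (`psi`, whose derivative is the reciprocal of this maximum), this is a decrease
of the potential by a constant, and the initial potential is of order `ε⁻¹ (ε⁻¹ ∧ d) log κ`. For
cyclic block choices this gives a deterministic bound on the number of cycles, better than the claim by
a factor `√p`. For independent block choices one round decreases the potential by `1 / p` of
this amount in expectation, and an exponential supermartingale (`Rounds.random_guarantee`) bounds the
expectation and the tail of the running time at the same time.

*Stopping.* The stopping test costs `O(m)` operations, which a round on a small block cannot afford.
It is therefore performed only after the rounds of block `0`, once in `p` rounds on average, so that it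
adds a constant factor to the cost of a cycle. The potential argument survives because a round from `x`
has probability `1 / p` of being a round of block `0`: if that round would stop, this alone makes
progress; if not, its end point is unbalanced, and then so is `x`, up to the progress of that round.

*The machine.* Row and column sums are computed in the logarithmic domain, by adding `e^y` and `e^z` as
`max y z + log (1 + e^(-|y - z|))` with rounding down, so that a sum of `n` terms has error `2 n` units.
The scale is `u = 3000 n ^ 2 ⌈1 / ε⌉`, which makes the accuracy of an update `3 n / u ≤ ε / (1000 n)`.
A program is specified by a bound on its cost and a postcondition (`Runs`). A block is swept
sequentially and in place; as it contains no edges, this is a simultaneous update. The stopping test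
divides all row and column sums by the largest row sum before it leaves the logarithmic domain.
-/

open MeasureTheory ProbabilityTheory

set_option autoImplicit false

namespace Osborne

variable {n : ℕ} {K : Matrix (Fin n) (Fin n) ℝ} {x y z : Fin n → ℝ} {k : Fin n} {η s : ℝ}

/-! ### Damped Osborne updates -/

/-- The total mass `F(x) = ∑ᵢⱼ e^{xᵢ - xⱼ} Kᵢⱼ`, the objective of matrix balancing. -/
noncomputable def total (K : Matrix (Fin n) (Fin n) ℝ) (x : Fin n → ℝ) : ℝ :=
  ∑ i, ∑ j, scaling K x i j

/-- The difference of the square roots of the `k`-th row and column sums. -/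
noncomputable def sqrtGap (K : Matrix (Fin n) (Fin n) ℝ) (x : Fin n → ℝ) (k : Fin n) : ℝ :=
  √(rowSum (scaling K x) k) - √(colSum (scaling K x) k)

/-- The entrywise square root of the scaling, in which distances are Hellinger distances. -/
noncomputable def hell (K : Matrix (Fin n) (Fin n) ℝ) (x : Fin n → ℝ) (i j : Fin n) : ℝ :=
  √(scaling K x i j)

/-- The squared Hellinger distance between the scalings by `x` and `y`. -/
noncomputable def hellDist (K : Matrix (Fin n) (Fin n) ℝ) (x y : Fin n → ℝ) : ℝ :=
  ∑ i, ∑ j, (hell K y i j - hell K x i j) ^ 2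

lemma scaling_nonneg (hK : ∀ i j, 0 ≤ K i j) (x : Fin n → ℝ) (i j : Fin n) :
    0 ≤ scaling K x i j := by
  unfold scaling
  have := hK i j
  positivity

lemma scaling_pos {i j : Fin n} (h : 0 < K i j) (x : Fin n → ℝ) : 0 < scaling K x i j := by
  unfold scaling
  positivity

lemma scaling_self (K : Matrix (Fin n) (Fin n) ℝ) (x : Fin n → ℝ) (k : Fin n) :
    scaling K x k k = K k k := by
  unfold scaling
  rw [mul_right_comm, ← Real.exp_add]; simp

lemma scaling_eq (K : Matrix (Fin n) (Fin n) ℝ) (x : Fin n → ℝ) (i j : Fin n) :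
    scaling K x i j = Real.exp (x i - x j) * K i j := by
  unfold scaling
  rw [mul_right_comm, ← Real.exp_add, sub_eq_add_neg]

lemma rowSum_nonneg (hK : ∀ i j, 0 ≤ K i j) (x : Fin n → ℝ) (k : Fin n) :
    0 ≤ rowSum (scaling K x) k := Finset.sum_nonneg fun j _ => scaling_nonneg hK x k j

lemma colSum_nonneg (hK : ∀ i j, 0 ≤ K i j) (x : Fin n → ℝ) (k : Fin n) :
    0 ≤ colSum (scaling K x) k := Finset.sum_nonneg fun j _ => scaling_nonneg hK x j k

lemma sum_rowSum (K : Matrix (Fin n) (Fin n) ℝ) (x : Fin n → ℝ) :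
    ∑ k, rowSum (scaling K x) k = total K x := rfl

lemma sum_colSum (K : Matrix (Fin n) (Fin n) ℝ) (x : Fin n → ℝ) :
    ∑ k, colSum (scaling K x) k = total K x := Finset.sum_comm

lemma rowSum_le_total (hK : ∀ i j, 0 ≤ K i j) (x : Fin n → ℝ) (k : Fin n) :
    rowSum (scaling K x) k ≤ total K x := by
  rw [← sum_rowSum]
  exact Finset.single_le_sum (f := fun k => rowSum (scaling K x) k)
    (fun i _ => rowSum_nonneg hK x i) (Finset.mem_univ k)

lemma colSum_le_total (hK : ∀ i j, 0 ≤ K i j) (x : Fin n → ℝ) (k : Fin n) :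
    colSum (scaling K x) k ≤ total K x := by
  rw [← sum_colSum]
  exact Finset.single_le_sum (f := fun k => colSum (scaling K x) k)
    (fun i _ => colSum_nonneg hK x i) (Finset.mem_univ k)

lemma total_nonneg (hK : ∀ i j, 0 ≤ K i j) (x : Fin n → ℝ) : 0 ≤ total K x :=
  Finset.sum_nonneg fun i _ => rowSum_nonneg hK x i

lemma total_update (K : Matrix (Fin n) (Fin n) ℝ) (x : Fin n → ℝ) (k : Fin n) (s : ℝ) :
    total K (Function.update x k (x k + s)) = total K x
      + rowSum (scaling K x) k * (Real.exp s - 1) + colSum (scaling K x) k * (Real.exp (-s) - 1)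
      - K k k * (Real.exp s + Real.exp (-s) - 2) := by
  have hent : ∀ i j, scaling K (Function.update x k (x k + s)) i j
      = scaling K x i j + (if i = k then scaling K x i j * (Real.exp s - 1) else 0)
        + (if j = k then scaling K x i j * (Real.exp (-s) - 1) else 0)
        - (if i = k then if j = k then scaling K x i j * (Real.exp s + Real.exp (-s) - 2) else 0
            else 0) := by
    intro i j
    have h1 : Real.exp s * Real.exp (-s) = 1 := by rw [← Real.exp_add]; simp
    unfold scaling
    by_cases hi : i = k <;> by_cases hj : j = k
    · subst hi; subst hj
      simp only [Function.update_self, if_true, Real.exp_add, neg_add]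
      linear_combination (Real.exp (x j) * K j j * Real.exp (-x j)) * h1
    · subst hi
      simp [hj, Real.exp_add]; ring
    · subst hj
      simp [hi, Real.exp_add]; ring
    · simp [hi, hj]
  unfold total
  simp only [hent, Finset.sum_add_distrib, Finset.sum_sub_distrib]
  congr 1
  · congr 1
    · congr 1
      rw [Finset.sum_comm]
      simp [rowSum, Finset.sum_mul]
    · simp [colSum, Finset.sum_mul]
  · have : ∀ i, (∑ j, if i = k then if j = k then
        scaling K x i j * (Real.exp s + Real.exp (-s) - 2) else 0 else 0)
        = if i = k then scaling K x i k * (Real.exp s + Real.exp (-s) - 2) else 0 := by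
      intro i; by_cases hi : i = k <;> simp [hi]
    simp only [this]
    simp [scaling_self]

lemma hell_sq (hK : ∀ i j, 0 ≤ K i j) (x : Fin n → ℝ) (i j : Fin n) :
    hell K x i j ^ 2 = scaling K x i j := Real.sq_sqrt (scaling_nonneg hK x i j)

lemma hell_mul (hK : ∀ i j, 0 ≤ K i j) (x y : Fin n → ℝ) (i j : Fin n) :
    hell K x i j * hell K y i j = scaling K (fun i => (x i + y i) / 2) i j := by
  unfold hell
  rw [← Real.sqrt_mul (scaling_nonneg hK x i j)]
  have : scaling K x i j * scaling K y i j = scaling K (fun i => (x i + y i) / 2) i j ^ 2 := by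
    simp only [scaling_eq]
    have : Real.exp (x i - x j) * Real.exp (y i - y j)
        = Real.exp ((x i + y i) / 2 - (x j + y j) / 2) ^ 2 := by
      rw [← Real.exp_add, ← Real.exp_nat_mul]; congr 1; push_cast; ring
    rw [mul_pow, ← this]; ring
  rw [this, Real.sqrt_sq (scaling_nonneg hK _ i j)]

lemma hell_congr {i j : Fin n} (hi : x i = y i) (hj : x j = y j) :
    hell K x i j = hell K y i j := by
  simp [hell, scaling, hi, hj]

/-- The Hellinger distance is the defect of midpoint convexity of the total mass. -/
lemma hellDist_eq (hK : ∀ i j, 0 ≤ K i j) (x y : Fin n → ℝ) :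
    hellDist K x y = total K x + total K y - 2 * total K (fun i => (x i + y i) / 2) := by
  have : ∀ i j, (hell K y i j - hell K x i j) ^ 2 = scaling K x i j + scaling K y i j
      - 2 * scaling K (fun i => (x i + y i) / 2) i j := by
    intro i j
    rw [← hell_mul hK, ← hell_sq hK x, ← hell_sq hK y]; ring
  simp only [hellDist, this, Finset.sum_add_distrib, Finset.sum_sub_distrib, ← Finset.mul_sum]
  rfl

/-- Half the logarithm of the ratio of column to row sum: the step of an exact Osborne update. -/
noncomputable def exactStep (K : Matrix (Fin n) (Fin n) ℝ) (x : Fin n → ℝ) (k : Fin n) : ℝ :=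
  (Real.log (colSum (scaling K x) k) - Real.log (rowSum (scaling K x) k)) / 2

/-- `y` arises from `x` by moving the coordinate `k` towards its exact Osborne update, without
overshooting, up to a distance of at most `η` from it. -/
def Damped (K : Matrix (Fin n) (Fin n) ℝ) (η : ℝ) (k : Fin n) (x y : Fin n → ℝ) : Prop :=
  ∃ s : ℝ, y = Function.update x k (x k + s) ∧
    ((0 ≤ s ∧ s ≤ exactStep K x k) ∨ (exactStep K x k ≤ s ∧ s ≤ 0)) ∧
    |s - exactStep K x k| ≤ η

lemma exp_exactStep (hr : 0 < rowSum (scaling K x) k) (hc : 0 < colSum (scaling K x) k) :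
    Real.exp (exactStep K x k) = √(colSum (scaling K x) k) / √(rowSum (scaling K x) k) := by
  unfold exactStep
  rw [sub_div, Real.exp_sub, ← Real.log_sqrt hc.le, ← Real.log_sqrt hr.le,
    Real.exp_log (Real.sqrt_pos.2 hc), Real.exp_log (Real.sqrt_pos.2 hr)]

/-- The change of the total mass in the second half of a step that does not overshoot, where `t ^ 2` is
the exponential of the step and `a` the diagonal entry. -/
lemma damped_ineq {r c a t : ℝ} (ha : 0 ≤ a) (hr : 0 ≤ r) (ht : 1 ≤ t)
    (h : r * t ^ 4 ≤ c) :
    r * (t ^ 2 - t) + c * ((t ^ 2)⁻¹ - t⁻¹) - a * (t ^ 2 + (t ^ 2)⁻¹ - t - t⁻¹) ≤ 0 := by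
  have ht0 : 0 < t := by linarith
  have e : r * (t ^ 2 - t) + c * ((t ^ 2)⁻¹ - t⁻¹) - a * (t ^ 2 + (t ^ 2)⁻¹ - t - t⁻¹)
      = (t - 1) * ((r * t ^ 3 - c) - a * (t ^ 3 - 1)) / t ^ 2 := by
    field_simp; ring
  rw [e]
  apply div_nonpos_of_nonpos_of_nonneg _ (by positivity)
  apply mul_nonpos_of_nonneg_of_nonpos (by linarith)
  have h1 : r * t ^ 3 ≤ r * t ^ 4 := by
    apply mul_le_mul_of_nonneg_left _ hr
    exact pow_le_pow_right₀ ht (by norm_num)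
  have h2 : (1 : ℝ) ≤ t ^ 3 := one_le_pow₀ ht
  nlinarith

/-- A damped step decreases the total mass by at least the squared Hellinger distance moved. -/
lemma Damped.hellDist_le (hK : ∀ i j, 0 ≤ K i j) (hr : 0 < rowSum (scaling K x) k)
    (hc : 0 < colSum (scaling K x) k) (h : Damped K η k x y) :
    hellDist K x y ≤ total K x - total K y := by
  obtain ⟨s, rfl, hs, -⟩ := h
  rw [hellDist_eq hK]
  have hmid : (fun i => (x i + Function.update x k (x k + s) i) / 2)
      = Function.update x k (x k + s / 2) := by
    ext i
    by_cases hi : i = k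
    · subst hi; simp; ring
    · simp [Function.update_of_ne hi]
  rw [hmid, total_update, total_update]
  set r := rowSum (scaling K x) k
  set c := colSum (scaling K x) k
  have hexp := exp_exactStep hr hc
  have hr' : 0 < √r := Real.sqrt_pos.2 hr
  have hc' : 0 < √c := Real.sqrt_pos.2 hc
  have hrr : √r ^ 2 = r := Real.sq_sqrt hr.le
  have hcc : √c ^ 2 = c := Real.sq_sqrt hc.le
  have e1 : Real.exp s = Real.exp (s / 2) ^ 2 := by
    rw [← Real.exp_nat_mul]; congr 1; push_cast; ring
  have e2 : Real.exp (-s) = (Real.exp (s / 2) ^ 2)⁻¹ := by rw [Real.exp_neg, e1]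
  have e3 : Real.exp (-(s / 2)) = (Real.exp (s / 2))⁻¹ := Real.exp_neg _
  rw [e2, e3, e1]
  set t := Real.exp (s / 2)
  have ht : 0 < t := Real.exp_pos _
  rcases hs with ⟨h0, h1⟩ | ⟨h1, h0⟩
  · have := Real.exp_le_exp.2 h1
    rw [hexp, e1, le_div_iff₀ hr'] at this
    have h4 : r * t ^ 4 ≤ c := by
      rw [← hrr, ← hcc]
      have := pow_le_pow_left₀ (by positivity) this 2
      nlinarith
    have := damped_ineq (hK k k) hr.le (Real.one_le_exp (by linarith : 0 ≤ s / 2)) h4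
    linarith
  · have := Real.exp_le_exp.2 h1
    rw [hexp, e1, div_le_iff₀ hr'] at this
    have h4 : c * (t⁻¹) ^ 4 ≤ r := by
      have := pow_le_pow_left₀ (by positivity) this 2
      have h5 : c ≤ r * t ^ 4 := by rw [← hrr, ← hcc]; nlinarith
      rw [inv_pow, ← div_eq_mul_inv, div_le_iff₀ (by positivity)]
      exact h5
    have h6 : 1 ≤ t⁻¹ := by
      rw [← Real.exp_neg]; exact Real.one_le_exp (by linarith)
    have := damped_ineq (hK k k) hc.le h6 h4
    simp only [inv_pow, inv_inv] at this
    linarith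

lemma Damped.total_le (hK : ∀ i j, 0 ≤ K i j) (hr : 0 < rowSum (scaling K x) k)
    (hc : 0 < colSum (scaling K x) k) (h : Damped K η k x y) : total K y ≤ total K x := by
  have := h.hellDist_le hK hr hc
  have h0 : 0 ≤ hellDist K x y :=
    Finset.sum_nonneg fun i _ => Finset.sum_nonneg fun j _ => sq_nonneg _
  linarith

lemma exp_add_exp_neg_le {u : ℝ} (hu : |u| ≤ 1) : Real.exp u + Real.exp (-u) - 2 ≤ 2 * u ^ 2 := by
  have h1 := Real.abs_exp_sub_one_sub_id_le hu
  have h2 := Real.abs_exp_sub_one_sub_id_le (x := -u) (by simpa using hu)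
  have := (abs_le.1 h1).2
  have := (abs_le.1 h2).2
  nlinarith

/-- A damped step of accuracy `η` decreases the total mass almost as much as an exact one. -/
lemma Damped.sqrtGap_sq_le (hK : ∀ i j, 0 ≤ K i j) (hr : 0 < rowSum (scaling K x) k)
    (hc : 0 < colSum (scaling K x) k) (hη : η ≤ 1) (h : Damped K η k x y) :
    sqrtGap K x k ^ 2 ≤ total K x - total K y + 2 * η ^ 2 * total K x := by
  obtain ⟨s, rfl, hs, hsη⟩ := h
  rw [total_update]
  have hrF := rowSum_le_total hK x k
  have hcF := colSum_le_total hK x k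
  unfold sqrtGap
  set r := rowSum (scaling K x) k
  set c := colSum (scaling K x) k
  have hr' : 0 < √r := Real.sqrt_pos.2 hr
  have hc' : 0 < √c := Real.sqrt_pos.2 hc
  have hrr : √r ^ 2 = r := Real.sq_sqrt hr.le
  have hcc : √c ^ 2 = c := Real.sq_sqrt hc.le
  set u := s - exactStep K x k with hu
  have hexp := exp_exactStep hr hc
  have hs' : s = exactStep K x k + u := by rw [hu]; ring
  have e1 : r * Real.exp s = √r * √c * Real.exp u := by
    rw [hs', Real.exp_add, hexp]
    change r * (√c / √r * _) = _
    field_simp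
    rw [hrr]
  have e2 : c * Real.exp (-s) = √r * √c * Real.exp (-u) := by
    rw [hs', neg_add, Real.exp_add, Real.exp_neg (exactStep K x k), hexp, inv_div]
    change c * (√r / √c * _) = _
    field_simp
    rw [hcc]
  have h1 := exp_add_exp_neg_le (hsη.trans hη)
  have h2 : u ^ 2 ≤ η ^ 2 := sq_le_sq' (abs_le.1 hsη).1 (abs_le.1 hsη).2
  have h3 : √r * √c ≤ total K x := by nlinarith [sq_nonneg (√r - √c)]
  have h4 : 0 ≤ Real.exp s + Real.exp (-s) - 2 := by
    have := Real.add_one_le_exp s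
    have := Real.add_one_le_exp (-s)
    linarith
  have h5 : √r * √c * (Real.exp u + Real.exp (-u) - 2) ≤ total K x * (2 * η ^ 2) := by
    apply mul_le_mul h3 (by linarith) _ (total_nonneg hK x)
    have := Real.add_one_le_exp u
    have := Real.add_one_le_exp (-u)
    linarith
  have h6 := mul_nonneg (hK k k) h4
  nlinarith

/-! ### Sweeps over several coordinates -/

/-- `z` arises from `x` by damped steps on the coordinates in a list, one after the other. -/
inductive Sweep (K : Matrix (Fin n) (Fin n) ℝ) (η : ℝ) :
    List (Fin n) → (Fin n → ℝ) → (Fin n → ℝ) → Prop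
  | nil (x : Fin n → ℝ) : Sweep K η [] x x
  | cons {k : Fin n} {ks : List (Fin n)} {x y z : Fin n → ℝ} :
      Damped K η k x y → Sweep K η ks y z → Sweep K η (k :: ks) x z

lemma Sweep.append {ks ls : List (Fin n)} (h : Sweep K η ks x y) (h' : Sweep K η ls y z) :
    Sweep K η (ks ++ ls) x z := by
  induction h with
  | nil => exact h'
  | cons hd _ ih => exact .cons hd (ih h')

/-- Every row and every column has positive sum. -/
def PosSums (K : Matrix (Fin n) (Fin n) ℝ) : Prop :=
  ∀ x k, 0 < rowSum (scaling K x) k ∧ 0 < colSum (scaling K x) k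

lemma Sweep.total_le (hK : ∀ i j, 0 ≤ K i j) (hP : PosSums K) {ks : List (Fin n)}
    (h : Sweep K η ks x z) : total K z ≤ total K x := by
  induction h with
  | nil => exact le_rfl
  | cons hd _ ih => exact ih.trans (hd.total_le hK (hP _ _).1 (hP _ _).2)

lemma Damped.apply_ne (h : Damped K η k x y) {j : Fin n} (hj : j ≠ k) : y j = x j := by
  obtain ⟨s, rfl, -⟩ := h
  exact Function.update_of_ne hj _ _

/-- Reverse triangle inequality for the square roots of sums of squares. -/
lemma sq_sqrt_sub_sqrt_le {ι : Type*} (S : Finset ι) (f g : ι → ℝ) :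
    (√(∑ i ∈ S, f i ^ 2) - √(∑ i ∈ S, g i ^ 2)) ^ 2 ≤ ∑ i ∈ S, (f i - g i) ^ 2 := by
  have h := Real.sum_mul_le_sqrt_mul_sqrt S f g
  have h1 := Real.sq_sqrt (Finset.sum_nonneg fun i (_ : i ∈ S) => sq_nonneg (f i))
  have h2 := Real.sq_sqrt (Finset.sum_nonneg fun i (_ : i ∈ S) => sq_nonneg (g i))
  have h3 : ∑ i ∈ S, (f i - g i) ^ 2
      = ∑ i ∈ S, f i ^ 2 + ∑ i ∈ S, g i ^ 2 - 2 * ∑ i ∈ S, f i * g i := by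
    rw [Finset.mul_sum, ← Finset.sum_add_distrib, ← Finset.sum_sub_distrib]
    exact Finset.sum_congr rfl fun i _ => by ring
  rw [h3]; nlinarith

/-- The squared Hellinger distance between the `k`-th rows plus that between the `k`-th columns. -/
noncomputable def crossDist (K : Matrix (Fin n) (Fin n) ℝ) (k : Fin n) (x y : Fin n → ℝ) : ℝ :=
  ∑ b, ((hell K y k b - hell K x k b) ^ 2 + (hell K y b k - hell K x b k) ^ 2)

lemma sqrtGap_sub_sq_le (hK : ∀ i j, 0 ≤ K i j) (x y : Fin n → ℝ) (k : Fin n) :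
    (sqrtGap K y k - sqrtGap K x k) ^ 2 ≤ 2 * crossDist K k x y := by
  have h1 := sq_sqrt_sub_sqrt_le Finset.univ (fun b => hell K y k b) (fun b => hell K x k b)
  have h2 := sq_sqrt_sub_sqrt_le Finset.univ (fun b => hell K y b k) (fun b => hell K x b k)
  simp only [hell_sq hK] at h1 h2
  rw [crossDist, Finset.sum_add_distrib]
  unfold sqrtGap rowSum colSum
  nlinarith [sq_nonneg ((√(∑ j, scaling K y k j) - √(∑ j, scaling K x k j))
    + (√(∑ j, scaling K y j k) - √(∑ j, scaling K x j k)))]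

lemma sum_crossDist (x y : Fin n → ℝ) : ∑ k, crossDist K k x y = 2 * hellDist K x y := by
  simp only [crossDist, Finset.sum_add_distrib, hellDist]
  rw [Finset.sum_comm (f := fun k b => (hell K y b k - hell K x b k) ^ 2)]
  ring

/-- A step on `k` changes only two entries in the cross of another coordinate `j`. As long as
neither of `j`, `k` has moved away from the reference point `w`, these entries are moved for the
first time. -/
lemma Damped.crossDist_eq (h : Damped K η k x y) {w : Fin n → ℝ} {j : Fin n} (hjk : j ≠ k)
    (hj : x j = w j) (hk : x k = w k) :
    crossDist K j w y = crossDist K j w x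
      + ((hell K y j k - hell K x j k) ^ 2 + (hell K y k j - hell K x k j) ^ 2) := by
  unfold crossDist
  rw [← Finset.sum_erase_add _ _ (Finset.mem_univ k),
    ← Finset.sum_erase_add (Finset.univ) _ (Finset.mem_univ k)]
  have e1 : hell K x j k = hell K w j k := hell_congr hj hk
  have e2 : hell K x k j = hell K w k j := hell_congr hk hj
  rw [e1, e2]
  have : ∀ b ∈ Finset.univ.erase k, hell K y j b = hell K x j b ∧ hell K y b j = hell K x b j := by
    intro b hb
    have hb' := Finset.ne_of_mem_erase hb
    exact ⟨hell_congr (h.apply_ne hjk) (h.apply_ne hb'),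
      hell_congr (h.apply_ne hb') (h.apply_ne hjk)⟩
  rw [Finset.sum_congr rfl fun b hb => by rw [(this b hb).1, (this b hb).2]]
  simp

lemma sum_list_cross_le {ks : List (Fin n)} (hnd : ks.Nodup) (hk : k ∉ ks) (x y : Fin n → ℝ) :
    (ks.map fun j => (hell K y j k - hell K x j k) ^ 2 + (hell K y k j - hell K x k j) ^ 2).sum
      ≤ hellDist K x y := by
  rw [← List.sum_toFinset _ hnd, Finset.sum_add_distrib]
  set d : Fin n → Fin n → ℝ := fun i j => (hell K y i j - hell K x i j) ^ 2 with hd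
  have h1 : ∑ j ∈ ks.toFinset, d k j ≤ ∑ j, d k j :=
    Finset.sum_le_univ_sum_of_nonneg fun j => sq_nonneg _
  have h2 : ∑ j ∈ ks.toFinset, d j k ≤ ∑ i ∈ Finset.univ.erase k, ∑ j, d i j := by
    calc ∑ j ∈ ks.toFinset, d j k ≤ ∑ i ∈ Finset.univ.erase k, d i k := by
          apply Finset.sum_le_sum_of_subset_of_nonneg
          · intro i hi
            exact Finset.mem_erase.2 ⟨fun e => hk (by simpa [e] using hi), Finset.mem_univ _⟩
          · intro i _ _; exact sq_nonneg _
      _ ≤ _ := Finset.sum_le_sum fun i _ =>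
          Finset.single_le_sum (f := fun j => d i j) (fun j _ => sq_nonneg _) (Finset.mem_univ k)
  have h3 : hellDist K x y = ∑ i ∈ Finset.univ.erase k, ∑ j, d i j + ∑ j, d k j := by
    rw [Finset.sum_erase_add _ _ (Finset.mem_univ k)]; rfl
  rw [h3]
  exact add_le_add h2 h1

/-- The induction behind `Sweep.sum_sqrtGap_le`: the sweep is in progress, `w` is its starting point, and
the coordinates in `ks` have not been moved yet. -/
lemma Sweep.sum_sqrtGap_le_aux (hK : ∀ i j, 0 ≤ K i j) (hP : PosSums K) (hη : η ≤ 1)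
    {w : Fin n → ℝ} {ks : List (Fin n)} (h : Sweep K η ks x z) (hnd : ks.Nodup)
    (hw : ∀ k ∈ ks, x k = w k) (hF : total K x ≤ total K w) :
    (ks.map fun k => sqrtGap K w k ^ 2).sum ≤ 6 * (total K x - total K z)
      + 4 * (ks.map fun k => crossDist K k w x).sum + ks.length * (4 * η ^ 2 * total K w) := by
  induction h with
  | nil => simp
  | @cons k ks x y z hd hs ih =>
    have hnd' := List.nodup_cons.1 hnd
    have hxk : x k = w k := hw k (by simp)
    have hle := hd.total_le hK (hP _ _).1 (hP _ _).2
    have hwy : ∀ j ∈ ks, y j = w j := fun j hj => by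
      rw [hd.apply_ne (fun e => hnd'.1 (e ▸ hj)), hw j (by simp [hj])]
    have ih' := ih hnd'.2 hwy (hle.trans hF)
    have hcross : (ks.map fun j => crossDist K j w y).sum
        ≤ (ks.map fun j => crossDist K j w x).sum + (total K x - total K y) := by
      have : (ks.map fun j => crossDist K j w y) = ks.map fun j => crossDist K j w x
          + ((hell K y j k - hell K x j k) ^ 2 + (hell K y k j - hell K x k j) ^ 2) := by
        apply List.map_congr_left
        intro j hj
        exact hd.crossDist_eq (fun e => hnd'.1 (e ▸ hj)) (hw j (by simp [hj])) hxk
      rw [this, List.sum_map_add]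
      have := sum_list_cross_le (K := K) hnd'.2 hnd'.1 x y
      have := hd.hellDist_le hK (hP _ _).1 (hP _ _).2
      linarith
    have h1 := hd.sqrtGap_sq_le hK (hP _ _).1 (hP _ _).2 hη
    have h2 := sqrtGap_sub_sq_le hK w x k
    have h3 : sqrtGap K w k ^ 2 ≤ 2 * sqrtGap K x k ^ 2
        + 2 * (sqrtGap K x k - sqrtGap K w k) ^ 2 := by
      nlinarith [sq_nonneg (2 * sqrtGap K x k - sqrtGap K w k)]
    have h4 : η ^ 2 * total K x ≤ η ^ 2 * total K w :=
      mul_le_mul_of_nonneg_left hF (sq_nonneg η)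
    simp only [List.map_cons, List.sum_cons, List.length_cons]
    push_cast
    linarith

/-- A sweep over distinct coordinates decreases the total mass by a constant fraction of the
imbalance of these coordinates at its start, whatever their order. -/
lemma Sweep.sum_sqrtGap_le (hK : ∀ i j, 0 ≤ K i j) (hP : PosSums K) (hη : η ≤ 1)
    {ks : List (Fin n)} (h : Sweep K η ks x z) (hnd : ks.Nodup) :
    (ks.map fun k => sqrtGap K x k ^ 2).sum ≤ 6 * (total K x - total K z)
      + ks.length * (4 * η ^ 2 * total K x) := by
  have := h.sum_sqrtGap_le_aux hK hP hη hnd (fun _ _ => rfl) le_rfl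
  simpa [crossDist] using this

/-- The squared Hellinger distance in which the entries with an index in `ks` count double. -/
noncomputable def weightedDist (K : Matrix (Fin n) (Fin n) ℝ) (ks : List (Fin n))
    (x y : Fin n → ℝ) : ℝ :=
  ∑ i, ∑ j, (if i ∈ ks ∨ j ∈ ks then 2 else 1) * (hell K y i j - hell K x i j) ^ 2

lemma Damped.weightedDist_le (h : Damped K η k x y) {w : Fin n → ℝ} {ks : List (Fin n)}
    (hk : k ∉ ks) (hw : ∀ j ∈ k :: ks, x j = w j) :
    weightedDist K ks w y ≤ weightedDist K (k :: ks) w x + 2 * hellDist K x y := by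
  unfold weightedDist hellDist
  rw [Finset.mul_sum, ← Finset.sum_add_distrib]
  refine Finset.sum_le_sum fun i _ => ?_
  rw [Finset.mul_sum, ← Finset.sum_add_distrib]
  refine Finset.sum_le_sum fun j _ => ?_
  have key : ∀ p q r : ℝ, (p - r) ^ 2 ≤ 2 * (q - r) ^ 2 + 2 * (p - q) ^ 2 := fun p q r => by
    nlinarith [sq_nonneg (p - 2 * q + r)]
  by_cases hik : i = k
  · by_cases hj : j ∈ k :: ks
    · -- the entry has not been moved before
      have e : hell K x i j = hell K w i j := hell_congr (hw i (by simp [hik])) (hw j hj)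
      rw [e]
      split_ifs <;> nlinarith [sq_nonneg (hell K y i j - hell K w i j)]
    · have h1 : ¬ (i ∈ ks ∨ j ∈ ks) := by
        rintro (h | h)
        · exact hk (hik ▸ h)
        · exact hj (by simp [h])
      have h2 : i ∈ k :: ks ∨ j ∈ k :: ks := Or.inl (by simp [hik])
      rw [if_neg h1, if_pos h2, one_mul]
      exact key _ _ _
  · by_cases hjk : j = k
    · by_cases hi : i ∈ k :: ks
      · have e : hell K x i j = hell K w i j := hell_congr (hw i hi) (hw j (by simp [hjk]))
        rw [e]
        split_ifs <;> nlinarith [sq_nonneg (hell K y i j - hell K w i j)]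
      · have h1 : ¬ (i ∈ ks ∨ j ∈ ks) := by
          rintro (h | h)
          · exact hi (by simp [h])
          · exact hk (hjk ▸ h)
        have h2 : i ∈ k :: ks ∨ j ∈ k :: ks := Or.inr (by simp [hjk])
        rw [if_neg h1, if_pos h2, one_mul]
        exact key _ _ _
    · have e : hell K y i j = hell K x i j := hell_congr (h.apply_ne hik) (h.apply_ne hjk)
      rw [e]
      simp [hik, hjk]

/-- A sweep over distinct coordinates moves every entry at most twice, hence not far. -/
lemma Sweep.hellDist_le (hK : ∀ i j, 0 ≤ K i j) (hP : PosSums K)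
    {ks : List (Fin n)} (h : Sweep K η ks x z) (hnd : ks.Nodup) :
    hellDist K x z ≤ 2 * (total K x - total K z) := by
  suffices H : ∀ w, (∀ k ∈ ks, x k = w k) →
      hellDist K w z ≤ weightedDist K ks w x + 2 * (total K x - total K z) by
    have := H x fun _ _ => rfl
    simpa [weightedDist] using this
  intro w hw
  induction h with
  | nil => simp [hellDist, weightedDist]
  | @cons k ks x y z hd hs ih =>
    have hnd' := List.nodup_cons.1 hnd
    have hwy : ∀ j ∈ ks, y j = w j := fun j hj => by
      rw [hd.apply_ne (fun e => hnd'.1 (e ▸ hj)), hw j (by simp [hj])]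
    have h1 := ih hnd'.2 hwy
    have h2 := hd.weightedDist_le hnd'.1 hw
    have h3 := hd.hellDist_le hK (hP _ _).1 (hP _ _).2
    linarith

end Osborne

namespace Osborne

variable {n : ℕ} {K : Matrix (Fin n) (Fin n) ℝ} {x y z : Fin n → ℝ} {k : Fin n} {η s ε : ℝ}

/-! ### Irreducible matrices: walks, diameter, condition number -/

lemma posSums_of_isIrreducible (hn : 2 ≤ n) (hK : K.IsIrreducible) : PosSums K := by
  have : Nontrivial (Fin n) := Fin.nontrivial_iff_two_le.2 hn
  intro x k
  constructor
  · obtain ⟨j, hj⟩ := hK.exists_pos k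
    exact Finset.sum_pos' (fun j _ => scaling_nonneg hK.nonneg x k j)
      ⟨j, Finset.mem_univ _, scaling_pos hj x⟩
  · obtain ⟨j, hj⟩ := hK.transpose.exists_pos k
    replace hj : 0 < K j k := hj
    exact Finset.sum_pos' (fun j _ => scaling_nonneg hK.nonneg x j k)
      ⟨j, Finset.mem_univ _, scaling_pos hj x⟩

/-- The positive entries of powers of `K` come from walks. -/
lemma hasWalk_of_pow_pos (hK : ∀ i j, 0 ≤ K i j) (l : ℕ) :
    ∀ u v, 0 < (K ^ l) u v → HasWalk K u v l := by
  induction l with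
  | zero =>
    intro u v h
    have : u = v := by
      by_contra hne
      simp [hne] at h
    exact ⟨fun _ => u, rfl, this, by simp⟩
  | succ l ih =>
    intro u v h
    rw [pow_succ', Matrix.mul_apply] at h
    obtain ⟨w, -, hw⟩ := Finset.exists_ne_zero_of_sum_ne_zero h.ne'
    have hpow : ∀ (m : ℕ) i j, 0 ≤ (K ^ m) i j := by
      intro m
      induction m with
      | zero => intro i j; by_cases hij : i = j <;> simp [hij]
      | succ m ihm =>
        intro i j
        rw [pow_succ, Matrix.mul_apply]
        exact Finset.sum_nonneg fun b _ => mul_nonneg (ihm i b) (hK b j)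
    have h1 : 0 < K u w := lt_of_le_of_ne (hK u w) (Ne.symm (left_ne_zero_of_mul hw))
    have h2 : 0 < (K ^ l) w v :=
      lt_of_le_of_ne (hpow l w v) (Ne.symm (right_ne_zero_of_mul hw))
    obtain ⟨f, hf0, hfl, hf⟩ := ih w v h2
    refine ⟨fun t => if t = 0 then u else f (t - 1), by simp, by simp [hfl], ?_⟩
    intro t ht
    rcases t with _ | t
    · simpa [hf0] using h1
    · simpa using hf t (by omega)

lemma exists_walk_le_diam (hK : K.IsIrreducible) (u v : Fin n) :
    ∃ l ≤ diam K, HasWalk K u v l := by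
  have hne : {d | ∀ u v, ∃ l ≤ d, HasWalk K u v l}.Nonempty := by
    have h := (Matrix.isIrreducible_iff_exists_pow_pos hK.nonneg).1 hK
    choose f hf using h
    refine ⟨∑ u, ∑ v, f u v, fun u v => ⟨f u v, ?_, hasWalk_of_pow_pos hK.nonneg _ _ _ (hf u v).2⟩⟩
    calc f u v ≤ ∑ v, f u v := Finset.single_le_sum (fun _ _ => Nat.zero_le _) (Finset.mem_univ v)
      _ ≤ _ := Finset.single_le_sum (f := fun u => ∑ v, f u v) (fun _ _ => Nat.zero_le _)
          (Finset.mem_univ u)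
  exact Nat.sInf_mem hne u v

lemma one_le_diam (hn : 2 ≤ n) (hK : K.IsIrreducible) : 1 ≤ diam K := by
  obtain ⟨l, hl, w, h0, h1, -⟩ := exists_walk_le_diam hK ⟨0, by omega⟩ ⟨1, by omega⟩
  rcases Nat.eq_zero_or_pos l with rfl | h
  · rw [h0] at h1; simp at h1
  · omega

/-- A shortest walk visits no vertex twice. -/
lemma diam_le (hK : K.IsIrreducible) : diam K ≤ n := by
  apply Nat.sInf_le
  intro u v
  classical
  have hex : ∃ l, HasWalk K u v l := by
    obtain ⟨l, -, h⟩ := exists_walk_le_diam hK u v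
    exact ⟨l, h⟩
  refine ⟨Nat.find hex, ?_, Nat.find_spec hex⟩
  obtain ⟨w, h0, hl, hw⟩ := Nat.find_spec hex
  set l := Nat.find hex with hldef
  by_contra hgt
  push Not at hgt
  have hinj : ¬ Function.Injective (fun t : Fin l => w t) := by
    intro hi
    have := Fintype.card_le_of_injective _ hi
    simp at this
    omega
  obtain ⟨s, t, hst, hlt⟩ : ∃ s t : Fin l, w s = w t ∧ s < t := by
    simp only [Function.Injective, not_forall] at hinj
    obtain ⟨s, t, h, hne⟩ := hinj
    rcases lt_or_gt_of_ne hne with h' | h'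
    · exact ⟨s, t, h, h'⟩
    · exact ⟨t, s, h.symm, h'⟩
  have hst' : (s : ℕ) < t := hlt
  have htl : (t : ℕ) < l := t.2
  have hshort : HasWalk K u v (l - (t - s)) := by
    refine ⟨fun r => if r ≤ s then w r else w (r + (t - s)), by simp [h0], ?_, ?_⟩
    · have e1 : ¬ (l - (t - s) ≤ (s : ℕ)) := by omega
      have e2 : l - (t - s) + (t - s) = l := by omega
      simp only [e1, if_false, e2, hl]
    · intro r hr
      by_cases h1 : r + 1 ≤ s
      · simp only [h1, if_true, show r ≤ (s : ℕ) by omega]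
        exact hw r (by omega)
      · by_cases h2 : r = s
        · subst h2
          simp only [le_refl, if_true, h1, if_false]
          rw [show (s : ℕ) + 1 + (t - s) = t + 1 by omega, hst]
          exact hw t htl
        · simp only [show ¬ (r ≤ (s : ℕ)) by omega, if_false, h1]
          rw [show r + 1 + (t - s) = (r + (t - s)) + 1 by omega]
          exact hw _ (by omega)
  have := Nat.find_min' hex hshort
  omega

lemma posEntries_finite (K : Matrix (Fin n) (Fin n) ℝ) :
    {v | 0 < v ∧ ∃ i j, K i j = v}.Finite := by
  apply (Set.finite_range fun e : Fin n × Fin n => K e.1 e.2).subset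
  rintro v ⟨-, i, j, rfl⟩
  exact ⟨(i, j), rfl⟩

lemma Kmin_le {i j : Fin n} (h : 0 < K i j) : Kmin K ≤ K i j :=
  csInf_le ⟨0, fun _ hv => hv.1.le⟩ ⟨h, i, j, rfl⟩

lemma Kmin_pos (hn : 2 ≤ n) (hK : K.IsIrreducible) : 0 < Kmin K := by
  have : Nontrivial (Fin n) := Fin.nontrivial_iff_two_le.2 hn
  obtain ⟨j, hj⟩ := hK.exists_pos ⟨0, by omega⟩
  exact ((Set.Nonempty.csInf_mem ⟨_, hj, _, _, rfl⟩ (posEntries_finite K) :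
    Kmin K ∈ {v | 0 < v ∧ ∃ i j, K i j = v})).1

lemma le_Kmax (K : Matrix (Fin n) (Fin n) ℝ) (i j : Fin n) : K i j ≤ Kmax K := by
  refine le_csSup (Set.Finite.bddAbove ?_) ⟨i, j, rfl⟩
  apply (Set.finite_range fun e : Fin n × Fin n => K e.1 e.2).subset
  rintro v ⟨i, j, rfl⟩
  exact ⟨(i, j), rfl⟩

lemma total_zero (K : Matrix (Fin n) (Fin n) ℝ) : total K 0 = ∑ i, ∑ j, K i j := by
  simp [total, scaling]

lemma nnz_eq_sum (K : Matrix (Fin n) (Fin n) ℝ) :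
    nnz K = ∑ i, (Finset.univ.filter fun j => 0 < K i j).card := by
  classical
  unfold nnz
  rw [Nat.card_eq_fintype_card, Fintype.card_subtype]
  rw [← Finset.card_sigma]
  apply Finset.card_nbij' (fun e => ⟨e.1, e.2⟩) (fun e => (e.1, e.2)) <;>
    simp [Set.MapsTo, Set.LeftInvOn, Set.RightInvOn]

lemma le_nnz (hn : 2 ≤ n) (hK : K.IsIrreducible) : n ≤ nnz K := by
  have : Nontrivial (Fin n) := Fin.nontrivial_iff_two_le.2 hn
  rw [nnz_eq_sum]
  calc n = ∑ _i : Fin n, 1 := by simp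
    _ ≤ _ := Finset.sum_le_sum fun i _ => by
      obtain ⟨j, hj⟩ := hK.exists_pos i
      exact Finset.card_pos.2 ⟨j, by simpa using hj⟩

lemma nnz_mul_Kmin_le (hK : K.IsIrreducible) :
    nnz K * Kmin K ≤ ∑ i, ∑ j, K i j := by
  rw [nnz_eq_sum]
  push_cast
  rw [Finset.sum_mul]
  refine Finset.sum_le_sum fun i _ => ?_
  calc _ ≤ ∑ j ∈ Finset.univ.filter fun j => 0 < K i j, K i j := by
        rw [← nsmul_eq_mul]
        exact Finset.card_nsmul_le_sum _ _ _ fun j hj => Kmin_le (Finset.mem_filter.1 hj).2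
    _ ≤ _ := Finset.sum_le_univ_sum_of_nonneg fun j => hK.nonneg i j

lemma two_le_cond (hn : 2 ≤ n) (hK : K.IsIrreducible) : 2 ≤ cond K := by
  unfold cond
  rw [le_div_iff₀ (Kmin_pos hn hK)]
  refine le_trans ?_ (nnz_mul_Kmin_le hK)
  apply mul_le_mul_of_nonneg_right _ (Kmin_pos hn hK).le
  exact_mod_cast hn.trans (le_nnz hn hK)

lemma half_le_log_cond (hn : 2 ≤ n) (hK : K.IsIrreducible) : 1 / 2 ≤ Real.log (cond K) := by
  have h1 := Real.log_le_log (by norm_num) (two_le_cond hn hK)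
  have h2 := Real.log_two_gt_d9
  linarith

/-- The largest possible spread `d log κ` of a scaling that is no heavier than `K` itself. -/
noncomputable def spread (K : Matrix (Fin n) (Fin n) ℝ) : ℝ := diam K * Real.log (cond K)

lemma spread_pos (hn : 2 ≤ n) (hK : K.IsIrreducible) : 0 < spread K := by
  have h1 := half_le_log_cond hn hK
  have h2 : (1 : ℝ) ≤ diam K := by exact_mod_cast one_le_diam hn hK
  unfold spread
  nlinarith

lemma sub_le_log_cond (hn : 2 ≤ n) (hK : K.IsIrreducible) (hx : total K x ≤ total K 0)
    {i j : Fin n} (hij : 0 < K i j) : x i - x j ≤ Real.log (cond K) := by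
  have hm := Kmin_pos hn hK
  have h1 : scaling K x i j ≤ total K x := by
    refine le_trans ?_ (rowSum_le_total hK.nonneg x i)
    exact Finset.single_le_sum (f := fun j => scaling K x i j)
      (fun j _ => scaling_nonneg hK.nonneg x i j) (Finset.mem_univ j)
  rw [scaling_eq] at h1
  rw [Real.le_log_iff_exp_le (by linarith [two_le_cond hn hK]), cond, le_div_iff₀ hm, ← total_zero]
  exact (mul_le_mul_of_nonneg_left (Kmin_le hij) (Real.exp_pos _).le).trans (h1.trans hx)

/-- Following a walk: the coordinates of a scaling no heavier than `K` differ by at most `spread K`. -/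
lemma sub_le_spread (hn : 2 ≤ n) (hK : K.IsIrreducible) (hx : total K x ≤ total K 0)
    (i j : Fin n) : x i - x j ≤ spread K := by
  obtain ⟨l, hl, w, h0, h1, hw⟩ := exists_walk_le_diam hK i j
  have hlog := half_le_log_cond hn hK
  have : ∀ t ≤ l, x (w 0) - x (w t) ≤ t * Real.log (cond K) := by
    intro t
    induction t with
    | zero => simp
    | succ t ih =>
      intro ht
      have := ih (by omega)
      have := sub_le_log_cond hn hK hx (hw t (by omega))
      push_cast
      linarith
  have h2 := this l le_rfl
  rw [h0, h1] at h2
  refine h2.trans ?_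
  unfold spread
  gcongr

/-! ### The optimal scaling -/

lemma total_add_const (K : Matrix (Fin n) (Fin n) ℝ) (x : Fin n → ℝ) (c : ℝ) :
    total K (fun i => x i + c) = total K x := by
  simp [total, scaling_eq]

lemma continuous_total (K : Matrix (Fin n) (Fin n) ℝ) : Continuous (total K) := by
  unfold total scaling
  fun_prop

/-- By `sub_le_spread`, up to a translation all scalings no heavier than `K` lie in a compact box. -/
lemma exists_minimizer (hn : 2 ≤ n) (hK : K.IsIrreducible) :
    ∃ w : Fin n → ℝ, (∀ i, |w i| ≤ spread K) ∧ ∀ y, total K w ≤ total K y := by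
  have hs := spread_pos hn hK
  let o : Fin n := ⟨0, by omega⟩
  have hcomp : IsCompact (Set.univ.pi fun _ : Fin n => Set.Icc (-spread K) (spread K)) :=
    isCompact_univ_pi fun _ => isCompact_Icc
  have hne : (Set.univ.pi fun _ : Fin n => Set.Icc (-spread K) (spread K)).Nonempty :=
    ⟨0, fun i _ => ⟨by simp [hs.le], by simp [hs.le]⟩⟩
  obtain ⟨w, hw, hmin⟩ := hcomp.exists_isMinOn hne (continuous_total K).continuousOn
  refine ⟨w, fun i => abs_le.2 (hw i (Set.mem_univ i)), fun y => ?_⟩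
  by_cases hy : total K y ≤ total K 0
  · rw [← total_add_const K y (-(y o))]
    apply hmin
    intro i _
    have h1 := sub_le_spread hn hK hy i o
    have h2 := sub_le_spread hn hK hy o i
    constructor <;> linarith
  · push Not at hy
    exact (hmin (fun i _ => ⟨by simp [hs.le], by simp [hs.le]⟩ :
      (0 : Fin n → ℝ) ∈ Set.univ.pi fun _ : Fin n => Set.Icc (-spread K) (spread K))).trans hy.le

lemma exactStep_eq_zero_of_min (hK : ∀ i j, 0 ≤ K i j) (hP : PosSums K) {w : Fin n → ℝ}
    (hw : ∀ y, total K w ≤ total K y) (k : Fin n) : exactStep K w k = 0 := by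
  have hd : Damped K 0 k w (Function.update w k (w k + exactStep K w k)) := by
    refine ⟨exactStep K w k, rfl, ?_, by simp⟩
    rcases le_total 0 (exactStep K w k) with h | h
    · exact Or.inl ⟨h, le_rfl⟩
    · exact Or.inr ⟨le_rfl, h⟩
  have h1 := hd.sqrtGap_sq_le hK (hP _ _).1 (hP _ _).2 zero_le_one
  have h2 := hw (Function.update w k (w k + exactStep K w k))
  have h3 : sqrtGap K w k = 0 := by
    rw [← sq_eq_zero_iff]
    nlinarith [sq_nonneg (sqrtGap K w k)]
  have h4 : rowSum (scaling K w) k = colSum (scaling K w) k := by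
    have := sub_eq_zero.1 h3
    exact (Real.sqrt_inj (hP w k).1.le (hP w k).2.le).1 this
  simp [exactStep, h4]

/-- Exact Osborne updates commute with translations and are monotone, so they do not increase the
sup-distance to a minimizer; neither do damped ones. -/
lemma Damped.abs_sub_le (hK : ∀ i j, 0 ≤ K i j) (hP : PosSums K) {w : Fin n → ℝ} {M : ℝ}
    (hw : exactStep K w k = 0) (h : Damped K η k x y) (hx : ∀ i, |x i - w i| ≤ M) :
    ∀ i, |y i - w i| ≤ M := by
  intro i
  by_cases hi : i = k
  swap
  · rw [h.apply_ne hi]; exact hx i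
  subst hi
  obtain ⟨s, rfl, hs, -⟩ := h
  rw [Function.update_self]
  have hrw : rowSum (scaling K w) i = colSum (scaling K w) i := by
    have : Real.log (colSum (scaling K w) i) = Real.log (rowSum (scaling K w) i) := by
      unfold exactStep at hw; linarith
    exact (Real.log_injOn_pos (Set.mem_Ioi.2 (hP w i).2) (Set.mem_Ioi.2 (hP w i).1) this).symm
  set e := x i - w i with he
  -- `x j ≤ w j + M` and `x j ≥ w j - M` give bounds on the row and column sums at `x`
  have row : ∀ t, (∀ j, x j - w j ≤ t) →
      Real.log (rowSum (scaling K w) i) + (e - t) ≤ Real.log (rowSum (scaling K x) i) := by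
    intro t ht
    rw [Real.le_log_iff_exp_le (hP x i).1, Real.exp_add, Real.exp_log (hP w i).1, rowSum,
      Finset.sum_mul]
    refine Finset.sum_le_sum fun j _ => ?_
    rw [scaling_eq, scaling_eq, mul_right_comm, ← Real.exp_add]
    apply mul_le_mul_of_nonneg_right _ (hK i j)
    apply Real.exp_le_exp.2
    have := ht j
    rw [he]; linarith
  have row' : ∀ t, (∀ j, -t ≤ x j - w j) →
      Real.log (rowSum (scaling K x) i) ≤ Real.log (rowSum (scaling K w) i) + (e + t) := by
    intro t ht
    rw [Real.log_le_iff_le_exp (hP x i).1, Real.exp_add, Real.exp_log (hP w i).1, rowSum, rowSum,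
      Finset.sum_mul]
    refine Finset.sum_le_sum fun j _ => ?_
    rw [scaling_eq, scaling_eq, mul_right_comm, ← Real.exp_add]
    apply mul_le_mul_of_nonneg_right _ (hK i j)
    apply Real.exp_le_exp.2
    have := ht j
    rw [he]; linarith
  have col : ∀ t, (∀ j, x j - w j ≤ t) →
      Real.log (colSum (scaling K x) i) ≤ Real.log (colSum (scaling K w) i) + (t - e) := by
    intro t ht
    rw [Real.log_le_iff_le_exp (hP x i).2, Real.exp_add, Real.exp_log (hP w i).2, colSum, colSum,
      Finset.sum_mul]
    refine Finset.sum_le_sum fun j _ => ?_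
    rw [scaling_eq, scaling_eq, mul_right_comm, ← Real.exp_add]
    apply mul_le_mul_of_nonneg_right _ (hK j i)
    apply Real.exp_le_exp.2
    have := ht j
    rw [he]; linarith
  have col' : ∀ t, (∀ j, -t ≤ x j - w j) →
      Real.log (colSum (scaling K w) i) - (e + t) ≤ Real.log (colSum (scaling K x) i) := by
    intro t ht
    rw [Real.le_log_iff_exp_le (hP x i).2, sub_eq_add_neg, Real.exp_add, Real.exp_log (hP w i).2,
      colSum, Finset.sum_mul]
    refine Finset.sum_le_sum fun j _ => ?_
    rw [scaling_eq, scaling_eq, mul_right_comm, ← Real.exp_add]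
    apply mul_le_mul_of_nonneg_right _ (hK j i)
    apply Real.exp_le_exp.2
    have := ht j
    rw [he]; linarith
  have hle : ∀ j, x j - w j ≤ M := fun j => (abs_le.1 (hx j)).2
  have hge : ∀ j, -M ≤ x j - w j := fun j => (abs_le.1 (hx j)).1
  have h1 := row M hle
  have h2 := row' M hge
  have h3 := col M hle
  have h4 := col' M hge
  rw [hrw] at h1 h2
  have hi1 := hle i
  have hi2 := hge i
  rw [abs_le]
  have hδ : exactStep K x i
    = (Real.log (colSum (scaling K x) i) - Real.log (rowSum (scaling K x) i)) / 2 := rfl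
  rcases hs with ⟨h5, h6⟩ | ⟨h5, h6⟩ <;> constructor <;> linarith

/-! ### The optimality gap -/

/-- The sum of the squares of the `sqrtGap`s, a Hellinger measure of imbalance. -/
noncomputable def hellGap (K : Matrix (Fin n) (Fin n) ℝ) (x : Fin n → ℝ) : ℝ :=
  ∑ k, sqrtGap K x k ^ 2

/-- The `ℓ₁` distance between the row and column sums. -/
noncomputable def imbalance (K : Matrix (Fin n) (Fin n) ℝ) (x : Fin n → ℝ) : ℝ :=
  ∑ k, |rowSum (scaling K x) k - colSum (scaling K x) k|

lemma total_pos (hn : 2 ≤ n) (hP : PosSums K) (x : Fin n → ℝ) : 0 < total K x := by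
  have : Nonempty (Fin n) := ⟨⟨0, by omega⟩⟩
  exact Finset.sum_pos (fun i _ => (hP x i).1) Finset.univ_nonempty

lemma hellGap_nonneg (K : Matrix (Fin n) (Fin n) ℝ) (x : Fin n → ℝ) : 0 ≤ hellGap K x :=
  Finset.sum_nonneg fun _ _ => sq_nonneg _

lemma imbalance_nonneg (K : Matrix (Fin n) (Fin n) ℝ) (x : Fin n → ℝ) : 0 ≤ imbalance K x :=
  Finset.sum_nonneg fun _ _ => abs_nonneg _

/-- Cauchy–Schwarz, as `r - c = (√r - √c) (√r + √c)`. -/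
lemma imbalance_sq_le (hK : ∀ i j, 0 ≤ K i j) (x : Fin n → ℝ) :
    imbalance K x ^ 2 ≤ 4 * hellGap K x * total K x := by
  have h1 : ∀ k, |rowSum (scaling K x) k - colSum (scaling K x) k|
      = |sqrtGap K x k| * (√(rowSum (scaling K x) k) + √(colSum (scaling K x) k)) := by
    intro k
    have hr := Real.sq_sqrt (rowSum_nonneg hK x k)
    have hc := Real.sq_sqrt (colSum_nonneg hK x k)
    nth_rewrite 1 [← hr]
    nth_rewrite 1 [← hc]
    rw [sq_sub_sq, abs_mul, abs_of_nonneg (by positivity), mul_comm]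
    rfl
  have h2 := Finset.sum_mul_sq_le_sq_mul_sq Finset.univ (fun k => |sqrtGap K x k|)
    (fun k => √(rowSum (scaling K x) k) + √(colSum (scaling K x) k))
  simp only [← h1, sq_abs] at h2
  have h3 : ∑ k, (√(rowSum (scaling K x) k) + √(colSum (scaling K x) k)) ^ 2
      ≤ 4 * total K x := by
    calc _ ≤ ∑ k, (2 * rowSum (scaling K x) k + 2 * colSum (scaling K x) k) := by
          refine Finset.sum_le_sum fun k _ => ?_
          have hr := Real.sq_sqrt (rowSum_nonneg hK x k)
          have hc := Real.sq_sqrt (colSum_nonneg hK x k)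
          nlinarith [sq_nonneg (√(rowSum (scaling K x) k) - √(colSum (scaling K x) k))]
      _ = _ := by
          rw [Finset.sum_add_distrib, ← Finset.mul_sum, ← Finset.mul_sum, sum_rowSum, sum_colSum]
          ring
  calc imbalance K x ^ 2 ≤ _ := h2
    _ ≤ hellGap K x * (4 * total K x) := mul_le_mul_of_nonneg_left h3 (hellGap_nonneg K x)
    _ = _ := by ring

/-- Convexity of `log F`: the gradient inequality. -/
lemma log_total_sub_le (hn : 2 ≤ n) (hK : ∀ i j, 0 ≤ K i j) (hP : PosSums K) (x y : Fin n → ℝ) :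
    (Real.log (total K x) - Real.log (total K y)) * total K x
      ≤ ∑ k, (rowSum (scaling K x) k - colSum (scaling K x) k) * (x k - y k) := by
  have hx := total_pos hn hP x
  have hy := total_pos hn hP y
  set F := total K x
  set S := ∑ k, (rowSum (scaling K x) k - colSum (scaling K x) k) * (x k - y k) with hS
  -- `S` is the sum over the entries of the linearized exponents
  have hS' : S = ∑ i, ∑ j, scaling K x i j * ((x i - y i) - (x j - y j)) := by
    have e1 : ∀ i, ∑ j, scaling K x i j * ((x i - y i) - (x j - y j))
        = rowSum (scaling K x) i * (x i - y i) - ∑ j, scaling K x i j * (x j - y j) := by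
      intro i
      simp only [mul_sub (scaling K x i _), Finset.sum_sub_distrib]
      rw [rowSum, Finset.sum_mul]
      simp only [mul_sub, Finset.sum_sub_distrib]
    rw [Finset.sum_congr rfl fun i _ => e1 i, Finset.sum_sub_distrib, Finset.sum_comm, hS]
    simp only [sub_mul (rowSum _ _), Finset.sum_sub_distrib]
    congr 1
    exact Finset.sum_congr rfl fun k _ => by rw [colSum, Finset.sum_mul]
  -- Jensen, by the tangent of `exp` at the mean exponent
  have key : F * Real.exp (-(S / F)) ≤ total K y := by
    have h1 : ∀ i j, scaling K x i j * (Real.exp (-(S / F)) *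
        (1 + (-((x i - y i) - (x j - y j)) + S / F))) ≤ scaling K y i j := by
      intro i j
      have e : scaling K y i j = scaling K x i j * (Real.exp (-(S / F)) *
          Real.exp (-((x i - y i) - (x j - y j)) + S / F)) := by
        rw [scaling_eq, scaling_eq, mul_right_comm, ← Real.exp_add, ← Real.exp_add]
        congr 2
        ring
      rw [e]
      apply mul_le_mul_of_nonneg_left _ (scaling_nonneg hK x i j)
      apply mul_le_mul_of_nonneg_left _ (Real.exp_pos _).le
      have := Real.add_one_le_exp (-((x i - y i) - (x j - y j)) + S / F)
      linarith
    have h2 := Finset.sum_le_sum fun i (_ : i ∈ Finset.univ) =>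
      Finset.sum_le_sum fun j (_ : j ∈ Finset.univ) => h1 i j
    have h3 : ∑ i, ∑ j, scaling K x i j * (Real.exp (-(S / F)) *
        (1 + (-((x i - y i) - (x j - y j)) + S / F))) = F * Real.exp (-(S / F)) := by
      have : ∀ i j, scaling K x i j * (Real.exp (-(S / F)) *
          (1 + (-((x i - y i) - (x j - y j)) + S / F)))
          = Real.exp (-(S / F)) * (1 + S / F) * scaling K x i j
            - Real.exp (-(S / F)) * (scaling K x i j * ((x i - y i) - (x j - y j))) := by
        intro i j; ring
      simp only [this, Finset.sum_sub_distrib, ← Finset.mul_sum]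
      rw [← hS']
      change Real.exp (-(S / F)) * (1 + S / F) * F - _ = _
      field_simp
      ring
    rw [h3] at h2
    exact h2
  have h4 := Real.log_le_log (by positivity) key
  rw [Real.log_mul hx.ne' (Real.exp_pos _).ne', Real.log_exp] at h4
  have h5 : Real.log F - Real.log (total K y) ≤ S / F := by linarith
  rwa [le_div_iff₀ hx] at h5

/-- The optimality gap is controlled by the imbalance and the diameter. -/
lemma gap_sq_le (hn : 2 ≤ n) (hK : K.IsIrreducible) (hx : total K x ≤ total K 0)
    {w : Fin n → ℝ} (hw : ∀ y, total K w ≤ total K y) :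
    (Real.log (total K x) - Real.log (total K w)) ^ 2 * total K x
      ≤ 16 * spread K ^ 2 * hellGap K x := by
  have hP := posSums_of_isIrreducible hn hK
  have hF := total_pos hn hP x
  have hFw := total_pos hn hP w
  have h1 := log_total_sub_le hn hK.nonneg hP x w
  let o : Fin n := ⟨0, by omega⟩
  have h2 : ∑ k, (rowSum (scaling K x) k - colSum (scaling K x) k) * (x k - w k)
      = ∑ k, (rowSum (scaling K x) k - colSum (scaling K x) k)
          * ((x k - x o) - (w k - w o)) := by
    have : ∑ k, (rowSum (scaling K x) k - colSum (scaling K x) k) * (x o - w o) = 0 := by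
      rw [← Finset.sum_mul, Finset.sum_sub_distrib, sum_rowSum, sum_colSum]; simp
    rw [← sub_zero (∑ k, _), ← this, ← Finset.sum_sub_distrib]
    exact Finset.sum_congr rfl fun k _ => by ring
  have h3 : ∑ k, (rowSum (scaling K x) k - colSum (scaling K x) k) * ((x k - x o) - (w k - w o))
      ≤ imbalance K x * (2 * spread K) := by
    rw [imbalance, Finset.sum_mul]
    refine Finset.sum_le_sum fun k _ => ?_
    refine (le_abs_self _).trans ?_
    rw [abs_mul]
    apply mul_le_mul_of_nonneg_left _ (abs_nonneg _)
    have a1 := sub_le_spread hn hK hx k o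
    have a2 := sub_le_spread hn hK hx o k
    have a3 := sub_le_spread hn hK (hw 0) k o
    have a4 := sub_le_spread hn hK (hw 0) o k
    rw [abs_le]; constructor <;> linarith
  have h4 := imbalance_sq_le hK.nonneg x
  set g := Real.log (total K x) - Real.log (total K w)
  have hg : 0 ≤ g := sub_nonneg.2 (Real.log_le_log hFw (hw x))
  have h5 : g * total K x ≤ imbalance K x * (2 * spread K) := h1.trans (h2.le.trans h3)
  have h6 := pow_le_pow_left₀ (mul_nonneg hg hF.le) h5 2
  have h7 : (g ^ 2 * total K x) * total K x ≤ (16 * spread K ^ 2 * hellGap K x) * total K x := by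
    nlinarith [sq_nonneg (spread K)]
  exact le_of_mul_le_mul_right h7 hF

end Osborne

namespace Osborne

variable {n : ℕ} {K : Matrix (Fin n) (Fin n) ℝ} {x y z w : Fin n → ℝ} {k : Fin n} {η s ε : ℝ}

/-! ### The concave potential -/

/-- The concave function of the gap `g` with derivative `1 / max (ε ^ 2) ((g / D) ^ 2)`, that is,
the time in which a gap `g` disappears if it shrinks at the rate `max (ε ^ 2) ((g / D) ^ 2)`. -/
noncomputable def psi (ε D g : ℝ) : ℝ :=
  if g ≤ D * ε then g / ε ^ 2 else 2 * D / ε - D ^ 2 / g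

/-- The mean value inequality for `psi`, whose derivative is decreasing. -/
lemma psi_sub_ge {ε D g g' : ℝ} (hε : 0 < ε) (hD : 0 < D) (h : g' ≤ g) :
    g - g' ≤ max (ε ^ 2) ((g / D) ^ 2) * (psi ε D g - psi ε D g') := by
  unfold psi
  by_cases hg : g ≤ D * ε
  · rw [if_pos hg, if_pos (h.trans hg), ← sub_div]
    calc g - g' = ε ^ 2 * ((g - g') / ε ^ 2) := by field_simp
      _ ≤ _ := mul_le_mul_of_nonneg_right (le_max_left _ _)
          (div_nonneg (by linarith) (by positivity))
  · rw [if_neg hg]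
    push Not at hg
    have hg0 : 0 < g := lt_trans (by positivity) hg
    have key : (g - g') * D ^ 2 / g ^ 2 ≤
        2 * D / ε - D ^ 2 / g - if g' ≤ D * ε then g' / ε ^ 2 else 2 * D / ε - D ^ 2 / g' := by
      split_ifs with hg'
      · rw [← sub_nonneg]
        have e : 2 * D / ε - D ^ 2 / g - g' / ε ^ 2 - (g - g') * D ^ 2 / g ^ 2
            = (D * ε * (g - D * ε) ^ 2 + (D * ε - g') * (g ^ 2 - (D * ε) ^ 2))
              / (ε ^ 2 * g ^ 2) := by
          field_simp; ring
        rw [e]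
        apply div_nonneg _ (by positivity)
        have h1 : (D * ε) ^ 2 ≤ g ^ 2 := pow_le_pow_left₀ (by positivity) hg.le 2
        have h2 := mul_nonneg (sub_nonneg.2 hg') (sub_nonneg.2 h1)
        have h3 : 0 ≤ D * ε * (g - D * ε) ^ 2 := by positivity
        linarith
      · push Not at hg'
        have hg0' : 0 < g' := lt_trans (by positivity) hg'
        rw [← sub_nonneg]
        have e : 2 * D / ε - D ^ 2 / g - (2 * D / ε - D ^ 2 / g') - (g - g') * D ^ 2 / g ^ 2
            = D ^ 2 * (g - g') ^ 2 / (g ^ 2 * g') := by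
          field_simp; ring
        rw [e]
        positivity
    have h1 : 0 ≤ (g - g') * D ^ 2 / g ^ 2 :=
      div_nonneg (mul_nonneg (by linarith) (by positivity)) (by positivity)
    calc g - g' = (g / D) ^ 2 * ((g - g') * D ^ 2 / g ^ 2) := by field_simp
      _ ≤ _ := mul_le_mul (le_max_right _ _) key h1 (le_max_of_le_left (by positivity))

lemma psi_mono {ε D g g' : ℝ} (hε : 0 < ε) (hD : 0 < D) (h : g' ≤ g) :
    psi ε D g' ≤ psi ε D g := by
  have h1 := psi_sub_ge hε hD h
  have h2 : 0 < max (ε ^ 2) ((g / D) ^ 2) := lt_max_of_lt_left (by positivity)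
  by_contra hlt
  push Not at hlt
  nlinarith

lemma psi_nonneg {ε D g : ℝ} (hε : 0 < ε) (hD : 0 < D) (h0 : 0 ≤ g) : 0 ≤ psi ε D g := by
  have h1 := psi_mono hε hD h0
  have : psi ε D 0 = 0 := by simp [psi, (mul_pos hD hε).le]
  linarith

/-- The time `psi` to remove a gap of `l = log κ` is of the order of `rate`. -/
lemma psi_le {ε D g l d : ℝ} (hε : 0 < ε) (hd : 0 < d) (hl : 0 < l) (hD : D = d * l)
    (h : g ≤ l) : psi ε D g ≤ 2 * (1 / ε * min (1 / ε) d * l) := by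
  have hD0 : 0 < D := by rw [hD]; positivity
  rcases min_cases (1 / ε) d with ⟨h1, -⟩ | ⟨h1, -⟩ <;> rw [h1]
  · have : psi ε D g ≤ g / ε ^ 2 := by
      unfold psi
      split_ifs with hg
      · exact le_rfl
      · push Not at hg
        have hg0 : 0 < g := lt_trans (by positivity) hg
        rw [← sub_nonneg]
        have e : g / ε ^ 2 - (2 * D / ε - D ^ 2 / g) = (g - D * ε) ^ 2 / (g * ε ^ 2) := by
          field_simp; ring
        rw [e]; positivity
    refine this.trans ?_
    have e : 2 * (1 / ε * (1 / ε) * l) = 2 * (l / ε ^ 2) := by field_simp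
    rw [e]
    have : g / ε ^ 2 ≤ l / ε ^ 2 := by gcongr
    have : 0 ≤ l / ε ^ 2 := by positivity
    linarith
  · have : psi ε D g ≤ 2 * D / ε := by
      unfold psi
      split_ifs with hg
      · rw [div_le_div_iff₀ (by positivity) hε]
        nlinarith [mul_pos hD0 hε, mul_le_mul_of_nonneg_right hg hε.le]
      · push Not at hg
        have hg0 : 0 < g := lt_trans (by positivity) hg
        have : 0 ≤ D ^ 2 / g := by positivity
        linarith
    refine this.trans (le_of_eq ?_)
    rw [hD]; field_simp

/-- The potential of an iterate `x`, where `w` is an optimal scaling. -/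
noncomputable def potential (K : Matrix (Fin n) (Fin n) ℝ) (ε : ℝ) (w x : Fin n → ℝ) : ℝ :=
  psi ε (spread K) (Real.log (total K x) - Real.log (total K w))

/-- The rate at which the gap of `x` shrinks. -/
noncomputable def gapRate (K : Matrix (Fin n) (Fin n) ℝ) (ε : ℝ) (w x : Fin n → ℝ) : ℝ :=
  max (ε ^ 2) (((Real.log (total K x) - Real.log (total K w)) / spread K) ^ 2)

lemma gapRate_pos (hε : 0 < ε) : 0 < gapRate K ε w x := lt_max_of_lt_left (by positivity)

lemma gap_nonneg (hn : 2 ≤ n) (hK : K.IsIrreducible) (hw : ∀ y, total K w ≤ total K y)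
    (x : Fin n → ℝ) : 0 ≤ Real.log (total K x) - Real.log (total K w) :=
  sub_nonneg.2 (Real.log_le_log (total_pos hn (posSums_of_isIrreducible hn hK) w) (hw x))

lemma potential_nonneg (hn : 2 ≤ n) (hK : K.IsIrreducible) (hε : 0 < ε)
    (hw : ∀ y, total K w ≤ total K y) (x : Fin n → ℝ) : 0 ≤ potential K ε w x :=
  psi_nonneg hε (spread_pos hn hK) (gap_nonneg hn hK hw x)

lemma potential_mono (hn : 2 ≤ n) (hK : K.IsIrreducible) (hε : 0 < ε) (w : Fin n → ℝ)
    (h : total K y ≤ total K x) :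
    potential K ε w y ≤ potential K ε w x := by
  apply psi_mono hε (spread_pos hn hK)
  have := Real.log_le_log (total_pos hn (posSums_of_isIrreducible hn hK) y) h
  linarith

/-- A decrease of the total mass, measured by the potential. -/
lemma potential_drop (hn : 2 ≤ n) (hK : K.IsIrreducible) (hε : 0 < ε) (w : Fin n → ℝ)
    (h : total K y ≤ total K x) :
    total K x - total K y
      ≤ total K x * gapRate K ε w x * (potential K ε w x - potential K ε w y) := by
  have hP := posSums_of_isIrreducible hn hK
  have hx := total_pos hn hP x
  have hy := total_pos hn hP y
  have hlog := Real.log_le_log hy h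
  have h1 := psi_sub_ge hε (spread_pos hn hK)
    (g' := Real.log (total K y) - Real.log (total K w))
    (g := Real.log (total K x) - Real.log (total K w)) (by linarith)
  have h2 := Real.log_le_sub_one_of_pos (div_pos hy hx)
  rw [Real.log_div hy.ne' hx.ne'] at h2
  have h3 : 1 - total K y / total K x ≤
      gapRate K ε w x * (potential K ε w x - potential K ε w y) := by
    unfold gapRate potential
    linarith
  have h4 := mul_le_mul_of_nonneg_left h3 hx.le
  have e : total K x * (1 - total K y / total K x) = total K x - total K y := by field_simp
  rw [e] at h4
  linarith

/-- The gap never exceeds `log κ`, since the total mass is at least `Kmin`. -/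
lemma log_total_zero_sub_le (hn : 2 ≤ n) (hK : K.IsIrreducible) (hx : total K x ≤ total K 0)
    (w : Fin n → ℝ) :
    Real.log (total K x) - Real.log (total K w) ≤ Real.log (cond K) := by
  have hP := posSums_of_isIrreducible hn hK
  have hm := Kmin_pos hn hK
  have h1 := Real.log_le_log (total_pos hn hP x) hx
  -- in the row of a largest coordinate of `w`, no entry is scaled down
  have h2 : Kmin K ≤ total K w := by
    have hne : Nonempty (Fin n) := ⟨⟨0, by omega⟩⟩
    obtain ⟨i, hi⟩ := Finite.exists_max w
    have : Nontrivial (Fin n) := Fin.nontrivial_iff_two_le.2 hn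
    obtain ⟨j, hj⟩ := hK.exists_pos i
    calc Kmin K ≤ K i j := Kmin_le hj
      _ ≤ scaling K w i j := by
        rw [scaling_eq]
        exact le_mul_of_one_le_left hj.le (Real.one_le_exp (sub_nonneg.2 (hi j)))
      _ ≤ rowSum (scaling K w) i := Finset.single_le_sum (f := fun j => scaling K w i j)
        (fun j _ => scaling_nonneg hK.nonneg w i j) (Finset.mem_univ j)
      _ ≤ total K w := rowSum_le_total hK.nonneg w i
  have h3 := Real.log_le_log hm h2
  have h4 : Real.log (cond K) = Real.log (total K 0) - Real.log (Kmin K) := by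
    rw [cond, ← total_zero, Real.log_div (total_pos hn hP 0).ne' hm.ne']
  linarith

lemma potential_le (hn : 2 ≤ n) (hK : K.IsIrreducible) (hε : 0 < ε) (w : Fin n → ℝ)
    (hx : total K x ≤ total K 0) :
    potential K ε w x ≤ 2 * rate K ε := by
  have h1 := half_le_log_cond hn hK
  have h2 : (0 : ℝ) < diam K := by exact_mod_cast one_le_diam hn hK
  exact psi_le hε h2 (by linarith) rfl (log_total_zero_sub_le hn hK hx w)

lemma half_le_rate (hn : 2 ≤ n) (hK : K.IsIrreducible) (hε : 0 < ε) (hε1 : ε ≤ 1) :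
    1 / 2 ≤ rate K ε := by
  have h1 := half_le_log_cond hn hK
  have h2 : (1 : ℝ) ≤ diam K := by exact_mod_cast one_le_diam hn hK
  have h3 : 1 ≤ 1 / ε := by rwa [le_div_iff₀ hε, one_mul]
  have h4 : 1 ≤ min (1 / ε) (diam K : ℝ) := le_min h3 h2
  have h5 : 1 ≤ 1 / ε * min (1 / ε) (diam K : ℝ) := by nlinarith
  unfold rate
  nlinarith

/-! ### Progress of a sweep -/

/-- If a sweep ends far from balance, then it made progress or it started far from balance. -/
lemma Sweep.progress_or (hn : 2 ≤ n) (hK : K.IsIrreducible) (hε : 0 < ε) (hε1 : ε ≤ 1)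
    {ks : List (Fin n)} (h : Sweep K η ks x z) (hnd : ks.Nodup)
    (hz : ε / 8 * total K z ≤ imbalance K z) :
    ε ^ 2 / 10 ^ 4 * total K x ≤ total K x - total K z ∨
      ε ^ 2 / 10 ^ 4 * total K x ≤ hellGap K x := by
  by_contra hcon
  push Not at hcon
  obtain ⟨h1, h2⟩ := hcon
  have hP := posSums_of_isIrreducible hn hK
  have hFx := total_pos hn hP x
  have hFz := total_pos hn hP z
  have hmov := h.hellDist_le hK.nonneg hP hnd
  have hle := h.total_le hK.nonneg hP
  have hε2 : ε ^ 2 ≤ 1 := pow_le_one₀ hε.le hε1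
  have hhalf : total K x ≤ 2 * total K z := by nlinarith
  have hgap : hellGap K z ≤ 2 * hellGap K x + 8 * hellDist K x z := by
    have : hellGap K z ≤ ∑ k, (2 * sqrtGap K x k ^ 2 + 4 * crossDist K k x z) := by
      refine Finset.sum_le_sum fun k _ => ?_
      have := sqrtGap_sub_sq_le hK.nonneg x z k
      nlinarith [sq_nonneg (sqrtGap K z k - 2 * sqrtGap K x k)]
    rw [Finset.sum_add_distrib, ← Finset.mul_sum, ← Finset.mul_sum, sum_crossDist] at this
    unfold hellGap at this ⊢
    linarith
  have him := imbalance_sq_le hK.nonneg z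
  have hz2 := pow_le_pow_left₀ (by positivity) hz 2
  have h3 : hellGap K z ≤ 36 * (ε ^ 2 / 10 ^ 4) * total K z := by nlinarith
  have h4 : 4 * hellGap K z * total K z ≤ 4 * (36 * (ε ^ 2 / 10 ^ 4) * total K z) * total K z := by
    gcongr
  have h5 : 0 < ε ^ 2 * total K z ^ 2 := by positivity
  nlinarith

/-- The amount by which the gap has to shrink if no balanced iterate has been met. -/
lemma gapRate_le_of_progress (hn : 2 ≤ n) (hK : K.IsIrreducible) (hε : 0 < ε)
    (hw : ∀ y, total K w ≤ total K y) (hx : total K x ≤ total K 0) {Δ : ℝ}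
    (hη0 : 0 ≤ η) (hη : η ≤ ε / (1000 * n))
    (hgap : hellGap K x ≤ 6 * Δ + n * (4 * η ^ 2 * total K x))
    (hor : ε ^ 2 / 10 ^ 4 * total K x ≤ Δ ∨ ε ^ 2 / 10 ^ 4 * total K x ≤ hellGap K x) :
    10⁻¹ ^ 5 * (total K x * gapRate K ε w x) ≤ Δ := by
  have hP := posSums_of_isIrreducible hn hK
  have hF := total_pos hn hP x
  have hn' : (2 : ℝ) ≤ n := by exact_mod_cast hn
  have herr : n * (4 * η ^ 2 * total K x) ≤ 2 * 10⁻¹ ^ 6 * (ε ^ 2 * total K x) := by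
    have h1 : η ^ 2 ≤ (ε / (1000 * n)) ^ 2 := pow_le_pow_left₀ hη0 hη 2
    have h2 : n * η ^ 2 ≤ 10⁻¹ ^ 6 / 2 * ε ^ 2 := by
      calc n * η ^ 2 ≤ n * (ε / (1000 * n)) ^ 2 := by gcongr
        _ = 10⁻¹ ^ 6 * ε ^ 2 * (1 / n) := by field_simp; norm_num
        _ ≤ 10⁻¹ ^ 6 * ε ^ 2 * (1 / 2) := by gcongr
        _ = _ := by ring
    nlinarith
  have hΔ : 10⁻¹ ^ 5 * (ε ^ 2 * total K x) ≤ Δ := by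
    have : 0 < ε ^ 2 * total K x := by positivity
    rcases hor with h | h <;> nlinarith
  have hs := spread_pos hn hK
  have hg := gap_sq_le hn hK hx hw
  unfold gapRate
  rcases max_cases (ε ^ 2) (((Real.log (total K x) - Real.log (total K w)) / spread K) ^ 2)
    with ⟨h1, -⟩ | ⟨h1, -⟩ <;> rw [h1]
  · linarith
  · have h2 : total K x * ((Real.log (total K x) - Real.log (total K w)) / spread K) ^ 2
        ≤ 16 * hellGap K x := by
      rw [div_pow, ← mul_div_assoc, div_le_iff₀ (by positivity)]
      linarith
    have h4 : 0 ≤ Δ := le_trans (by positivity) hΔ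
    have h3 : hellGap K x ≤ 7 * Δ := by linarith
    nlinarith

end Osborne

namespace Osborne

/-! ### Stopped random processes driven by block selections -/

section Path

variable {X : Type*} {p : ℕ} {step : X → Fin p → X} {halt : X → Prop} {x₀ : X}

/-- The state after `t` rounds with the selections `a`. -/
def path (step : X → Fin p → X) (x₀ : X) (a : ℕ → Fin p) : ℕ → X
  | 0 => x₀
  | t + 1 => step (path step x₀ a t) (a t)

/-- The cost of the first `N` rounds. -/
def costTo (step : X → Fin p → X) (cost : X → Fin p → ℕ) (x₀ : X) (a : ℕ → Fin p) (N : ℕ) : ℕ :=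
  ∑ t ∈ Finset.range N, cost (path step x₀ a t) (a t)

/-- The first time at which the state satisfies `halt` (and `0` if this never happens). -/
noncomputable def stopTime (step : X → Fin p → X) (halt : X → Prop) (x₀ : X) (a : ℕ → Fin p) : ℕ :=
  sInf {t | halt (path step x₀ a t)}

lemma path_congr (t : ℕ) (a b : ℕ → Fin p) (h : ∀ i < t, a i = b i) :
    path step x₀ a t = path step x₀ b t := by
  induction t with
  | zero => rfl
  | succ t ih => simp only [path, ih fun i hi => h i (by omega), h t (by omega)]

lemma costTo_congr (cost : X → Fin p → ℕ) (t : ℕ) (a b : ℕ → Fin p) (h : ∀ i < t, a i = b i) :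
    costTo step cost x₀ a t = costTo step cost x₀ b t := by
  refine Finset.sum_congr rfl fun i hi => ?_
  have hi' := Finset.mem_range.1 hi
  rw [path_congr i a b fun j hj => h j (by omega), h i hi']

/-- A function of the selections that depends only on the first `t` of them factors through a finite type. -/
lemma exists_factor {β : Type*} [NeZero p] {Φ : (ℕ → Fin p) → β} {t : ℕ}
    (h : ∀ a b, (∀ i < t, a i = b i) → Φ a = Φ b) :
    ∃ Ψ : (Finset.range t → Fin p) → β, ∀ a, Φ a = Ψ fun i => a i := by
  refine ⟨fun b => Φ fun i => if hi : i ∈ Finset.range t then b ⟨i, hi⟩ else 0, fun a => ?_⟩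
  apply h
  intro i hi
  simp [hi]

variable {Ω : Type*} [MeasurableSpace Ω] {μ : Measure Ω} {s : ℕ → Ω → Fin p}

lemma measurable_of_depends {β : Type*} [MeasurableSpace β] [NeZero p]
    (hs : ∀ t, Measurable (s t)) {Φ : (ℕ → Fin p) → β} {t : ℕ}
    (h : ∀ a b, (∀ i < t, a i = b i) → Φ a = Φ b) : Measurable fun ω => Φ fun i => s i ω := by
  obtain ⟨Ψ, hΨ⟩ := exists_factor h
  simp only [hΨ]
  exact (Measurable.of_discrete (f := Ψ)).comp (measurable_pi_lambda _ fun i => hs i)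

lemma integrable_of_depends [IsFiniteMeasure μ] [NeZero p]
    (hs : ∀ t, Measurable (s t)) {Φ : (ℕ → Fin p) → ℝ} {t : ℕ}
    (h : ∀ a b, (∀ i < t, a i = b i) → Φ a = Φ b) : Integrable (fun ω => Φ fun i => s i ω) μ := by
  obtain ⟨Ψ, hΨ⟩ := exists_factor h
  simp only [hΨ]
  exact (Integrable.of_finite (f := Ψ)).comp_measurable (measurable_pi_lambda _ fun i => hs i)

/-- An observable of the past is independent of the next selection. -/
lemma integral_mul_selection [IsProbabilityMeasure μ] [NeZero p] (hs : IsUniformSelection μ s)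
    {Φ : (ℕ → Fin p) → ℝ} {t : ℕ} (h : ∀ a b, (∀ i < t, a i = b i) → Φ a = Φ b) (l : Fin p) :
    ∫ ω, (Φ fun i => s i ω) * (if s t ω = l then 1 else 0) ∂μ
      = (∫ ω, (Φ fun i => s i ω) ∂μ) * (1 / (p : ℝ)) := by
  obtain ⟨hm, hind, hunif⟩ := hs
  obtain ⟨Ψ, hΨ⟩ := exists_factor h
  have h1 := hind.indepFun_finset (Finset.range t) {t} (by simp) hm
  have h2 := h1.comp (φ := Ψ)
    (ψ := fun b : (({t} : Finset ℕ) → Fin p) => if b ⟨t, by simp⟩ = l then (1 : ℝ) else 0)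
    .of_discrete .of_discrete
  have h3 : ∫ ω, (if s t ω = l then (1 : ℝ) else 0) ∂μ = 1 / (p : ℝ) := by
    rw [← hunif t l]
    have : (fun ω => if s t ω = l then (1 : ℝ) else 0)
        = Set.indicator {ω | s t ω = l} fun _ => 1 := by
      ext ω; simp [Set.indicator]
    rw [this, integral_indicator_const]
    · simp
    · exact hm t (measurableSet_singleton l)
  simp only [hΨ]
  rw [← h3]
  refine IndepFun.integral_fun_mul_eq_mul_integral h2 ?_ ?_
  · exact (measurable_of_depends hm h).aestronglyMeasurable.congr (by simp [hΨ])
  · exact (Measurable.ite (hm t (measurableSet_singleton l)) measurable_const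
      measurable_const).aestronglyMeasurable

/-- If `G` decreases on average even after multiplication by `exp (r * cost)`, then the product of
`G` and the exponential of the accumulated cost is a supermartingale. -/
lemma integral_exp_costTo_le [IsProbabilityMeasure μ] [NeZero p] (hs : IsUniformSelection μ s)
    {cost : X → Fin p → ℕ} {r : ℝ} {G : X → ℝ} {Inv : X → Prop} (h₀ : Inv x₀)
    (hInv : ∀ x, Inv x → ∀ l, Inv (step x l))
    (hG : ∀ x, Inv x → ∑ l, G (step x l) * Real.exp (r * cost x l) ≤ p * G x) (N : ℕ) :
    ∫ ω, G (path step x₀ (fun i => s i ω) N)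
      * Real.exp (r * costTo step cost x₀ (fun i => s i ω) N) ∂μ ≤ G x₀ := by
  have hp : (0 : ℝ) < p := by exact_mod_cast Nat.pos_of_ne_zero (NeZero.ne p)
  induction N with
  | zero => simp [path, costTo]
  | succ N ih =>
    refine le_trans ?_ ih
    let H : Fin p → (ℕ → Fin p) → ℝ := fun l a =>
      G (step (path step x₀ a N) l) * Real.exp (r * cost (path step x₀ a N) l)
        * Real.exp (r * costTo step cost x₀ a N)
    have hH : ∀ l a b, (∀ i < N, a i = b i) → H l a = H l b := by
      intro l a b hab
      simp only [H, path_congr N a b hab, costTo_congr cost N a b hab]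
    have hH' : ∀ l, ∀ a b, (∀ i < N + 1, a i = b i) →
        H l a * (if a N = l then 1 else 0) = H l b * (if b N = l then (1 : ℝ) else 0) := by
      intro l a b hab
      rw [hH l a b fun i hi => hab i (by omega), hab N (by omega)]
    have e1 : ∀ ω, G (path step x₀ (fun i => s i ω) (N + 1))
        * Real.exp (r * costTo step cost x₀ (fun i => s i ω) (N + 1))
        = ∑ l, H l (fun i => s i ω) * (if s N ω = l then 1 else 0) := by
      intro ω
      simp only [mul_ite, mul_one, mul_zero, Finset.sum_ite_eq, Finset.mem_univ, if_true, H]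
      rw [costTo, Finset.sum_range_succ, ← costTo, path]
      push_cast
      rw [mul_add, Real.exp_add]
      ring
    simp only [e1]
    rw [integral_finsetSum _ fun l _ => integrable_of_depends hs.1 (hH' l),
      Finset.sum_congr rfl fun l _ => integral_mul_selection hs (hH l) l, ← Finset.sum_mul,
      ← integral_finsetSum _ fun l _ => integrable_of_depends hs.1 (hH l), ← integral_mul_const]
    apply integral_mono
    · exact integrable_of_depends hs.1 (Φ := fun a => (∑ l, H l a) * (1 / (p : ℝ))) (t := N)
        fun a b hab => by simp only [fun l => hH l a b hab]
    · exact integrable_of_depends hs.1 (t := N)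
        (Φ := fun a => G (path step x₀ a N) * Real.exp (r * costTo step cost x₀ a N))
        fun a b hab => by simp only [path_congr N a b hab, costTo_congr cost N a b hab]
    · intro ω
      have hpath : ∀ M, Inv (path step x₀ (fun i => s i ω) M) := by
        intro M
        induction M with
        | zero => exact h₀
        | succ M ihM => exact hInv _ ihM _
      have h1 := hG _ (hpath N)
      simp only [H, ← Finset.sum_mul]
      rw [mul_one_div, div_le_iff₀ hp]
      have := mul_le_mul_of_nonneg_right h1
        (Real.exp_pos (r * costTo step cost x₀ (fun i => s i ω) N)).le
      linarith

open Classical in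
/-- The process that stays put, at no cost, once it has reached a state satisfying `halt`. -/
noncomputable def absorb (step : X → Fin p → X) (halt : X → Prop) (x : X) (l : Fin p) : X :=
  if halt x then x else step x l

open Classical in
/-- The cost of the process that stays put once it has reached a state satisfying `halt`. -/
noncomputable def absorbCost (cost : X → Fin p → ℕ) (halt : X → Prop) (x : X) (l : Fin p) : ℕ :=
  if halt x then 0 else cost x l

lemma path_absorb {a : ℕ → Fin p} {N : ℕ} (h : ∀ t < N, ¬ halt (path step x₀ a t)) :
    path (absorb step halt) x₀ a N = path step x₀ a N := by
  induction N with
  | zero => rfl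
  | succ N ih =>
    have ih' := ih fun t ht => h t (by omega)
    rw [path, path, ih', absorb, if_neg (h N (by omega))]

lemma not_stop_of_lt_stopTime {a : ℕ → Fin p} {t : ℕ} (h : t < stopTime step halt x₀ a) :
    ¬ halt (path step x₀ a t) := fun h' => Nat.notMem_of_lt_sInf h h'

lemma costTo_absorb_eq {cost : X → Fin p → ℕ} {a : ℕ → Fin p} {N : ℕ}
    (h : ∀ t < N, ¬ halt (path step x₀ a t)) :
    costTo (absorb step halt) (absorbCost cost halt) x₀ a N = costTo step cost x₀ a N := by
  refine Finset.sum_congr rfl fun t ht => ?_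
  have ht' := Finset.mem_range.1 ht
  rw [path_absorb fun i hi => h i (by omega), absorbCost, if_neg (h t ht')]

lemma costTo_absorb_le {cost : X → Fin p → ℕ} {a : ℕ → Fin p} {N : ℕ}
    (h : stopTime step halt x₀ a ≤ N) :
    costTo step cost x₀ a (stopTime step halt x₀ a)
      ≤ costTo (absorb step halt) (absorbCost cost halt) x₀ a N := by
  rw [← costTo_absorb_eq (halt := halt) fun t ht => not_stop_of_lt_stopTime ht]
  exact Finset.sum_le_sum_of_subset (Finset.range_subset_range.2 h)

/-- The bound on the exponential moment of the accumulated cost, for the process stopped at a fixed time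
or, by Fatou's lemma, at `stopTime`. -/
lemma lintegral_exp_costTo_stopTime_le [IsProbabilityMeasure μ] [NeZero p]
    (hs : IsUniformSelection μ s)
    {cost : X → Fin p → ℕ} {r : ℝ} (hr : 0 ≤ r) {G : X → ℝ} {Inv : X → Prop} (h₀ : Inv x₀)
    (hInv : ∀ x, Inv x → ¬ halt x → ∀ l, Inv (step x l)) (hG1 : ∀ x, Inv x → 1 ≤ G x)
    (hG : ∀ x, Inv x → ¬ halt x → ∑ l, G (step x l) * Real.exp (r * cost x l) ≤ p * G x) :
    (∀ N, ∫⁻ ω, ENNReal.ofReal (Real.exp (r * costTo (absorb step halt) (absorbCost cost halt) x₀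
      (fun i => s i ω) N)) ∂μ ≤ ENNReal.ofReal (G x₀)) ∧
    ∫⁻ ω, ENNReal.ofReal (Real.exp (r * costTo step cost x₀ (fun i => s i ω)
      (stopTime step halt x₀ fun i => s i ω))) ∂μ ≤ ENNReal.ofReal (G x₀) := by
  have hA : ∀ x, Inv x → ∀ l, Inv (absorb step halt x l) := by
    intro x hx l
    unfold absorb
    split_ifs with h
    · exact hx
    · exact hInv x hx h l
  have hN : ∀ N, ∫⁻ ω, ENNReal.ofReal (Real.exp (r * costTo (absorb step halt)
      (absorbCost cost halt) x₀ (fun i => s i ω) N)) ∂μ ≤ ENNReal.ofReal (G x₀) := by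
    intro N
    have h1 := integral_exp_costTo_le (cost := absorbCost cost halt) (r := r) (G := G) hs h₀ hA
      (by
        intro x hx
        by_cases h : halt x
        · simp [absorb, absorbCost, h]
        · simpa [absorb, absorbCost, h] using hG x hx h) N
    have hpath : ∀ ω M, Inv (path (absorb step halt) x₀ (fun i => s i ω) M) := by
      intro ω M
      induction M with
      | zero => exact h₀
      | succ M ihM => exact hA _ ihM _
    rw [← ofReal_integral_eq_lintegral_ofReal]
    · apply ENNReal.ofReal_le_ofReal
      refine le_trans (integral_mono ?_ ?_ fun ω => ?_) h1
      · exact integrable_of_depends hs.1 (t := N) (Φ := fun a => Real.exp (r *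
          costTo (absorb step halt) (absorbCost cost halt) x₀ a N))
          fun a b hab => by simp only [costTo_congr _ N a b hab]
      · exact integrable_of_depends hs.1 (t := N) (Φ := fun a => G (path _ x₀ a N) * Real.exp (r *
          costTo (absorb step halt) (absorbCost cost halt) x₀ a N))
          fun a b hab => by simp only [path_congr N a b hab, costTo_congr _ N a b hab]
      · exact le_mul_of_one_le_left (Real.exp_pos _).le (hG1 _ (hpath ω N))
    · exact integrable_of_depends hs.1 (t := N) (Φ := fun a => Real.exp (r *
          costTo (absorb step halt) (absorbCost cost halt) x₀ a N))
          fun a b hab => by simp only [costTo_congr _ N a b hab]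
    · exact Filter.Eventually.of_forall fun ω => (Real.exp_pos _).le
  refine ⟨hN, ?_⟩
  have hFatou := lintegral_liminf_le (μ := μ) (u := Filter.atTop)
    (f := fun N ω => ENNReal.ofReal (Real.exp (r * costTo (absorb step halt)
      (absorbCost cost halt) x₀ (fun i => s i ω) N)))
    (fun N => measurable_of_depends hs.1 (t := N) (Φ := fun a => ENNReal.ofReal (Real.exp (r *
          costTo (absorb step halt) (absorbCost cost halt) x₀ a N)))
          fun a b hab => by simp only [costTo_congr _ N a b hab])
  refine le_trans (lintegral_mono fun ω => ?_) (hFatou.trans ?_)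
  · refine Filter.le_liminf_of_le (by isBoundedDefault) ?_
    filter_upwards [Filter.eventually_ge_atTop (stopTime step halt x₀ fun i => s i ω)] with N hN
    apply ENNReal.ofReal_le_ofReal
    apply Real.exp_le_exp.2
    apply mul_le_mul_of_nonneg_left _ hr
    exact_mod_cast costTo_absorb_le hN
  · refine Filter.liminf_le_of_frequently_le' ?_
    exact Filter.Frequently.of_forall hN

/-- The process stops almost surely. -/
lemma ae_exists_stop [IsProbabilityMeasure μ] [NeZero p]
    (hs : IsUniformSelection μ s) {r : ℝ} (hr : 0 < r) {G : X → ℝ} {Inv : X → Prop} (h₀ : Inv x₀)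
    (hInv : ∀ x, Inv x → ¬ halt x → ∀ l, Inv (step x l)) (hG1 : ∀ x, Inv x → 1 ≤ G x)
    (hG : ∀ x, Inv x → ¬ halt x → ∑ l, G (step x l) * Real.exp r ≤ p * G x) :
    ∀ᵐ ω ∂μ, ∃ t, halt (path step x₀ (fun i => s i ω) t) := by
  have hN := (lintegral_exp_costTo_stopTime_le (cost := fun _ _ => 1) hs hr.le h₀ hInv hG1
    (by simpa using hG)).1
  rw [ae_iff]
  refine le_antisymm ?_ (by simp)
  have hbound : ∀ N : ℕ, μ {ω | ¬ ∃ t, halt (path step x₀ (fun i => s i ω) t)}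
      ≤ ENNReal.ofReal (G x₀) / ENNReal.ofReal (Real.exp (r * N)) := by
    intro N
    refine le_trans (measure_mono ?_) ((meas_ge_le_lintegral_div (measurable_of_depends hs.1
      (t := N) (Φ := fun a => ENNReal.ofReal (Real.exp (r * costTo (absorb step halt)
          (absorbCost (fun _ _ => 1) halt) x₀ a N)))
          fun a b hab => by simp only [costTo_congr _ N a b hab]).aemeasurable
        (ε := ENNReal.ofReal (Real.exp (r * N))) ?_ ?_).trans ?_)
    · intro ω hω
      simp only [Set.mem_ofPred_eq, not_exists] at hω
      simp only [Set.mem_ofPred_eq]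
      rw [costTo_absorb_eq fun t _ => hω t]
      simp [costTo]
    · simp [Real.exp_pos]
    · simp
    · gcongr
      exact hN N
  have hlim : Filter.Tendsto (fun N : ℕ => ENNReal.ofReal (G x₀) / ENNReal.ofReal (Real.exp (r * N)))
      Filter.atTop (nhds 0) := by
    have h1 : Filter.Tendsto (fun N : ℕ => ENNReal.ofReal (Real.exp (r * N))) Filter.atTop
        (nhds ⊤) := by
      apply ENNReal.tendsto_ofReal_nhds_top.2
      apply Real.tendsto_exp_atTop.comp
      exact tendsto_natCast_atTop_atTop.const_mul_atTop hr
    have h2 := ENNReal.Tendsto.const_div h1 (a := ENNReal.ofReal (G x₀)) (Or.inr ENNReal.ofReal_ne_top)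
    simpa using h2
  exact ge_of_tendsto' hlim hbound

lemma measurable_stopTime [NeZero p] (hs : ∀ t, Measurable (s t)) :
    Measurable fun ω => stopTime step halt x₀ fun i => s i ω := by
  have hst : ∀ t, MeasurableSet {ω | halt (path step x₀ (fun i => s i ω) t)} := fun t =>
    measurableSet_setOfPred.2 (measurable_of_depends hs (t := t) (Φ := fun a => halt (path step x₀ a t))
      fun a b hab => by simp only [path_congr t a b hab])
  refine measurable_to_countable' fun N => ?_
  have : (fun ω => stopTime step halt x₀ fun i => s i ω) ⁻¹' {N}
      = ({ω | halt (path step x₀ (fun i => s i ω) N)}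
          ∩ ⋂ t, ⋂ _ : t < N, {ω | halt (path step x₀ (fun i => s i ω) t)}ᶜ)
        ∪ ({_ω | N = 0} ∩ ⋂ t, {ω | halt (path step x₀ (fun i => s i ω) t)}ᶜ) := by
    ext ω
    simp only [Set.mem_preimage, Set.mem_singleton_iff, Set.mem_union, Set.mem_inter_iff,
      Set.mem_ofPred_eq, Set.mem_iInter, Set.mem_compl_iff]
    constructor
    · rintro rfl
      by_cases h : ∃ t, halt (path step x₀ (fun i => s i ω) t)
      · exact Or.inl ⟨Nat.sInf_mem (s := {t | halt (path step x₀ (fun i => s i ω) t)}) h,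
          fun t ht => not_stop_of_lt_stopTime ht⟩
      · push Not at h
        refine Or.inr ⟨?_, h⟩
        simp [stopTime, h]
    · rintro (⟨h1, h2⟩ | ⟨rfl, h⟩)
      · apply le_antisymm (Nat.sInf_le h1)
        by_contra hlt
        push Not at hlt
        exact h2 _ hlt (Nat.sInf_mem (s := {t | halt (path step x₀ (fun i => s i ω) t)}) ⟨N, h1⟩)
      · simp [stopTime, h]
  rw [this]
  refine ((hst N).inter (.iInter fun t => .iInter fun _ => (hst t).compl)).union
    ((MeasurableSet.const _).inter (.iInter fun t => (hst t).compl))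

lemma measurable_costTo_stopTime [NeZero p] (hs : ∀ t, Measurable (s t)) (cost : X → Fin p → ℕ) :
    Measurable fun ω => costTo step cost x₀ (fun i => s i ω)
      (stopTime step halt x₀ fun i => s i ω) := by
  have h1 : Measurable (Function.uncurry fun (N : ℕ) ω =>
      costTo step cost x₀ (fun i => s i ω) N) := by
    apply measurable_from_prod_countable_right
    intro N
    exact measurable_of_depends hs (t := N) (Φ := fun a => costTo step cost x₀ a N)
      fun a b hab => costTo_congr cost N a b hab
  exact h1.comp ((measurable_stopTime hs).prodMk measurable_id)

end Path

/-! ### Guarantees -/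

section Guarantee

variable {Ω : Type*} [MeasurableSpace Ω] {μ : Measure Ω}

/-- An exponential moment gives a bound on the expectation and an exponential tail. -/
lemma guarantee_of_exp_moment [IsProbabilityMeasure μ] {T : Ω → ℕ} (hT : Measurable T) {r B : ℝ}
    (hr : 0 < r) (hB : 4 ≤ r * B)
    (h : ∫⁻ ω, ENNReal.ofReal (Real.exp (r * T ω)) ∂μ ≤ ENNReal.ofReal 4) : Guarantee μ T B := by
  have hmeas : Measurable fun ω => Real.exp (r * (T ω : ℝ)) := by
    have : Measurable fun ω => (T ω : ℝ) := measurable_from_top.comp hT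
    fun_prop
  have hint : Integrable (fun ω => Real.exp (r * (T ω : ℝ))) μ := by
    refine ⟨hmeas.aestronglyMeasurable, ?_⟩
    rw [hasFiniteIntegral_iff_ofReal (Filter.Eventually.of_forall fun ω => (Real.exp_pos _).le)]
    exact h.trans_lt ENNReal.ofReal_lt_top
  have hexp : ∫ ω, Real.exp (r * (T ω : ℝ)) ∂μ ≤ 4 := by
    rw [← ENNReal.ofReal_le_ofReal_iff (by norm_num), ofReal_integral_eq_lintegral_ofReal hint
      (Filter.Eventually.of_forall fun ω => (Real.exp_pos _).le)]
    exact h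
  have hle : ∀ ω, (T ω : ℝ) ≤ r⁻¹ * Real.exp (r * (T ω : ℝ)) := by
    intro ω
    rw [inv_mul_eq_div, le_div_iff₀ hr]
    have := Real.add_one_le_exp (r * (T ω : ℝ))
    linarith
  have hTint : Integrable (fun ω => (T ω : ℝ)) μ := by
    refine Integrable.mono' (hint.const_mul r⁻¹) (measurable_from_top.comp hT).aestronglyMeasurable
      (Filter.Eventually.of_forall fun ω => ?_)
    rw [Real.norm_of_nonneg (Nat.cast_nonneg _)]
    exact hle ω
  refine ⟨hTint, ?_, ?_⟩
  · calc ∫ ω, (T ω : ℝ) ∂μ ≤ ∫ ω, r⁻¹ * Real.exp (r * (T ω : ℝ)) ∂μ :=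
          integral_mono hTint (hint.const_mul r⁻¹) hle
      _ = r⁻¹ * ∫ ω, Real.exp (r * (T ω : ℝ)) ∂μ := integral_const_mul _ _
      _ ≤ r⁻¹ * 4 := by gcongr
      _ ≤ B := by rw [inv_mul_le_iff₀ hr]; exact hB
  · intro δ hδ hδ2
    set l := Real.log (1 / δ) with hl
    have hδl : Real.exp (-l) = δ := by
      rw [hl, Real.log_div one_ne_zero hδ.ne', Real.log_one, zero_sub, neg_neg, Real.exp_log hδ]
    have hl2 : Real.log 2 ≤ l := by
      apply Real.log_le_log (by norm_num)
      rw [le_div_iff₀ hδ]; linarith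
    have hl0 : 0 < l := (Real.log_pos (by norm_num)).trans_le hl2
    have hset : MeasurableSet {ω | (T ω : ℝ) ≤ B * l} :=
      measurableSet_le (measurable_from_top.comp hT) measurable_const
    have hcompl : μ.real {ω | (T ω : ℝ) ≤ B * l}ᶜ ≤ δ := by
      have hmark := mul_meas_ge_le_integral_of_nonneg
        (Filter.Eventually.of_forall fun ω => (Real.exp_pos (r * (T ω : ℝ))).le) hint
        (Real.exp (4 * l))
      have hsub : μ.real {ω | (T ω : ℝ) ≤ B * l}ᶜ
          ≤ μ.real {ω | Real.exp (4 * l) ≤ Real.exp (r * (T ω : ℝ))} := by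
        refine measureReal_mono (fun ω hω => ?_) (measure_ne_top _ _)
        simp only [Set.mem_compl_iff, Set.mem_ofPred_eq, not_le] at hω ⊢
        apply Real.exp_le_exp.2
        nlinarith
      have h4 : (4 : ℝ) ≤ Real.exp (3 * l) := by
        have h5 : (2 : ℝ) ≤ Real.exp l := by
          rw [← Real.log_le_iff_le_exp (by norm_num)]; exact hl2
        have h6 : Real.exp (3 * l) = Real.exp l ^ 3 := by
          rw [← Real.exp_nat_mul]; norm_num
        rw [h6]
        calc (4 : ℝ) ≤ 2 ^ 3 := by norm_num
          _ ≤ _ := pow_le_pow_left₀ (by norm_num) h5 3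
      have h7 : Real.exp (4 * l) * δ = Real.exp (3 * l) := by
        rw [← hδl, ← Real.exp_add]; congr 1; ring
      have h8 : 0 < Real.exp (4 * l) := Real.exp_pos _
      refine le_of_mul_le_mul_left ?_ h8
      calc _ ≤ Real.exp (4 * l) * μ.real {ω | Real.exp (4 * l) ≤ Real.exp (r * (T ω : ℝ))} :=
            mul_le_mul_of_nonneg_left hsub h8.le
        _ ≤ 4 := hmark.trans hexp
        _ ≤ _ := by rw [h7]; exact h4
    rw [probReal_compl_eq_one_sub hset] at hcompl
    linarith

/-- A bounded random variable has a guarantee of the order of its bound. -/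
lemma guarantee_of_le [IsProbabilityMeasure μ] {T : Ω → ℕ} (hT : Measurable T) {b B : ℝ}
    (h : ∀ ω, (T ω : ℝ) ≤ b) (hB : 2 * b ≤ B) : Guarantee μ T B := by
  have hb : 0 ≤ b := by
    have : Nonempty Ω := nonempty_of_isProbabilityMeasure μ
    obtain ⟨ω⟩ := this
    exact (Nat.cast_nonneg _).trans (h ω)
  have hint : Integrable (fun ω => (T ω : ℝ)) μ := by
    refine Integrable.of_bound (measurable_from_top.comp hT).aestronglyMeasurable b
      (Filter.Eventually.of_forall fun ω => ?_)
    rw [Real.norm_of_nonneg (Nat.cast_nonneg _)]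
    exact h ω
  refine ⟨hint, ?_, ?_⟩
  · calc ∫ ω, (T ω : ℝ) ∂μ ≤ ∫ _ω, b ∂μ := integral_mono hint (integrable_const _) h
      _ = b := by simp
      _ ≤ B := by linarith
  · intro δ hδ hδ2
    have hl2 : Real.log 2 ≤ Real.log (1 / δ) := by
      apply Real.log_le_log (by norm_num)
      rw [le_div_iff₀ hδ]; linarith
    have h2 := Real.log_two_gt_d9
    have : {ω | (T ω : ℝ) ≤ B * Real.log (1 / δ)} = Set.univ := by
      ext ω
      simp only [Set.mem_ofPred_eq, Set.mem_univ, iff_true]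
      have := h ω
      nlinarith
    rw [this]
    simp
    exact hδ.le

end Guarantee

end Osborne

namespace Osborne

/-! ### The number of rounds and the total cost -/

section Rounds

variable {n p : ℕ} {K : Matrix (Fin n) (Fin n) ℝ} {ε η : ℝ} {color : Fin n → Fin p}
  {X : Type*} {step : X → Fin p → X} {halt : X → Prop} {iter : X → Fin n → ℝ} {Inv : X → Prop}

/-- The properties of a single round that determine the running time: a round performs a damped
sweep over its block, and the rounds of block `0` stop unless they end far from balance. -/
structure Rounds (K : Matrix (Fin n) (Fin n) ℝ) (ε η : ℝ) (color : Fin n → Fin p)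
    (step : X → Fin p → X) (halt : X → Prop) (iter : X → Fin n → ℝ) (Inv : X → Prop) : Prop where
  inv : ∀ x, Inv x → ¬ halt x → ∀ l, Inv (step x l)
  total_le : ∀ x, Inv x → total K (iter x) ≤ total K 0
  sweep : ∀ x, Inv x → ¬ halt x → ∀ l,
    Sweep K η (block color l).reverse (iter x) (iter (step x l))
  unbalanced : ∀ x, Inv x → ¬ halt x → ∀ l : Fin p, (l : ℕ) = 0 → ¬ halt (step x l) →
    ε / 8 * total K (iter (step x l)) ≤ imbalance K (iter (step x l))

lemma mem_block {k : Fin n} {l : Fin p} : k ∈ block color l ↔ color k = l := by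
  simp [block]

lemma nodup_block (color : Fin n → Fin p) (l : Fin p) : (block color l).Nodup :=
  Finset.sort_nodup _ _

lemma sum_block {M : Type*} [AddCommMonoid M] (color : Fin n → Fin p) (f : Fin n → M) (l : Fin p) :
    ((block color l).map f).sum = ∑ k with color k = l, f k := by
  rw [← List.sum_toFinset _ (nodup_block color l)]
  congr 1
  ext k
  simp [mem_block]

lemma sum_sum_block {M : Type*} [AddCommMonoid M] (color : Fin n → Fin p) (f : Fin n → M) :
    ∑ l, ((block color l).map f).sum = ∑ k, f k := by
  simp only [sum_block]
  exact Finset.sum_fiberwise _ _ _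

/-- If a round of block `0` does not stop, then a round of a uniformly random block decreases the
potential by at least `10⁻⁵ / p` on average. -/
lemma Rounds.random_progress (hR : Rounds K ε η color step halt iter Inv)
    (hn : 2 ≤ n) (hK : K.IsIrreducible) (hε : 0 < ε) (hε1 : ε ≤ 1)
    (hη0 : 0 ≤ η) (hη : η ≤ ε / (1000 * n))
    {w : Fin n → ℝ} (hw : ∀ y, total K w ≤ total K y) {x : X} (hx : Inv x) (hst : ¬ halt x)
    {l₀ : Fin p} (hl₀ : (l₀ : ℕ) = 0) (hcont : ¬ halt (step x l₀)) :
    10⁻¹ ^ 5 ≤ ∑ l, (potential K ε w (iter x) - potential K ε w (iter (step x l))) := by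
  have hP := posSums_of_isIrreducible hn hK
  have hη1 : η ≤ 1 := by
    refine hη.trans ?_
    have : (2 : ℝ) ≤ n := by exact_mod_cast hn
    rw [div_le_one (by positivity)]
    linarith
  have hle : ∀ l, total K (iter (step x l)) ≤ total K (iter x) := fun l =>
    (hR.sweep x hx hst l).total_le hK.nonneg hP
  have hF := total_pos hn hP (iter x)
  have hgap : hellGap K (iter x) ≤ 6 * ∑ l, (total K (iter x) - total K (iter (step x l)))
      + n * (4 * η ^ 2 * total K (iter x)) := by
    have h1 : ∀ l, ((block color l).map fun k => sqrtGap K (iter x) k ^ 2).sum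
        ≤ 6 * (total K (iter x) - total K (iter (step x l)))
          + ((block color l).map fun _ => 4 * η ^ 2 * total K (iter x)).sum := by
      intro l
      have := (hR.sweep x hx hst l).sum_sqrtGap_le hK.nonneg hP hη1
        (List.nodup_reverse.2 (nodup_block color l))
      simpa [List.sum_reverse] using this
    have h2 := Finset.sum_le_sum fun l (_ : l ∈ Finset.univ) => h1 l
    rw [Finset.sum_add_distrib, sum_sum_block, sum_sum_block, ← Finset.mul_sum] at h2
    simpa [hellGap] using h2
  have hsingle : total K (iter x) - total K (iter (step x l₀))
      ≤ ∑ l, (total K (iter x) - total K (iter (step x l))) :=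
    Finset.single_le_sum (f := fun l => total K (iter x) - total K (iter (step x l)))
      (fun l _ => sub_nonneg.2 (hle l)) (Finset.mem_univ l₀)
  have hor := (hR.sweep x hx hst l₀).progress_or hn hK hε hε1
    (List.nodup_reverse.2 (nodup_block color l₀)) (hR.unbalanced x hx hst l₀ hl₀ hcont)
  have h3 := gapRate_le_of_progress hn hK hε hw (hR.total_le x hx) hη0 hη hgap
    (hor.imp_left fun h => h.trans hsingle)
  have h4 : ∑ l, (total K (iter x) - total K (iter (step x l)))
      ≤ total K (iter x) * gapRate K ε w (iter x) *
        ∑ l, (potential K ε w (iter x) - potential K ε w (iter (step x l))) := by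
    rw [Finset.mul_sum]
    exact Finset.sum_le_sum fun l _ => potential_drop hn hK hε w (hle l)
  have h5 : 0 < total K (iter x) * gapRate K ε w (iter x) := mul_pos hF (gapRate_pos hε)
  refine le_of_mul_le_mul_left ?_ h5
  linarith

lemma exp_le_one_add_two_mul {u : ℝ} (h0 : 0 ≤ u) (h1 : u ≤ 1) : Real.exp u ≤ 1 + 2 * u := by
  have := Real.abs_exp_sub_one_le (x := u) (by rwa [abs_of_nonneg h0])
  rw [abs_of_nonneg h0] at this
  have := (abs_le.1 this).2
  linarith

/-- The scale of the number of rounds of the random variants. -/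
noncomputable def roundScale (p : ℕ) (K : Matrix (Fin n) (Fin n) ℝ) (ε : ℝ) : ℝ :=
  p * (1 + 2 * 10 ^ 5 * rate K ε)

open Classical in
/-- A Lyapunov function of the random variants: `1` on stopped states, and between `1` and `2` on
the others. It adds up the expected time to the next round of block `0` and the time in which the
potential is used up. -/
noncomputable def lyapunov (p : ℕ) (K : Matrix (Fin n) (Fin n) ℝ) (ε : ℝ) (w : Fin n → ℝ)
    (halt : X → Prop) (iter : X → Fin n → ℝ) (x : X) : ℝ :=
  1 + (if halt x then 0 else p + 10 ^ 5 * p * potential K ε w (iter x)) / roundScale p K ε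

lemma one_le_lyapunov [NeZero p] (hn : 2 ≤ n) (hK : K.IsIrreducible) (hε : 0 < ε) (hε1 : ε ≤ 1)
    {w : Fin n → ℝ} (hw : ∀ y, total K w ≤ total K y) (x : X) :
    1 ≤ lyapunov p K ε w halt iter x := by
  have h1 := half_le_rate hn hK hε hε1
  unfold lyapunov roundScale
  rw [le_add_iff_nonneg_right]
  apply div_nonneg _ (by positivity)
  split_ifs
  · exact le_rfl
  · have := potential_nonneg hn hK hε hw (iter x)
    positivity

lemma Rounds.lyapunov_le (hR : Rounds K ε η color step halt iter Inv) [NeZero p]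
    (hn : 2 ≤ n) (hK : K.IsIrreducible) (hε : 0 < ε) (hε1 : ε ≤ 1)
    (w : Fin n → ℝ) {x : X} (hx : Inv x) :
    lyapunov p K ε w halt iter x ≤ 2 := by
  classical
  have hp : (0 : ℝ) < p := by exact_mod_cast Nat.pos_of_ne_zero (NeZero.ne p)
  have h1 := half_le_rate hn hK hε hε1
  unfold lyapunov roundScale
  suffices h : (if halt x then 0 else p + 10 ^ 5 * p * potential K ε w (iter x)) /
      (p * (1 + 2 * 10 ^ 5 * rate K ε)) ≤ 1 by linarith
  rw [div_le_one (by positivity)]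
  split_ifs
  · positivity
  · have := potential_le hn hK hε w (hR.total_le x hx)
    nlinarith

/-- The Lyapunov function decreases on average. If a round of block `0` stops, this removes its first
summand with probability `1 / p`; otherwise the potential decreases. -/
lemma Rounds.sum_lyapunov_le (hR : Rounds K ε η color step halt iter Inv) [NeZero p]
    (hn : 2 ≤ n) (hK : K.IsIrreducible) (hε : 0 < ε) (hε1 : ε ≤ 1)
    (hη0 : 0 ≤ η) (hη : η ≤ ε / (1000 * n))
    {w : Fin n → ℝ} (hw : ∀ y, total K w ≤ total K y) {x : X} (hx : Inv x) (hst : ¬ halt x) :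
    ∑ l, lyapunov p K ε w halt iter (step x l)
      ≤ p * lyapunov p K ε w halt iter x - p / roundScale p K ε := by
  classical
  have hp : (0 : ℝ) < p := by exact_mod_cast Nat.pos_of_ne_zero (NeZero.ne p)
  have h1 := half_le_rate hn hK hε hε1
  have hV : 0 < roundScale p K ε := by unfold roundScale; positivity
  have hP := posSums_of_isIrreducible hn hK
  set Ψ := fun y => potential K ε w (iter y) with hΨ
  have hΨ0 : ∀ y, 0 ≤ Ψ y := fun y => potential_nonneg hn hK hε hw _
  have hmono : ∀ l, Ψ (step x l) ≤ Ψ x := fun l =>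
    potential_mono hn hK hε w ((hR.sweep x hx hst l).total_le hK.nonneg hP)
  have key : ∑ l, (if halt (step x l) then 0 else p + 10 ^ 5 * p * Ψ (step x l))
      ≤ p * (p + 10 ^ 5 * p * Ψ x) - p := by
    by_cases h0 : halt (step x 0)
    · rw [← Finset.sum_erase_add _ _ (Finset.mem_univ (0 : Fin p)), if_pos h0, add_zero]
      calc _ ≤ ∑ _l ∈ Finset.univ.erase (0 : Fin p), (p + 10 ^ 5 * p * Ψ x) := by
            refine Finset.sum_le_sum fun l _ => ?_
            have := hmono l
            have := hΨ0 x
            split_ifs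
            · positivity
            · gcongr
        _ = (p - 1) * (p + 10 ^ 5 * p * Ψ x) := by
            rw [Finset.sum_const, Finset.card_erase_of_mem (Finset.mem_univ _)]
            rw [nsmul_eq_mul, Nat.cast_sub (by simpa using NeZero.one_le (n := p))]
            simp
        _ ≤ _ := by
            have : 0 ≤ 10 ^ 5 * p * Ψ x := mul_nonneg (by positivity) (hΨ0 x)
            linarith
    · have hprog := hR.random_progress hn hK hε hε1 hη0 hη hw hx hst (l₀ := 0) rfl h0
      calc _ ≤ ∑ l, (p + 10 ^ 5 * p * Ψ (step x l)) := by
            refine Finset.sum_le_sum fun l _ => ?_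
            have := hΨ0 (step x l)
            split_ifs
            · positivity
            · exact le_rfl
        _ = p * (p + 10 ^ 5 * p * Ψ x) - 10 ^ 5 * p * ∑ l, (Ψ x - Ψ (step x l)) := by
            rw [Finset.sum_sub_distrib, Finset.sum_add_distrib, ← Finset.mul_sum]
            simp
            ring
        _ ≤ _ := by
            have := mul_le_mul_of_nonneg_left hprog (by positivity : (0 : ℝ) ≤ 10 ^ 5 * p)
            have e : (10 : ℝ) ^ 5 * p * 10⁻¹ ^ 5 = p := by norm_num; ring
            rw [e] at this
            linarith
  unfold lyapunov
  rw [Finset.sum_add_distrib, ← Finset.sum_div, if_neg hst]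
  have := div_le_div_of_nonneg_right key hV.le
  rw [sub_div] at this
  simp only [Finset.sum_const, Finset.card_univ, Fintype.card_fin, nsmul_eq_mul, mul_one]
  rw [mul_add, mul_one, ← mul_div_assoc]
  linarith

/-- The exponent for which the accumulated cost has a bounded exponential moment. -/
noncomputable def costExponent (p : ℕ) (K : Matrix (Fin n) (Fin n) ℝ) (ε S : ℝ) : ℝ :=
  p / (4 * roundScale p K ε * S)

/-- The decrease of the Lyapunov function outweighs the factors `exp (r * cost)`, because the costs of the
blocks add up to at most `S` and the Lyapunov function is at most `2`. -/
lemma Rounds.sum_lyapunov_mul_exp_le (hR : Rounds K ε η color step halt iter Inv) [NeZero p]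
    (hn : 2 ≤ n) (hK : K.IsIrreducible) (hε : 0 < ε) (hε1 : ε ≤ 1)
    (hη0 : 0 ≤ η) (hη : η ≤ ε / (1000 * n))
    {w : Fin n → ℝ} (hw : ∀ y, total K w ≤ total K y) {cost : X → Fin p → ℕ} {c : Fin p → ℝ} {S : ℝ}
    (hc : ∀ x, Inv x → ¬ halt x → ∀ l, (cost x l : ℝ) ≤ c l) (hS0 : 0 < S) (hS : ∑ l, c l ≤ S)
    {x : X} (hx : Inv x) (hst : ¬ halt x) :
    ∑ l, lyapunov p K ε w halt iter (step x l) * Real.exp (costExponent p K ε S * cost x l)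
      ≤ p * lyapunov p K ε w halt iter x := by
  have hp : (0 : ℝ) < p := by exact_mod_cast Nat.pos_of_ne_zero (NeZero.ne p)
  have h1 := half_le_rate hn hK hε hε1
  have hV : 0 < roundScale p K ε := by unfold roundScale; positivity
  have hpV : p ≤ roundScale p K ε := by
    unfold roundScale
    exact le_mul_of_one_le_right hp.le (by linarith)
  set r := costExponent p K ε S with hr
  have hr0 : 0 < r := by rw [hr, costExponent]; positivity
  have hrS : r * S = p / (4 * roundScale p K ε) := by
    rw [hr, costExponent]; field_simp
  have hc0 : ∀ l, 0 ≤ c l := fun l => (Nat.cast_nonneg _).trans (hc x hx hst l)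
  have hcS : ∀ l, c l ≤ S := fun l =>
    (Finset.single_le_sum (fun l _ => hc0 l) (Finset.mem_univ l)).trans hS
  have hterm : ∀ l, lyapunov p K ε w halt iter (step x l) * Real.exp (r * cost x l)
      ≤ lyapunov p K ε w halt iter (step x l) + 4 * r * c l := by
    intro l
    have h2 : r * cost x l ≤ r * c l := mul_le_mul_of_nonneg_left (hc x hx hst l) hr0.le
    have h3 : r * c l ≤ 1 := by
      refine (mul_le_mul_of_nonneg_left (hcS l) hr0.le).trans ?_
      rw [hrS, div_le_one (by positivity)]
      linarith
    have h4 := exp_le_one_add_two_mul (mul_nonneg hr0.le (hc0 l)) h3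
    have h5 := (Real.exp_le_exp.2 h2).trans h4
    have h6 := one_le_lyapunov (p := p) (halt := halt) (iter := iter) hn hK hε hε1 hw (step x l)
    have h7 := hR.lyapunov_le hn hK hε hε1 w (hR.inv x hx hst l)
    have h8 : 0 ≤ r * c l := mul_nonneg hr0.le (hc0 l)
    nlinarith
  have hsum := hR.sum_lyapunov_le hn hK hε hε1 hη0 hη hw hx hst
  calc _ ≤ ∑ l, (lyapunov p K ε w halt iter (step x l) + 4 * r * c l) :=
        Finset.sum_le_sum fun l _ => hterm l
    _ = ∑ l, lyapunov p K ε w halt iter (step x l) + 4 * r * ∑ l, c l := by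
        rw [Finset.sum_add_distrib, ← Finset.mul_sum]
    _ ≤ _ + 4 * r * S := by gcongr
    _ = ∑ l, lyapunov p K ε w halt iter (step x l) + p / roundScale p K ε := by
        rw [mul_assoc, hrS]; field_simp
    _ ≤ _ := by linarith

variable {Ω : Type*} [MeasurableSpace Ω] {μ : Measure Ω} {s : ℕ → Ω → Fin p} {x₀ : X}

lemma Rounds.random_ae_stop [IsProbabilityMeasure μ]
    (hR : Rounds K ε η color step halt iter Inv) [NeZero p]
    (hn : 2 ≤ n) (hK : K.IsIrreducible) (hε : 0 < ε) (hε1 : ε ≤ 1)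
    (hη0 : 0 ≤ η) (hη : η ≤ ε / (1000 * n)) (hs : IsUniformSelection μ s) (h₀ : Inv x₀) :
    ∀ᵐ ω ∂μ, ∃ t, halt (path step x₀ (fun i => s i ω) t) := by
  have hp : (0 : ℝ) < p := by exact_mod_cast Nat.pos_of_ne_zero (NeZero.ne p)
  have h1 := half_le_rate hn hK hε hε1
  obtain ⟨w, -, hw⟩ := exists_minimizer hn hK
  refine ae_exists_stop (r := costExponent p K ε p) (G := lyapunov p K ε w halt iter) hs ?_ h₀
    hR.inv (fun x _ => one_le_lyapunov hn hK hε hε1 hw x) fun x hx hst => ?_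
  · unfold costExponent roundScale; positivity
  · simpa using hR.sum_lyapunov_mul_exp_le hn hK hε hε1 hη0 hη hw (cost := fun _ _ => 1)
      (c := fun _ => 1) (S := p) (by simp) hp (by simp) hx hst

lemma Rounds.random_guarantee [IsProbabilityMeasure μ]
    (hR : Rounds K ε η color step halt iter Inv) [NeZero p]
    (hn : 2 ≤ n) (hK : K.IsIrreducible) (hε : 0 < ε) (hε1 : ε ≤ 1)
    (hη0 : 0 ≤ η) (hη : η ≤ ε / (1000 * n)) (hs : IsUniformSelection μ s) (h₀ : Inv x₀)
    {cost : X → Fin p → ℕ} {c : Fin p → ℝ} {S : ℝ}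
    (hc : ∀ x, Inv x → ¬ halt x → ∀ l, (cost x l : ℝ) ≤ c l) (hS : ∑ l, c l ≤ S)
    {A : ℕ} (hA : 0 < S) (hAS : A ≤ S) {B : ℝ} (hB : 10 ^ 7 * S * rate K ε ≤ B) :
    Guarantee μ (fun ω => A + costTo step cost x₀ (fun i => s i ω)
      (stopTime step halt x₀ fun i => s i ω)) B := by
  have hp : (0 : ℝ) < p := by exact_mod_cast Nat.pos_of_ne_zero (NeZero.ne p)
  have h1 := half_le_rate hn hK hε hε1
  have hV : 0 < roundScale p K ε := by unfold roundScale; positivity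
  have hpV : p ≤ roundScale p K ε := by
    unfold roundScale
    exact le_mul_of_one_le_right hp.le (by linarith)
  obtain ⟨w, -, hw⟩ := exists_minimizer hn hK
  set r := costExponent p K ε S with hr
  have hr0 : 0 < r := by rw [hr, costExponent]; positivity
  have hrS : r * S = p / (4 * roundScale p K ε) := by
    rw [hr, costExponent]; field_simp
  have hmeas : Measurable fun ω => A + costTo step cost x₀ (fun i => s i ω)
      (stopTime step halt x₀ fun i => s i ω) :=
    measurable_const.add (measurable_costTo_stopTime hs.1 cost)
  refine guarantee_of_exp_moment hmeas hr0 ?_ ?_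
  · refine le_trans ?_ (mul_le_mul_of_nonneg_left hB hr0.le)
    have e : r * (10 ^ 7 * S * rate K ε) = 10 ^ 7 * rate K ε * (r * S) := by ring
    rw [e, hrS, roundScale, ← mul_div_assoc, le_div_iff₀ (by positivity)]
    nlinarith
  · have h2 := (lintegral_exp_costTo_stopTime_le (cost := cost) (halt := halt)
      (G := lyapunov p K ε w halt iter) hs hr0.le h₀
      hR.inv (fun x _ => one_le_lyapunov hn hK hε hε1 hw x) fun x hx hst =>
        hR.sum_lyapunov_mul_exp_le hn hK hε hε1 hη0 hη hw hc hA hS hx hst).2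
    have hrA : Real.exp (r * A) ≤ 2 := by
      have h3 : r * A ≤ 1 / 4 := by
        refine (mul_le_mul_of_nonneg_left hAS hr0.le).trans ?_
        rw [hrS, div_le_div_iff₀ (by positivity) (by norm_num)]
        linarith
      have h4 := exp_le_one_add_two_mul (mul_nonneg hr0.le (Nat.cast_nonneg A)) (by linarith)
      linarith
    have hG := hR.lyapunov_le hn hK hε hε1 w h₀
    calc _ = ∫⁻ ω, ENNReal.ofReal (Real.exp (r * A)) * ENNReal.ofReal (Real.exp (r *
          costTo step cost x₀ (fun i => s i ω) (stopTime step halt x₀ fun i => s i ω))) ∂μ := by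
          congr 1
          ext ω
          rw [← ENNReal.ofReal_mul (Real.exp_pos _).le, ← Real.exp_add]
          push_cast
          ring_nf
      _ = ENNReal.ofReal (Real.exp (r * A)) * ∫⁻ ω, ENNReal.ofReal (Real.exp (r *
          costTo step cost x₀ (fun i => s i ω) (stopTime step halt x₀ fun i => s i ω))) ∂μ :=
          lintegral_const_mul' _ _ ENNReal.ofReal_ne_top
      _ ≤ ENNReal.ofReal 2 * ENNReal.ofReal 2 := by
          gcongr
          exact h2.trans (ENNReal.ofReal_le_ofReal hG)
      _ = ENNReal.ofReal 4 := by
          rw [← ENNReal.ofReal_mul (by norm_num)]; norm_num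

/-! ### Cyclic selections -/

/-- The coordinates updated in the first `j` rounds of a cycle in the order `τ`. -/
def cycleList (color : Fin n → Fin p) (τ : Equiv.Perm (Fin p)) (j : ℕ) : List (Fin n) :=
  ((List.finRange p).take j).flatMap fun i => (block color (τ i)).reverse

lemma nodup_cycleList (color : Fin n → Fin p) (τ : Equiv.Perm (Fin p)) (j : ℕ) :
    (cycleList color τ j).Nodup := by
  unfold cycleList
  rw [List.nodup_flatMap]
  refine ⟨fun i _ => List.nodup_reverse.2 (nodup_block color _), ?_⟩
  have hnd : ((List.finRange p).take j).Nodup := (List.nodup_finRange p).sublist (List.take_sublist _ _)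
  refine hnd.imp fun {a b} hab => ?_
  intro k ha hb
  rw [List.mem_reverse, mem_block] at ha hb
  exact hab (τ.injective (ha.symm.trans hb))

lemma mem_cycleList (color : Fin n → Fin p) (τ : Equiv.Perm (Fin p)) (k : Fin n) :
    k ∈ cycleList color τ p := by
  unfold cycleList
  rw [List.take_of_length_le (by simp), List.mem_flatMap]
  exact ⟨τ.symm (color k), List.mem_finRange _, by simp [mem_block]⟩

/-- The rounds of a cycle join up to a sweep over distinct coordinates. -/
lemma Rounds.sweep_cycle (hR : Rounds K ε η color step halt iter Inv) {a : ℕ → Fin p}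
    {τ : Equiv.Perm (Fin p)} {t : ℕ} (ha : ∀ i : Fin p, a (t + i) = τ i)
    (h₀ : Inv (path step x₀ a t)) {j : ℕ} (hj : j ≤ p)
    (hst : ∀ i < j, ¬ halt (path step x₀ a (t + i))) :
    Inv (path step x₀ a (t + j)) ∧
      Sweep K η (cycleList color τ j) (iter (path step x₀ a t)) (iter (path step x₀ a (t + j))) := by
  induction j with
  | zero => exact ⟨h₀, by simpa [cycleList] using Sweep.nil _⟩
  | succ j ih =>
    obtain ⟨hi, hsw⟩ := ih (by omega) fun i hi => hst i (by omega)
    have hns := hst j (by omega)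
    have hp : path step x₀ a (t + (j + 1)) = step (path step x₀ a (t + j)) (a (t + j)) := rfl
    rw [hp]
    refine ⟨hR.inv _ hi hns _, ?_⟩
    have e : cycleList color τ (j + 1)
        = cycleList color τ j ++ (block color (a (t + j))).reverse := by
      have hj' : j < (List.finRange p).length := by simp; omega
      unfold cycleList
      rw [List.take_succ_eq_append_getElem hj', List.flatMap_append]
      congr 1
      have := ha ⟨j, by omega⟩
      simp only at this
      simp [this]
    rw [e]
    exact hsw.append (hR.sweep _ hi hns _)

/-- A cycle without a stop decreases the potential by a constant. -/
lemma Rounds.cyclic_progress (hR : Rounds K ε η color step halt iter Inv) [NeZero p]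
    (hn : 2 ≤ n) (hK : K.IsIrreducible) (hε : 0 < ε) (hε1 : ε ≤ 1)
    (hη0 : 0 ≤ η) (hη : η ≤ ε / (1000 * n))
    {w : Fin n → ℝ} (hw : ∀ y, total K w ≤ total K y) {a : ℕ → Fin p}
    {τ : Equiv.Perm (Fin p)} {t : ℕ} (ha : ∀ i : Fin p, a (t + i) = τ i)
    (h₀ : Inv (path step x₀ a t))
    (hst : ∀ i ≤ p, ¬ halt (path step x₀ a (t + i))) :
    10⁻¹ ^ 5 ≤ potential K ε w (iter (path step x₀ a t))
      - potential K ε w (iter (path step x₀ a (t + p))) := by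
  have hP := posSums_of_isIrreducible hn hK
  have hη1 : η ≤ 1 := by
    refine hη.trans ?_
    have : (2 : ℝ) ≤ n := by exact_mod_cast hn
    rw [div_le_one (by positivity)]
    linarith
  set x := path step x₀ a t
  obtain ⟨-, hfull⟩ := hR.sweep_cycle ha h₀ le_rfl fun i hi => hst i hi.le
  have hle := hfull.total_le hK.nonneg hP
  have hF := total_pos hn hP (iter x)
  have huniv : (cycleList color τ p).toFinset = Finset.univ := by
    ext k; simp [mem_cycleList]
  have hnd := nodup_cycleList color τ p
  have hlen : (cycleList color τ p).length = n := by
    rw [← List.toFinset_card_of_nodup hnd, huniv]; simp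
  have hgap : hellGap K (iter x) ≤
      6 * (total K (iter x) - total K (iter (path step x₀ a (t + p))))
      + n * (4 * η ^ 2 * total K (iter x)) := by
    have := hfull.sum_sqrtGap_le hK.nonneg hP hη1 hnd
    rwa [hlen, ← List.sum_toFinset _ hnd, huniv] at this
  -- the round of block `0` in this cycle
  set j := τ.symm 0 with hj
  obtain ⟨hi, hsw⟩ := hR.sweep_cycle ha h₀ j.2.le fun i hi => hst i (hi.le.trans j.2.le)
  have hns := hst j j.2.le
  have haj : a (t + j) = 0 := by rw [ha]; simp [hj]
  have hsw' := hsw.append (hR.sweep _ hi hns (a (t + j)))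
  have hpath : path step x₀ a (t + (j + 1)) = step (path step x₀ a (t + j)) (a (t + j)) := rfl
  obtain ⟨hi', hsw''⟩ := hR.sweep_cycle ha h₀ j.2 fun i hi => hst i (hi.le.trans j.2)
  have hunb := hR.unbalanced _ hi hns (a (t + j)) (by rw [haj]; rfl)
    (by rw [← hpath]; exact hst (j + 1) j.2)
  rw [← hpath] at hunb
  have hor := hsw''.progress_or hn hK hε hε1 (nodup_cycleList color τ _) hunb
  -- the mass does not increase after the round of block `0`
  have hmono : ∀ i, j + 1 + i ≤ p → total K (iter (path step x₀ a (t + (j + 1 + i))))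
      ≤ total K (iter (path step x₀ a (t + (j + 1)))) := by
    intro i
    induction i with
    | zero => intro _; exact le_rfl
    | succ i ih =>
      intro hle
      have h1 := (hR.sweep_cycle ha h₀ (j := j + 1 + i) (by omega)
        fun i' hi' => hst i' (by omega)).1
      have h2 := (hR.sweep _ h1 (hst _ (by omega)) (a (t + (j + 1 + i)))).total_le hK.nonneg hP
      exact h2.trans (ih (by omega))
  have hend : total K (iter (path step x₀ a (t + p)))
      ≤ total K (iter (path step x₀ a (t + (j + 1)))) := by
    have := hmono (p - (j + 1)) (by omega)
    rwa [show (j : ℕ) + 1 + (p - (j + 1)) = p by omega] at this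
  have h3 := gapRate_le_of_progress hn hK hε hw (hR.total_le x h₀) hη0 hη hgap
    (hor.imp_left fun h => by linarith)
  have h4 := potential_drop hn hK hε w hle
  have h5 : 0 < total K (iter x) * gapRate K ε w (iter x) := mul_pos hF (gapRate_pos hε)
  refine le_of_mul_le_mul_left ?_ h5
  linarith

/-- With cyclic selections the number of cycles is bounded for every outcome. -/
lemma Rounds.cyclic_exists_stop (hR : Rounds K ε η color step halt iter Inv) [NeZero p]
    (hn : 2 ≤ n) (hK : K.IsIrreducible) (hε : 0 < ε) (hε1 : ε ≤ 1)
    (hη0 : 0 ≤ η) (hη : η ≤ ε / (1000 * n)) (h₀ : Inv x₀) {a : ℕ → Fin p}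
    {τ : ℕ → Equiv.Perm (Fin p)} (ha : ∀ c (i : Fin p), a (c * p + i) = τ c i)
    {N : ℕ} (hN : 2 * 10 ^ 5 * rate K ε < N) :
    ∃ t ≤ N * p, halt (path step x₀ a t) := by
  by_contra hcon
  push Not at hcon
  obtain ⟨w, -, hw⟩ := exists_minimizer hn hK
  have hinv : ∀ t ≤ N * p, Inv (path step x₀ a t) := by
    intro t
    induction t with
    | zero => intro _; exact h₀
    | succ t ih => intro ht; exact hR.inv _ (ih (by omega)) (hcon t (by omega)) _
  have hdrop : ∀ c ≤ N, potential K ε w (iter (path step x₀ a (c * p)))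
      ≤ potential K ε w (iter x₀) - c * 10⁻¹ ^ 5 := by
    intro c
    induction c with
    | zero => intro _; simp [path]
    | succ c ih =>
      intro hc
      have hcp : (c + 1) * p ≤ N * p := Nat.mul_le_mul_right p hc
      have e : (c + 1) * p = c * p + p := by ring
      have h1 := ih (by omega)
      have h2 := hR.cyclic_progress hn hK hε hε1 hη0 hη hw (x₀ := x₀) (ha c)
        (hinv _ (by omega)) fun i hi => hcon _ (by omega)
      rw [e]
      push_cast
      linarith
  have h1 := hdrop N le_rfl
  have h2 := potential_nonneg hn hK hε hw (iter (path step x₀ a (N * p)))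
  have h3 := potential_le hn hK hε w (hR.total_le x₀ h₀)
  norm_num at h1
  linarith

lemma measurable_of_isCyclicSelection [NeZero p] (hs : IsCyclicSelection μ s) (t : ℕ) :
    Measurable (s t) := by
  obtain ⟨τ, hτ, -, -, hsτ⟩ := hs
  have hp := Nat.pos_of_ne_zero (NeZero.ne p)
  refine measurable_to_countable' fun l => ?_
  have ht : t = t / p * p + ((⟨t % p, Nat.mod_lt t hp⟩ : Fin p) : ℕ) := by
    simp [Nat.div_add_mod']
  have : s t ⁻¹' {l} = ⋃ σ ∈ {σ : Equiv.Perm (Fin p) | σ ⟨t % p, Nat.mod_lt t hp⟩ = l},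
      {ω | τ (t / p) ω = σ} := by
    ext ω
    have h1 := hsτ (t / p) ω ⟨t % p, Nat.mod_lt t hp⟩
    rw [← ht] at h1
    simp [h1]
  rw [this]
  exact MeasurableSet.biUnion (Set.to_countable _) fun σ _ => hτ _ σ

lemma sum_range_cycles {a : ℕ → Fin p} {τ : ℕ → Equiv.Perm (Fin p)}
    (ha : ∀ c (i : Fin p), a (c * p + i) = τ c i) (f : Fin p → ℝ) (N : ℕ) :
    ∑ t ∈ Finset.range (N * p), f (a t) = N * ∑ l, f l := by
  induction N with
  | zero => simp
  | succ N ih =>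
    rw [show (N + 1) * p = N * p + p by ring, Finset.sum_range_add, ih,
      Finset.sum_range fun i => f (a (N * p + i))]
    simp only [ha, Equiv.sum_comp (τ N) f]
    push_cast
    ring

lemma Rounds.cyclic_guarantee [IsProbabilityMeasure μ]
    (hR : Rounds K ε η color step halt iter Inv) [NeZero p]
    (hn : 2 ≤ n) (hK : K.IsIrreducible) (hε : 0 < ε) (hε1 : ε ≤ 1)
    (hη0 : 0 ≤ η) (hη : η ≤ ε / (1000 * n)) (hs : IsCyclicSelection μ s) (h₀ : Inv x₀)
    {cost : X → Fin p → ℕ} {c : Fin p → ℝ} {S : ℝ} (hc0 : ∀ l, 0 ≤ c l)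
    (hc : ∀ x, Inv x → ¬ halt x → ∀ l, (cost x l : ℝ) ≤ c l) (hS : ∑ l, c l ≤ S)
    {A : ℕ} (hA : 0 < S) (hAS : A ≤ S) {B : ℝ} (hB : 10 ^ 7 * S * rate K ε ≤ B) :
    Guarantee μ (fun ω => A + costTo step cost x₀ (fun i => s i ω)
      (stopTime step halt x₀ fun i => s i ω)) B := by
  have h1 := half_le_rate hn hK hε hε1
  have hm := measurable_of_isCyclicSelection hs
  obtain ⟨τ, -, -, -, hsτ⟩ := hs
  set N := ⌊2 * 10 ^ 5 * rate K ε⌋₊ + 1 with hNdef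
  have hN : 2 * 10 ^ 5 * rate K ε < N := by
    have := Nat.lt_floor_add_one (2 * 10 ^ 5 * rate K ε)
    rw [hNdef]; push_cast; exact this
  have hN' : (N : ℝ) ≤ 2 * 10 ^ 5 * rate K ε + 1 := by
    have := Nat.floor_le (by positivity : 0 ≤ 2 * 10 ^ 5 * rate K ε)
    rw [hNdef]; push_cast; linarith
  have hmeas : Measurable fun ω => A + costTo step cost x₀ (fun i => s i ω)
      (stopTime step halt x₀ fun i => s i ω) :=
    measurable_const.add (measurable_costTo_stopTime hm cost)
  refine guarantee_of_le (b := A + N * S) hmeas (fun ω => ?_) ?_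
  · have ha : ∀ c (i : Fin p), s (c * p + i) ω = τ c ω i := fun c i => hsτ c ω i
    obtain ⟨t, ht, hhalt⟩ := hR.cyclic_exists_stop hn hK hε hε1 hη0 hη h₀
      (a := fun i => s i ω) ha hN
    have hstopT : stopTime step halt x₀ (fun i => s i ω) ≤ N * p := (Nat.sInf_le hhalt).trans ht
    have hinv : ∀ t ≤ stopTime step halt x₀ (fun i => s i ω),
        Inv (path step x₀ (fun i => s i ω) t) := by
      intro t
      induction t with
      | zero => intro _; exact h₀
      | succ t ih => intro ht; exact hR.inv _ (ih (by omega)) (not_stop_of_lt_stopTime ht) _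
    have hsum : (costTo step cost x₀ (fun i => s i ω)
        (stopTime step halt x₀ fun i => s i ω) : ℝ) ≤ N * ∑ l, c l := by
      rw [← sum_range_cycles (a := fun i => s i ω) (τ := fun c => τ c ω) ha c N, costTo]
      push_cast
      refine le_trans (Finset.sum_le_sum fun t ht => ?_)
        (Finset.sum_le_sum_of_subset_of_nonneg (Finset.range_subset_range.2 hstopT)
          fun t _ _ => hc0 _)
      have ht' := Finset.mem_range.1 ht
      exact hc _ (hinv t ht'.le) (not_stop_of_lt_stopTime ht') _
    push_cast
    have : (N : ℝ) * ∑ l, c l ≤ N * S := by gcongr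
    linarith
  · nlinarith

end Rounds

end Osborne

namespace Osborne

/-! ### Reasoning about programs -/

/-- Started in `σ`, the program `P` halts after at most `T` operations in a state satisfying `Q`. -/
def Runs (b : ℕ) (P : Cmd) (σ : State) (T : ℕ) (Q : State → Prop) : Prop :=
  ∃ t σ', Exec b P σ t σ' ∧ t ≤ T ∧ Q σ'

/-- Sequential composition of a list of programs. -/
def prog : List Cmd → Cmd
  | [] => .const 8 0
  | [c] => c
  | c :: d :: cs => .seq c (prog (d :: cs))

lemma reg_setReg (σ : State) (d r : ℕ) (v : ℤ) :
    (σ.setReg d v).reg r = if r = d then v else σ.reg r := by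
  simp [State.setReg, Function.update_apply]

lemma mem_setReg (σ : State) (d : ℕ) (v : ℤ) : (σ.setReg d v).mem = σ.mem := rfl

lemma reg_setMem (σ : State) (a : ℕ) (i j v : ℤ) : (σ.setMem a i j v).reg = σ.reg := rfl

lemma mem_setMem (σ : State) (a k : ℕ) (i j i' j' v : ℤ) :
    (σ.setMem a i j v).mem k i' j' = if k = a ∧ i' = i ∧ j' = j then v else σ.mem k i' j' := rfl

lemma clamp_eq {b : ℕ} {v : ℤ} (h : |v| ≤ 2 ^ b - 1) : clamp b v = v := by
  have := abs_le.1 h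
  unfold clamp
  omega

variable {b : ℕ} {P P' : Cmd} {cs : List Cmd} {c d : Cmd} {σ : State} {T T₁ T₂ : ℕ}
  {Q R : State → Prop}

lemma Runs.mono (h : Runs b P σ T₁ Q) (hT : T₁ ≤ T) (hQ : ∀ σ', Q σ' → R σ') : Runs b P σ T R := by
  obtain ⟨t, σ', h1, h2, h3⟩ := h
  exact ⟨t, σ', h1, h2.trans hT, hQ _ h3⟩

lemma Runs.cons (h : Runs b c σ T₁ R) (h' : ∀ σ', R σ' → Runs b (prog (d :: cs)) σ' T₂ Q) :
    Runs b (prog (c :: d :: cs)) σ (T₁ + T₂) Q := by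
  obtain ⟨t, σ₁, h1, h2, h3⟩ := h
  obtain ⟨t', σ₂, h4, h5, h6⟩ := h' _ h3
  exact ⟨t + t', σ₂, .seq h1 h4, by omega, h6⟩

lemma Runs.const {r : ℕ} {v : ℤ} (hv : |v| ≤ 2 ^ b - 1) (h : Q (σ.setReg r v)) :
    Runs b (.const r v) σ 1 Q := by
  refine ⟨1, _, .const r v σ, le_rfl, ?_⟩
  rwa [clamp_eq hv]

lemma Runs.op {o : Op} {r r₁ r₂ : ℕ} (hv : |o.eval (σ.reg r₁) (σ.reg r₂)| ≤ 2 ^ b - 1)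
    (h : Q (σ.setReg r (o.eval (σ.reg r₁) (σ.reg r₂)))) : Runs b (.op o r r₁ r₂) σ 1 Q := by
  refine ⟨1, _, .op o r r₁ r₂ σ, le_rfl, ?_⟩
  rwa [clamp_eq hv]

lemma Runs.load {r a i j : ℕ} (h : Q (σ.setReg r (σ.mem a (σ.reg i) (σ.reg j)))) :
    Runs b (.load r a i j) σ 1 Q := ⟨1, _, .load r a i j σ, le_rfl, h⟩

lemma Runs.store {r a i j : ℕ} (h : Q (σ.setMem a (σ.reg i) (σ.reg j) (σ.reg r))) :
    Runs b (.store a i j r) σ 1 Q := ⟨1, _, .store a i j r σ, le_rfl, h⟩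

lemma Runs.branch {r : ℕ} (h1 : 0 < σ.reg r → Runs b P σ T Q)
    (h2 : ¬ 0 < σ.reg r → Runs b P' σ T Q) : Runs b (.branch r P P') σ (T + 1) Q := by
  by_cases h : 0 < σ.reg r
  · obtain ⟨t, σ', h3, h4, h5⟩ := h1 h
    exact ⟨t + 1, σ', .branch_pos h h3, by omega, h5⟩
  · obtain ⟨t, σ', h3, h4, h5⟩ := h2 h
    exact ⟨t + 1, σ', .branch_neg h h3, by omega, h5⟩

/-- A loop whose register counts down to zero. -/
lemma Runs.loop {r : ℕ} {I : ℕ → State → Prop} {t : ℕ → ℕ} (hr : ∀ m σ, I m σ → σ.reg r = m)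
    (N : ℕ) (hbody : ∀ m < N, ∀ σ, I (m + 1) σ → Runs b P σ (t m) (I m)) (hσ : I N σ) :
    Runs b (.loop r P) σ (∑ m ∈ Finset.range N, (t m + 1) + 1) (I 0) := by
  induction N generalizing σ with
  | zero =>
    refine ⟨1, σ, .loop_neg ?_, by simp, hσ⟩
    rw [hr 0 σ hσ]; simp
  | succ N ih =>
    obtain ⟨t₁, σ₁, h1, h2, h3⟩ := hbody N (by omega) σ hσ
    obtain ⟨t₂, σ₂, h4, h5, h6⟩ := ih (fun m hm => hbody m (by omega)) h3
    refine ⟨t₁ + t₂ + 1, σ₂, .loop_pos ?_ h1 h4, ?_, h6⟩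
    · rw [hr _ σ hσ]; positivity
    · rw [Finset.sum_range_succ]; omega

/-! ### Fixed-point addition in the logarithmic domain -/

/-- The fixed-point version of `(y, z) ↦ log (e^y + e^z)`, with scale `u`. -/
noncomputable def logAddZ (u y z : ℤ) : ℤ :=
  max y z + Op.eval .log (Op.eval .exp (min y z - max y z) u + u) u

lemma eval_exp_bounds {u a : ℤ} (hu : 1 ≤ u) (ha : a ≤ 0) :
    0 ≤ Op.eval .exp a u ∧ Op.eval .exp a u ≤ u := by
  have hu' : (0 : ℝ) < u := by exact_mod_cast hu
  have ha' : (a : ℝ) ≤ 0 := by exact_mod_cast ha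
  constructor
  · exact Int.floor_nonneg.2 (by positivity)
  · refine Int.floor_le_iff.2 ?_
    have : Real.exp ((a : ℝ) / u) ≤ 1 :=
      Real.exp_le_one_iff.2 (div_nonpos_of_nonpos_of_nonneg ha' hu'.le)
    nlinarith

lemma logAddZ_log_bounds {u a : ℤ} (hu : 1 ≤ u) (ha : a ≤ 0) :
    0 ≤ Op.eval .log (Op.eval .exp a u + u) u ∧ Op.eval .log (Op.eval .exp a u + u) u ≤ u := by
  obtain ⟨h0, h1⟩ := eval_exp_bounds hu ha
  have hu' : (0 : ℝ) < u := by exact_mod_cast hu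
  set e := Op.eval .exp a u
  have h0' : (0 : ℝ) ≤ e := by exact_mod_cast h0
  have h1' : (e : ℝ) ≤ u := by exact_mod_cast h1
  have h2 : 1 ≤ ((e + u : ℤ) : ℝ) / u := by
    rw [le_div_iff₀ hu']; push_cast; linarith
  have h3 : ((e + u : ℤ) : ℝ) / u ≤ 2 := by
    rw [div_le_iff₀ hu']; push_cast; linarith
  have h4 := Real.log_nonneg h2
  have h5 := Real.log_le_sub_one_of_pos (lt_of_lt_of_le one_pos h2)
  constructor
  · exact Int.floor_nonneg.2 (by positivity)
  · refine Int.floor_le_iff.2 ?_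
    nlinarith

/-- Each of the two roundings loses at most one unit; the one of the exponential is not amplified by the
logarithm, whose argument is at least `1`. -/
lemma logAddZ_spec {u : ℤ} (hu : 1 ≤ u) (y z : ℤ) :
    (logAddZ u y z : ℝ) ≤ u * Real.log (Real.exp ((y : ℝ) / u) + Real.exp ((z : ℝ) / u)) ∧
    u * Real.log (Real.exp ((y : ℝ) / u) + Real.exp ((z : ℝ) / u)) ≤ logAddZ u y z + 2 := by
  have hu' : (1 : ℝ) ≤ u := by exact_mod_cast hu
  have hu0 : (0 : ℝ) < u := by linarith
  unfold logAddZ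
  wlog hyz : z ≤ y generalizing y z
  · have := this z y (by omega)
    rwa [max_comm, min_comm, add_comm (Real.exp _)] at this
  rw [max_eq_left hyz, min_eq_right hyz]
  set a := z - y with ha
  have ha0 : a ≤ 0 := by omega
  have hsum : Real.exp ((y : ℝ) / u) + Real.exp ((z : ℝ) / u)
      = Real.exp ((y : ℝ) / u) * (1 + Real.exp ((a : ℝ) / u)) := by
    rw [mul_add, mul_one, ← Real.exp_add, ha]
    congr 2
    push_cast; ring
  have h1e : 0 < 1 + Real.exp ((a : ℝ) / u) := by positivity
  rw [hsum, Real.log_mul (Real.exp_pos _).ne' h1e.ne', Real.log_exp, mul_add,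
    mul_div_cancel₀ _ hu0.ne']
  push_cast
  set e := Op.eval .exp a u with he
  obtain ⟨he0, he1⟩ := eval_exp_bounds hu ha0
  have he0' : (0 : ℝ) ≤ e := by exact_mod_cast he0
  have hfl : (e : ℝ) ≤ u * Real.exp ((a : ℝ) / u) := Int.floor_le _
  have hfl' : u * Real.exp ((a : ℝ) / u) < e + 1 := Int.lt_floor_add_one _
  set g := Op.eval .log (e + u) u with hg
  have hg1 : (g : ℝ) ≤ u * Real.log (((e + u : ℤ) : ℝ) / u) := Int.floor_le _
  have hg2 : u * Real.log (((e + u : ℤ) : ℝ) / u) < g + 1 := Int.lt_floor_add_one _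
  set v : ℝ := ((e + u : ℤ) : ℝ) / u with hv
  have hv1 : 1 ≤ v := by rw [hv, le_div_iff₀ hu0]; push_cast; linarith
  have hvu : v * u = e + u := by rw [hv, div_mul_cancel₀ _ hu0.ne']; push_cast; ring
  have hle : v ≤ 1 + Real.exp ((a : ℝ) / u) := by
    refine le_of_mul_le_mul_right ?_ hu0
    rw [hvu]; linarith
  have hge : u * (1 + Real.exp ((a : ℝ) / u)) ≤ u * v + 1 := by linarith
  constructor
  · have := Real.log_le_log (by linarith) hle
    nlinarith
  · have h2 := Real.log_le_sub_one_of_pos (div_pos h1e (by linarith : 0 < v))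
    rw [Real.log_div h1e.ne' (by linarith)] at h2
    have h3 : u * ((1 + Real.exp ((a : ℝ) / u)) / v - 1) ≤ 1 := by
      rw [mul_sub, mul_one, ← mul_div_assoc, sub_le_iff_le_add, div_le_iff₀ (by linarith)]
      nlinarith
    nlinarith

/-! ### The program: logarithms of row and column sums -/

/-- Replaces an entry of the input (in register `20`) by its logarithm (in register `21`). -/
def getLog : InputFormat → Cmd
  | .plain => prog [.op .mul 21 20 7, .op .log 21 21 7]
  | .logarithmic => prog [.op .mul 21 20 7, .op .div 21 21 4]

/-- Computes the logarithm of an entry of a row, up to the factor `e^{x k}` (with `o = .sub`,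
`A = 0`), or of a column, up to the factor `e^{-x k}` (with `o = .add`, `A = 3`). -/
def fetch (f : InputFormat) (A : ℕ) (o : Op) : Cmd :=
  prog [.load 23 (A + 1) 16 22, .load 24 8 23 8, .load 20 (A + 2) 16 22, getLog f, .op o 25 21 24]

/-- Adds the numbers in registers `25` and `27` in the logarithmic domain. -/
def logAdd : Cmd :=
  prog [.op .sub 28 27 25,
    .branch 28 (.op .sub 29 25 27) (prog [.op .add 29 28 8, .op .add 27 25 8]),
    .op .exp 29 29 7, .op .add 29 29 7, .op .log 29 29 7, .op .add 27 27 29]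

/-- Computes the logarithm of a row or column sum. -/
def logSum (f : InputFormat) (A : ℕ) (o : Op) : Cmd :=
  prog [.load 22 A 16 8, .op .sub 22 22 9, fetch f A o, .op .add 27 25 8,
    .loop 22 (prog [.op .sub 22 22 9, fetch f A o, logAdd])]

/-- The logarithm of a matrix entry, up to a common constant, in terms of the input. -/
noncomputable def InputFormat.ell (f : InputFormat) (q z : ℤ) : ℝ :=
  match f with
  | .plain => Real.log z
  | .logarithmic => z / q

/-- Constraints on the parameters: the words have to hold numbers of the order of `E * H`, where
`H` bounds the fixed-point numbers that occur. -/
structure Params (b n : ℕ) (u q E H : ℤ) : Prop where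
  n_pos : 1 ≤ n
  u_pos : 1 ≤ u
  q_pos : 0 < q
  E_pos : 1 ≤ E
  size : u * n + 2 * n + 2 ≤ H
  word : 20 * (E * H) ≤ 2 ^ b - 1

/-- The constants that the program keeps in its registers. -/
structure Consts (n : ℕ) (u q E : ℤ) (σ : State) : Prop where
  r0 : σ.reg 0 = n
  r2 : σ.reg 2 = E
  r4 : σ.reg 4 = q
  r7 : σ.reg 7 = u
  r8 : σ.reg 8 = 0
  r9 : σ.reg 9 = 1
  r10 : σ.reg 10 = 2 * n

/-- An entry of the input that is small enough for the words. -/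
structure Entry (f : InputFormat) (u q H z : ℤ) : Prop where
  le : |z * u| ≤ H
  log_le : |u * f.ell q z| ≤ H

/-- The sign with which the operation adds its second argument. -/
def Op.sgn : Op → ℤ
  | .sub => -1
  | _ => 1

variable {f : InputFormat} {n : ℕ} {u q E H : ℤ} {o : Op}

lemma Op.eval_eq_sgn (ho : o = .add ∨ o = .sub) (a c : ℤ) : o.eval a c = a + o.sgn * c := by
  rcases ho with rfl | rfl
  · simp [Op.eval, Op.sgn]
  · simp [Op.eval, Op.sgn, sub_eq_add_neg]

lemma Params.H_pos (hp : Params b n u q E H) : 4 ≤ H := by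
  have := hp.size
  have := hp.n_pos
  have := hp.u_pos
  have : 1 ≤ u * n := by
    have : (1 : ℤ) ≤ n := by exact_mod_cast hp.n_pos
    nlinarith
  omega

lemma Params.le_word (hp : Params b n u q E H) : 20 * H ≤ 2 ^ b - 1 := by
  have h1 := hp.word
  have h2 := hp.E_pos
  have h3 := hp.H_pos
  nlinarith

lemma Params.u_le (hp : Params b n u q E H) : u ≤ H := by
  have := hp.size
  have h1 : (1 : ℤ) ≤ n := by exact_mod_cast hp.n_pos
  have := hp.u_pos
  nlinarith

lemma Params.n_le (hp : Params b n u q E H) : 2 * (n : ℤ) ≤ H := by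
  have := hp.size
  have h1 : (1 : ℤ) ≤ n := by exact_mod_cast hp.n_pos
  have := hp.u_pos
  nlinarith

lemma Consts.of_agree {σ' : State} (h : Consts n u q E σ) (h' : ∀ r < 11, σ'.reg r = σ.reg r) :
    Consts n u q E σ' := by
  constructor <;> rw [h' _ (by norm_num)]
  exacts [h.r0, h.r2, h.r4, h.r7, h.r8, h.r9, h.r10]

lemma floor_eq_div (hq : 0 < q) (z u : ℤ) : ⌊(u : ℝ) * ((z : ℝ) / q)⌋ = z * u / q := by
  rw [Int.floor_eq_iff]
  have hq' : (0 : ℝ) < q := by exact_mod_cast hq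
  have h1 := Int.mul_ediv_add_emod (z * u) q
  have h2 := Int.emod_nonneg (z * u) hq.ne'
  have h3 := Int.emod_lt_of_pos (z * u) hq
  have h1' : (q : ℝ) * ((z * u / q : ℤ) : ℝ) + ((z * u % q : ℤ) : ℝ) = z * u := by
    exact_mod_cast h1
  have h2' : (0 : ℝ) ≤ ((z * u % q : ℤ) : ℝ) := by exact_mod_cast h2
  have h3' : ((z * u % q : ℤ) : ℝ) < q := by exact_mod_cast h3
  constructor
  · rw [← mul_div_assoc, le_div_iff₀ hq']; linarith
  · rw [← mul_div_assoc, div_lt_iff₀ hq']; linarith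

lemma abs_floor_le {r : ℝ} {H : ℤ} (h : |r| ≤ H) : |⌊r⌋| ≤ H + 1 := by
  have h1 := abs_le.1 h
  rw [abs_le]
  constructor
  · have : -H ≤ ⌊r⌋ := Int.le_floor.2 (by push_cast; linarith)
    omega
  · have : ⌊r⌋ ≤ H := by
      have : (⌊r⌋ : ℝ) ≤ H := (Int.floor_le r).trans h1.2
      exact_mod_cast this
    omega

lemma getLog_spec (hp : Params b n u q E H) (hc : Consts n u q E σ)
    (hz : Entry f u q H (σ.reg 20)) :
    Runs b (getLog f) σ 2 fun σ' => σ'.reg 21 = ⌊u * f.ell q (σ.reg 20)⌋ ∧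
      (∀ r ≠ 21, σ'.reg r = σ.reg r) ∧ σ'.mem = σ.mem := by
  have hH := hp.H_pos
  have hW := hp.le_word
  have hmul : |Op.mul.eval (σ.reg 20) (σ.reg 7)| ≤ 2 ^ b - 1 := by
    rw [hc.r7]
    exact hz.le.trans (by omega)
  have hlog := abs_floor_le hz.log_le
  cases f
  · refine Runs.cons (Runs.op (Q := fun σ' => σ' = σ.setReg 21 (σ.reg 20 * u)) hmul
      (by rw [hc.r7]; rfl)) (T₂ := 1) ?_
    rintro σ' rfl
    have e : Op.eval .log ((σ.setReg 21 (σ.reg 20 * u)).reg 21)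
        ((σ.setReg 21 (σ.reg 20 * u)).reg 7) = ⌊u * InputFormat.plain.ell q (σ.reg 20)⌋ := by
      have hu : (u : ℝ) ≠ 0 := by exact_mod_cast (by have := hp.u_pos; omega : u ≠ 0)
      simp [reg_setReg, hc.r7, Op.eval, InputFormat.ell, hu]
    refine Runs.op (by rw [e]; omega) ?_
    rw [e]
    refine ⟨by simp [reg_setReg], fun r hr => by simp [reg_setReg, hr], rfl⟩
  · refine Runs.cons (Runs.op (Q := fun σ' => σ' = σ.setReg 21 (σ.reg 20 * u)) hmul
      (by rw [hc.r7]; rfl)) (T₂ := 1) ?_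
    rintro σ' rfl
    have e : Op.eval .div ((σ.setReg 21 (σ.reg 20 * u)).reg 21)
        ((σ.setReg 21 (σ.reg 20 * u)).reg 4) = ⌊u * InputFormat.logarithmic.ell q (σ.reg 20)⌋ := by
      simp only [InputFormat.ell]
      rw [floor_eq_div hp.q_pos]
      simp [reg_setReg, hc.r4, Op.eval]
    refine Runs.op (by rw [e]; omega) ?_
    rw [e]
    refine ⟨by simp [reg_setReg], fun r hr => by simp [reg_setReg, hr], rfl⟩

/-- Row `k` of the arrays `A`, `A + 1`, `A + 2` holds the length of the list `l`, its elements, and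
their images under `z`. -/
structure ListAt {n : ℕ} (σ : State) (A k : ℕ) (l : List (Fin n)) (z : Fin n → ℤ) : Prop where
  length : σ.mem A k 0 = l.length
  index : ∀ j (h : j < l.length), σ.mem (A + 1) k j = ((l[j] : Fin n) : ℕ)
  value : ∀ j (h : j < l.length), σ.mem (A + 2) k j = z l[j]

variable {A k : ℕ} {l : List (Fin n)} {z X : Fin n → ℤ}

lemma fetch_spec (hp : Params b n u q E H) (hc : Consts n u q E σ) (ho : o = .add ∨ o = .sub)
    (hk : σ.reg 16 = k) (hl : ListAt σ A k l z) (hX : ∀ i : Fin n, σ.mem 8 (i : ℕ) 0 = X i)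
    {j : ℕ} (hj : j < l.length) (hreg : σ.reg 22 = j) (hz : Entry f u q H (z l[j]))
    (hb : |u * f.ell q (z l[j]) + o.sgn * X l[j]| ≤ H) :
    Runs b (fetch f A o) σ 6 fun σ' =>
      σ'.reg 25 = ⌊u * f.ell q (z l[j])⌋ + o.sgn * X l[j] ∧
      (∀ r, r < 20 ∨ r = 22 ∨ r = 27 → σ'.reg r = σ.reg r) ∧ σ'.mem = σ.mem := by
  have hW := hp.le_word
  have hH := hp.H_pos
  refine Runs.cons (T₂ := 5) (Runs.load (Q := fun σ' => σ' = σ.setReg 23 ((l[j] : Fin n) : ℕ)) ?_) ?_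
  · rw [hk, hreg, hl.index j hj]
  rintro _ rfl
  refine Runs.cons (T₂ := 4) (Runs.load (Q := fun σ' =>
    σ' = (σ.setReg 23 ((l[j] : Fin n) : ℕ)).setReg 24 (X l[j])) ?_) ?_
  · simp [reg_setReg, mem_setReg, hc.r8, hX]
  rintro _ rfl
  refine Runs.cons (T₂ := 3) (Runs.load (Q := fun σ' =>
    σ' = ((σ.setReg 23 ((l[j] : Fin n) : ℕ)).setReg 24 (X l[j])).setReg 20 (z l[j])) ?_) ?_
  · simp [reg_setReg, mem_setReg, hk, hreg, hl.value j hj]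
  rintro _ rfl
  set σ₁ := ((σ.setReg 23 ((l[j] : Fin n) : ℕ)).setReg 24 (X l[j])).setReg 20 (z l[j]) with hσ₁
  have hr20 : σ₁.reg 20 = z l[j] := by simp [hσ₁, reg_setReg]
  have hr24 : σ₁.reg 24 = X l[j] := by simp [hσ₁, reg_setReg]
  have hother : ∀ r, r < 20 ∨ r = 22 ∨ r = 27 → σ₁.reg r = σ.reg r := by
    intro r hr
    simp only [hσ₁, reg_setReg]
    rw [if_neg (by omega), if_neg (by omega), if_neg (by omega)]
  have hc₁ : Consts n u q E σ₁ := hc.of_agree fun r hr => hother r (by omega)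
  refine Runs.cons (T₂ := 1) (getLog_spec hp hc₁ (hr20.symm ▸ hz)) ?_
  rintro σ₂ ⟨h21, hsame, hmem⟩
  have e : o.eval (σ₂.reg 21) (σ₂.reg 24) = ⌊u * f.ell q (z l[j])⌋ + o.sgn * X l[j] := by
    rw [Op.eval_eq_sgn ho, h21, hsame 24 (by norm_num), hr24, hr20]
  have hfl : ⌊u * f.ell q (z l[j])⌋ + o.sgn * X l[j]
      = ⌊u * f.ell q (z l[j]) + ((o.sgn * X l[j] : ℤ) : ℝ)⌋ := by
    rw [Int.floor_add_intCast]
  refine Runs.op ?_ ?_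
  · rw [e, hfl]
    have := abs_floor_le (r := u * f.ell q (z l[j]) + ((o.sgn * X l[j] : ℤ) : ℝ)) (H := H)
      (by push_cast; exact hb)
    omega
  · rw [e]
    refine ⟨by simp [reg_setReg], fun r hr => ?_, hmem⟩
    rw [reg_setReg, if_neg (by omega), hsame r (by omega), hother r hr]

lemma logAdd_spec (hp : Params b n u q E H) (hc : Consts n u q E σ)
    (h25 : |σ.reg 25| ≤ 3 * H) (h27 : |σ.reg 27| ≤ 3 * H) :
    Runs b logAdd σ 8 fun σ' => σ'.reg 27 = logAddZ u (σ.reg 27) (σ.reg 25) ∧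
      (∀ r < 27, σ'.reg r = σ.reg r) ∧ σ'.mem = σ.mem := by
  have hW := hp.le_word
  have hu := hp.u_pos
  have huH := hp.u_le
  have a25 := abs_le.1 h25
  have a27 := abs_le.1 h27
  refine Runs.cons (T₂ := 7) (Runs.op (Q := fun σ' => σ' = σ.setReg 28 (σ.reg 27 - σ.reg 25)) ?_
    rfl) ?_
  · simp only [Op.eval]; rw [abs_le]; constructor <;> omega
  rintro _ rfl
  refine Runs.cons (T₁ := 3) (T₂ := 4) (R := fun σ' =>
    σ'.reg 29 = min (σ.reg 27) (σ.reg 25) - max (σ.reg 27) (σ.reg 25) ∧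
    σ'.reg 27 = max (σ.reg 27) (σ.reg 25) ∧ (∀ r < 27, σ'.reg r = σ.reg r) ∧ σ'.mem = σ.mem)
    (Runs.branch (fun hlt => ?_) fun hlt => ?_) ?_
  · simp only [reg_setReg, if_true] at hlt
    refine (Runs.op (Q := _) ?_ ?_).mono (T₁ := 1) (by norm_num) (fun _ h => h)
    · simp [reg_setReg, Op.eval]; rw [abs_lt]; constructor <;> omega
    · refine ⟨?_, ?_, fun r hr => ?_, rfl⟩
      · simp [reg_setReg, Op.eval]; omega
      · simp [reg_setReg]; omega
      · simp only [reg_setReg]; rw [if_neg (by omega), if_neg (by omega)]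
  · simp only [reg_setReg, if_true] at hlt
    refine Runs.cons (T₁ := 1) (T₂ := 1) (Runs.op (Q := fun σ' => σ' = (σ.setReg 28
      (σ.reg 27 - σ.reg 25)).setReg 29 (σ.reg 27 - σ.reg 25)) ?_ ?_) ?_
    · simp [reg_setReg, Op.eval, hc.r8]; rw [abs_lt]; constructor <;> omega
    · simp [reg_setReg, Op.eval, hc.r8]
    rintro _ rfl
    refine Runs.op ?_ ?_
    · simp [reg_setReg, Op.eval, hc.r8]; rw [abs_lt]; constructor <;> omega
    · refine ⟨?_, ?_, fun r hr => ?_, rfl⟩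
      · simp [reg_setReg]; omega
      · simp [reg_setReg, Op.eval, hc.r8]; omega
      · simp only [reg_setReg]; rw [if_neg (by omega), if_neg (by omega), if_neg (by omega)]
  rintro σ₁ ⟨h1, h2, h3, h4⟩
  have h7 : σ₁.reg 7 = u := by rw [h3 7 (by norm_num), hc.r7]
  set m := min (σ.reg 27) (σ.reg 25) - max (σ.reg 27) (σ.reg 25) with hm
  have hm0 : m ≤ 0 := by omega
  obtain ⟨he0, he1⟩ := eval_exp_bounds hu hm0
  obtain ⟨hg0, hg1⟩ := logAddZ_log_bounds hu hm0
  refine Runs.cons (T₁ := 1) (T₂ := 3) (Runs.op (Q := fun σ' => σ' = σ₁.setReg 29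
      (Op.eval .exp m u)) ?_ ?_) ?_
  · rw [h1, h7, abs_le]; constructor <;> omega
  · rw [h1, h7]
  rintro _ rfl
  refine Runs.cons (T₁ := 1) (T₂ := 2) (Runs.op (Q := fun σ' => σ' = (σ₁.setReg 29
      (Op.eval .exp m u)).setReg 29 (Op.eval .exp m u + u)) ?_ ?_) ?_
  · simp only [reg_setReg, h7, if_true, if_neg (by norm_num : ¬ (7 = 29))]
    change |Op.eval .exp m u + u| ≤ _
    rw [abs_le]; constructor <;> omega
  · simp only [reg_setReg, h7, if_true, if_neg (by norm_num : ¬ (7 = 29))]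
    rfl
  rintro _ rfl
  refine Runs.cons (T₁ := 1) (T₂ := 1) (Runs.op (Q := fun σ' => σ' = ((σ₁.setReg 29
      (Op.eval .exp m u)).setReg 29 (Op.eval .exp m u + u)).setReg 29
        (Op.eval .log (Op.eval .exp m u + u) u)) ?_ ?_) ?_
  · simp only [reg_setReg, h7, if_true, if_neg (by norm_num : ¬ (7 = 29))]
    rw [abs_le]; constructor <;> omega
  · simp only [reg_setReg, h7, if_true, if_neg (by norm_num : ¬ (7 = 29))]
  rintro _ rfl
  refine Runs.op ?_ ?_
  · simp only [reg_setReg, h2, if_true, if_neg (by norm_num : ¬ (27 = 29))]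
    change |_ + Op.eval .log (Op.eval .exp m u + u) u| ≤ _
    rw [abs_le]; constructor <;> omega
  · refine ⟨?_, fun r hr => ?_, h4⟩
    · simp only [reg_setReg, h2, if_true, if_neg (by norm_num : ¬ (27 = 29))]
      rfl
    · simp only [reg_setReg]
      rw [if_neg (by omega), if_neg (by omega), if_neg (by omega), if_neg (by omega), h3 r hr]

/-- The real number whose logarithm `logSum` computes. -/
noncomputable def expSum (f : InputFormat) (u q sg : ℤ) (z X : Fin n → ℤ) (l : List (Fin n)) : ℝ :=
  (l.map fun i => Real.exp (f.ell q (z i) + sg * X i / u)).sum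

/-- The integer `y` is a fixed-point approximation from below to `log S`, with error `2 m`. -/
def ApproxLog (u : ℤ) (y : ℤ) (S : ℝ) (m : ℕ) : Prop :=
  (y : ℝ) ≤ u * Real.log S ∧ u * Real.log S ≤ y + 2 * m

lemma ApproxLog.logAddZ {u y a : ℤ} (hu : 1 ≤ u) {S t : ℝ} {m : ℕ} (hm : 1 ≤ m) (hS : 0 < S)
    (h : ApproxLog u y S m) (ha : (a : ℝ) ≤ u * t) (ha' : u * t ≤ a + 1) :
    ApproxLog u (logAddZ u y a) (Real.exp t + S) (m + 1) := by
  obtain ⟨h1, h2⟩ := h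
  obtain ⟨h3, h4⟩ := logAddZ_spec hu y a
  have hu0 : (0 : ℝ) < u := by exact_mod_cast hu
  have hm' : (1 : ℝ) ≤ m := by exact_mod_cast hm
  have e1 : Real.exp ((y : ℝ) / u) ≤ S := by
    rw [← Real.le_log_iff_exp_le hS, div_le_iff₀ hu0]; linarith
  have e2 : S ≤ Real.exp ((y : ℝ) / u) * Real.exp (2 * m / u) := by
    rw [← Real.exp_add, ← Real.log_le_iff_le_exp hS, ← add_div, le_div_iff₀ hu0]; linarith
  have e3 : Real.exp ((a : ℝ) / u) ≤ Real.exp t := by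
    apply Real.exp_le_exp.2; rw [div_le_iff₀ hu0]; linarith
  have e4 : Real.exp t ≤ Real.exp ((a : ℝ) / u) * Real.exp (2 * m / u) := by
    rw [← Real.exp_add, ← add_div]
    apply Real.exp_le_exp.2
    rw [le_div_iff₀ hu0]; linarith
  have p1 : 0 < Real.exp ((y : ℝ) / u) + Real.exp ((a : ℝ) / u) := by positivity
  constructor
  · exact h3.trans (mul_le_mul_of_nonneg_left (Real.log_le_log p1 (by linarith)) hu0.le)
  · have e5 : Real.exp t + S
        ≤ (Real.exp ((y : ℝ) / u) + Real.exp ((a : ℝ) / u)) * Real.exp (2 * m / u) := by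
      linarith
    have e6 := Real.log_le_log (by positivity) e5
    rw [Real.log_mul p1.ne' (Real.exp_pos _).ne', Real.log_exp] at e6
    have e7 := mul_le_mul_of_nonneg_left e6 hu0.le
    rw [mul_add, mul_div_cancel₀ _ hu0.ne'] at e7
    push_cast
    linarith

lemma expSum_pos {sg : ℤ} (hl : l ≠ []) : 0 < expSum f u q sg z X l := by
  unfold expSum
  apply List.sum_pos
  · intro y hy
    obtain ⟨i, -, rfl⟩ := List.mem_map.1 hy
    exact Real.exp_pos _
  · simpa using hl

/-- Bounds on the logarithm of the sum in terms of bounds on its terms. -/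
lemma log_expSum_bounds (hu : 1 ≤ u) {sg : ℤ} (hl : l ≠ []) (hlen : l.length ≤ n)
    (hb : ∀ i ∈ l, |u * f.ell q (z i) + sg * X i| ≤ H) :
    -(H : ℝ) ≤ u * Real.log (expSum f u q sg z X l) ∧
      u * Real.log (expSum f u q sg z X l) ≤ H + u * n := by
  have hu0 : (0 : ℝ) < u := by exact_mod_cast hu
  have hpos := expSum_pos (f := f) (u := u) (q := q) (sg := sg) (z := z) (X := X) hl
  have hterm : ∀ i ∈ l, Real.exp (-(H / u : ℝ)) ≤ Real.exp (f.ell q (z i) + sg * X i / u) ∧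
      Real.exp (f.ell q (z i) + sg * X i / u) ≤ Real.exp (H / u : ℝ) := by
    intro i hi
    have h1 := abs_le.1 (hb i hi)
    have e : f.ell q (z i) + sg * X i / u = (u * f.ell q (z i) + sg * X i) / u := by
      field_simp
    rw [e]
    constructor
    · apply Real.exp_le_exp.2
      rw [← neg_div]
      exact div_le_div_of_nonneg_right h1.1 hu0.le
    · apply Real.exp_le_exp.2
      exact div_le_div_of_nonneg_right h1.2 hu0.le
  constructor
  · obtain ⟨i, hi⟩ := List.exists_mem_of_ne_nil l hl
    have h1 : Real.exp (-(H / u : ℝ)) ≤ expSum f u q sg z X l := by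
      refine (hterm i hi).1.trans ?_
      exact List.single_le_sum (l := l.map fun i => Real.exp (f.ell q (z i) + sg * X i / u))
        (by intro y hy; obtain ⟨i, -, rfl⟩ := List.mem_map.1 hy; exact (Real.exp_pos _).le) _
        (List.mem_map.2 ⟨i, hi, rfl⟩)
    rw [← Real.le_log_iff_exp_le hpos] at h1
    have := mul_le_mul_of_nonneg_left h1 hu0.le
    rwa [mul_neg, mul_div_cancel₀ _ hu0.ne'] at this
  · have h1 : expSum f u q sg z X l ≤ Real.exp (H / u + n : ℝ) := by
      calc expSum f u q sg z X l ≤ l.length • Real.exp (H / u : ℝ) := by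
            unfold expSum
            refine (List.sum_le_card_nsmul _ (Real.exp (H / u : ℝ)) ?_).trans (by simp)
            intro y hy
            obtain ⟨i, hi, rfl⟩ := List.mem_map.1 hy
            exact (hterm i hi).2
        _ ≤ n * Real.exp (H / u : ℝ) := by
            rw [nsmul_eq_mul]; gcongr
        _ ≤ Real.exp n * Real.exp (H / u : ℝ) := by
            gcongr
            have := Real.add_one_le_exp (n : ℝ)
            linarith
        _ = _ := by rw [← Real.exp_add, add_comm]
    rw [← Real.log_le_iff_le_exp hpos] at h1
    have := mul_le_mul_of_nonneg_left h1 hu0.le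
    rwa [mul_add, mul_div_cancel₀ _ hu0.ne'] at this

lemma ApproxLog.abs_le (hp : Params b n u q E H) {y : ℤ} {sg : ℤ} {m : ℕ} (hm : m ≤ n)
    (hl : l ≠ []) (hlen : l.length ≤ n) (hb : ∀ i ∈ l, |u * f.ell q (z i) + sg * X i| ≤ H)
    (h : ApproxLog u y (expSum f u q sg z X l) m) : |y| ≤ 2 * H := by
  obtain ⟨h1, h2⟩ := log_expSum_bounds hp.u_pos hl hlen hb
  obtain ⟨h3, h4⟩ := h
  have hs : ((u * n + 2 * n + 2 : ℤ) : ℝ) ≤ H := by exact_mod_cast hp.size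
  have hm' : (m : ℝ) ≤ n := by exact_mod_cast hm
  push_cast at hs
  have hn : (0 : ℝ) ≤ n := Nat.cast_nonneg n
  have hun : (0 : ℝ) ≤ u * n := mul_nonneg (by exact_mod_cast (by have := hp.u_pos; omega : 0 ≤ u)) hn
  have : |(y : ℝ)| ≤ 2 * H := by rw [_root_.abs_le]; constructor <;> linarith
  exact_mod_cast this

/-- The logarithm of a sum of `l.length` exponentials is computed with `20` operations for each term, with error
at most `2 n` units. -/
lemma logSum_spec (hp : Params b n u q E H) (hc : Consts n u q E σ) (ho : o = .add ∨ o = .sub)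
    (hk : σ.reg 16 = k) (hl : ListAt σ A k l z) (hX : ∀ i : Fin n, σ.mem 8 (i : ℕ) 0 = X i)
    (hne : l ≠ []) (hlen : l.length ≤ n) (hz : ∀ i ∈ l, Entry f u q H (z i))
    (hb : ∀ i ∈ l, |u * f.ell q (z i) + o.sgn * X i| ≤ H) :
    Runs b (logSum f A o) σ (20 * l.length) fun σ' =>
      ApproxLog u (σ'.reg 27) (expSum f u q o.sgn z X l) n ∧ |σ'.reg 27| ≤ 2 * H ∧
      (∀ r < 20, σ'.reg r = σ.reg r) ∧ σ'.mem = σ.mem := by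
  have hW := hp.le_word
  have hH := hp.H_pos
  have hu := hp.u_pos
  have hu0 : (0 : ℝ) < u := by exact_mod_cast hu
  have hnH := hp.n_le
  have hlpos : 0 < l.length := List.length_pos_of_ne_nil hne
  obtain ⟨m, hm⟩ : ∃ m, l.length = m + 1 := ⟨l.length - 1, by omega⟩
  -- the value computed by `fetch`
  have hval : ∀ i ∈ l, ((⌊u * f.ell q (z i)⌋ + o.sgn * X i : ℤ) : ℝ)
        ≤ u * (f.ell q (z i) + o.sgn * X i / u) ∧
      u * (f.ell q (z i) + o.sgn * X i / u)
        ≤ ((⌊u * f.ell q (z i)⌋ + o.sgn * X i : ℤ) : ℝ) + 1 ∧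
      |⌊u * f.ell q (z i)⌋ + o.sgn * X i| ≤ H + 1 := by
    intro i hi
    have e : u * (f.ell q (z i) + o.sgn * X i / u) = u * f.ell q (z i) + o.sgn * X i := by
      field_simp
    have h1 := Int.floor_le (u * f.ell q (z i))
    have h2 := (Int.lt_floor_add_one (u * f.ell q (z i))).le
    refine ⟨by rw [e]; push_cast; linarith, by rw [e]; push_cast; linarith, ?_⟩
    have hfl : ⌊u * f.ell q (z i)⌋ + o.sgn * X i
        = ⌊u * f.ell q (z i) + ((o.sgn * X i : ℤ) : ℝ)⌋ := by
      rw [Int.floor_add_intCast]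
    rw [hfl]
    exact abs_floor_le (by push_cast; exact hb i hi)
  have hdrop : ∀ c, (h : c < l.length) → l.drop c = l[c] :: l.drop (c + 1) := fun c h =>
    List.drop_eq_getElem_cons h
  let I : ℕ → State → Prop := fun c τ => τ.reg 22 = c ∧ c < l.length ∧
    ApproxLog u (τ.reg 27) (expSum f u q o.sgn z X (l.drop c)) (l.length - c) ∧
    (∀ r < 20, τ.reg r = σ.reg r) ∧ τ.mem = σ.mem
  have hdne : ∀ c < l.length, l.drop c ≠ [] := by
    intro c hc h
    have := congrArg List.length h
    simp at this
    omega
  have hIabs : ∀ c τ, I c τ → |τ.reg 27| ≤ 2 * H := fun c τ h =>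
    h.2.2.1.abs_le hp (by omega) (hdne c h.2.1) (by simp; omega)
      fun i hi => hb i (List.mem_of_mem_drop hi)
  have hfetch : ∀ τ : State, (∀ r < 20, τ.reg r = σ.reg r) → τ.mem = σ.mem → ∀ c (h : c < l.length),
      τ.reg 22 = c → Runs b (fetch f A o) τ 6 fun σ' =>
      σ'.reg 25 = ⌊u * f.ell q (z l[c])⌋ + o.sgn * X l[c] ∧
      (∀ r, r < 20 ∨ r = 22 ∨ r = 27 → σ'.reg r = τ.reg r) ∧ σ'.mem = τ.mem := by
    intro τ hτ hmem c hc' h22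
    refine fetch_spec hp (hc.of_agree fun r hr => hτ r (by omega)) ho
      (by rw [hτ 16 (by norm_num), hk]) ?_ (by rw [hmem]; exact hX) hc' h22
      (hz _ (List.getElem_mem hc')) (hb _ (List.getElem_mem hc'))
    constructor
    · rw [hmem]; exact hl.length
    · rw [hmem]; exact hl.index
    · rw [hmem]; exact hl.value
  refine Runs.mono (T₁ := 1 + (1 + (6 + (1 + (∑ _c ∈ Finset.range m, (15 + 1) + 1))))) ?_
    (by simp; omega) (fun _ h => h)
  refine Runs.cons (Runs.load (Q := fun σ' => σ' = σ.setReg 22 l.length) ?_) ?_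
  · rw [hk, hc.r8, hl.length]
  rintro _ rfl
  refine Runs.cons (Runs.op (Q := fun σ' => σ' = (σ.setReg 22 l.length).setReg 22 m) ?_ ?_) ?_
  · simp [reg_setReg, hc.r9, Op.eval, hm]; omega
  · simp [reg_setReg, hc.r9, Op.eval, hm]
  rintro _ rfl
  have hml : m < l.length := by omega
  refine Runs.cons (hfetch ((σ.setReg 22 l.length).setReg 22 m) (fun r hr => ?_) rfl m hml (by simp [reg_setReg])) ?_
  · simp only [reg_setReg]; rw [if_neg (by omega), if_neg (by omega)]
  rintro σ₁ ⟨h25, hsame, hmem⟩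
  have hs20 : ∀ r < 20, σ₁.reg r = σ.reg r := by
    intro r hr
    rw [hsame r (by omega)]
    simp only [reg_setReg]; rw [if_neg (by omega), if_neg (by omega)]
  have h22 : σ₁.reg 22 = m := by rw [hsame 22 (by omega)]; simp [reg_setReg]
  have hv := hval l[m] (List.getElem_mem hml)
  have h8 : σ₁.reg 8 = 0 := by rw [hs20 8 (by norm_num), hc.r8]
  refine Runs.cons (Runs.op (Q := I m) ?_ ?_) ?_
  · simp only [h8, Op.eval, add_zero, h25]; omega
  · simp only [h8, Op.eval, add_zero, h25]
    refine ⟨by simp [reg_setReg, h22], hml, ?_, fun r hr => ?_, hmem⟩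
    · have e : expSum f u q o.sgn z X (l.drop m)
          = Real.exp (f.ell q (z l[m]) + o.sgn * X l[m] / u) := by
        rw [hdrop m hml, List.drop_of_length_le (by omega)]
        simp [expSum]
      rw [e, hm]
      simp only [reg_setReg, if_true, ApproxLog, Real.log_exp]
      refine ⟨hv.1, hv.2.1.trans ?_⟩
      simp
    · rw [reg_setReg, if_neg (by omega), hs20 r hr]
  intro σ₂ hI
  refine (Runs.loop (t := fun _ => 15) (I := I) (fun c τ h => h.1) m (fun c hcm τ hτ => ?_)
    hI).mono le_rfl ?_
  · obtain ⟨i1, i2, i3, i4, i5⟩ := hτ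
    have hcl : c < l.length := by omega
    have habs := hIabs _ _ ⟨i1, i2, i3, i4, i5⟩
    refine Runs.cons (T₁ := 1) (T₂ := 14) (Runs.op (Q := fun σ' => σ' = τ.setReg 22 c) ?_ ?_) ?_
    · simp [i4 9 (by norm_num), hc.r9, Op.eval, i1]; omega
    · simp [i4 9 (by norm_num), hc.r9, Op.eval, i1]
    rintro _ rfl
    refine Runs.cons (T₁ := 6) (T₂ := 8) (hfetch (τ.setReg 22 c) (fun r hr => ?_) (by rw [mem_setReg, i5]) c hcl
      (by simp [reg_setReg])) ?_
    · rw [reg_setReg, if_neg (by omega), i4 r hr]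
    rintro τ₁ ⟨j25, jsame, jmem⟩
    have hvc := hval l[c] (List.getElem_mem hcl)
    have j27 : τ₁.reg 27 = τ.reg 27 := by rw [jsame 27 (by omega)]; simp [reg_setReg]
    have j20 : ∀ r < 20, τ₁.reg r = σ.reg r := by
      intro r hr
      rw [jsame r (by omega), reg_setReg, if_neg (by omega), i4 r hr]
    refine (logAdd_spec hp (hc.of_agree fun r hr => j20 r (by omega)) (by rw [j25]; omega)
      (by rw [j27]; omega)).mono le_rfl ?_
    rintro τ₂ ⟨k27, ksame, kmem⟩
    refine ⟨?_, hcl, ?_, fun r hr => ?_, ?_⟩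
    · rw [ksame 22 (by norm_num), jsame 22 (by omega)]; simp [reg_setReg]
    · have e : expSum f u q o.sgn z X (l.drop c)
          = Real.exp (f.ell q (z l[c]) + o.sgn * X l[c] / u)
            + expSum f u q o.sgn z X (l.drop (c + 1)) := by
        rw [hdrop c hcl, expSum, expSum, List.map_cons, List.sum_cons]
      rw [e, k27, j27, j25, show l.length - c = l.length - (c + 1) + 1 by omega]
      exact i3.logAddZ hu (by omega) (expSum_pos (hdne _ i2)) hvc.1 hvc.2.1
    · rw [ksame r (by omega), j20 r hr]
    · rw [kmem, jmem, mem_setReg, i5]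
  · rintro τ ⟨i1, i2, i3, i4, i5⟩
    have habs := hIabs _ _ ⟨i1, i2, i3, i4, i5⟩
    refine ⟨⟨i3.1, i3.2.trans ?_⟩, habs, i4, i5⟩
    have : ((l.length - 0 : ℕ) : ℝ) ≤ n := by exact_mod_cast hlen
    linarith

end Osborne

namespace Osborne

/-! ### The program: updates and the stopping test -/

/-- Computes the logarithm of a row sum (`A = 0`, `o = .sub`, `o' = .add`) or of a column sum
(`A = 3`, `o = .add`, `o' = .sub`) of the scaled matrix, up to a common constant. -/
def logLine (f : InputFormat) (A : ℕ) (o o' : Op) : Cmd :=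
  prog [logSum f A o, .load 18 8 16 8, .op o' 27 27 18]

/-- Moves the coordinate in register `16` towards its Osborne update, stopping short by the
accuracy of the computed logarithms. -/
def updateCoord (f : InputFormat) : Cmd :=
  prog [logLine f 3 .add .sub, .op .add 17 27 8, logLine f 0 .sub .add, .op .sub 17 17 27,
    .op .sub 19 17 10,
    .branch 19 (prog [.const 17 2, .op .div 19 19 17, .op .add 18 18 19])
      (prog [.op .add 19 17 10, .op .sub 19 8 19,
        .branch 19 (prog [.const 17 2, .op .div 19 19 17, .op .sub 18 18 19]) (.const 17 0)]),
    .store 8 16 8 18]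

/-- Computes the largest logarithm of a row sum. -/
def maxRow (f : InputFormat) : Cmd :=
  prog [.const 16 0, logLine f 0 .sub .add, .op .add 13 27 8, .op .add 12 0 8,
    .loop 12 (prog [.op .sub 12 12 9, .op .add 16 12 8, logLine f 0 .sub .add,
      .op .sub 28 27 13, .branch 28 (.op .add 13 27 8) (.const 28 0)])]

/-- Adds up the row sums, and the distances between the row and column sums. -/
def sumLines (f : InputFormat) : Cmd :=
  prog [.const 14 0, .const 15 0, .op .add 12 0 8,
    .loop 12 (prog [.op .sub 12 12 9, .op .add 16 12 8,
      logLine f 0 .sub .add, .op .sub 27 27 13, .op .exp 17 27 7, .op .add 14 14 17,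
      logLine f 3 .add .sub, .op .sub 27 27 13, .op .exp 19 27 7,
      .op .sub 17 17 19, .branch 17 (.op .add 15 15 17) (.op .sub 15 15 17)])]

/-- The stopping test. -/
def check (f : InputFormat) : Cmd :=
  prog [maxRow f, sumLines f, .op .mul 15 15 2, .op .add 15 15 15, .op .sub 14 14 15,
    .op .add 14 14 9, .branch 14 (.const 6 1) (.const 28 0)]

variable {f : InputFormat} {b n p : ℕ} {u q E H : ℤ} {σ : State} {K : Matrix (Fin n) (Fin n) ℝ}
  {z : Matrix (Fin n) (Fin n) ℤ} {X : Fin n → ℤ} {k : Fin n} {color : Fin n → Fin p} {c : ℝ}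

/-- The fixed-point vector with scale `u`. -/
noncomputable def fixedPoint (u : ℤ) (X : Fin n → ℤ) : Fin n → ℝ := fun i => X i / u

/-- The input describes `K`, up to the factor `e^c`, in numbers small enough for the words. -/
structure Setup (f : InputFormat) (b : ℕ) (K : Matrix (Fin n) (Fin n) ℝ)
    (z : Matrix (Fin n) (Fin n) ℤ) (u q E H : ℤ) (c : ℝ) : Prop where
  params : Params b n u q E H
  nonneg : ∀ i j, 0 ≤ K i j
  pos : PosSums K
  log_eq : ∀ i j, 0 < K i j → Real.log (K i j) = c + f.ell q (z i j)
  entry : ∀ i j, 0 < K i j → Entry f u q H (z i j)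
  small : ∀ i j, 0 < K i j → 2 * |u * f.ell q (z i j)| ≤ H

/-- The arrays of the memory that describe the input. -/
structure InputAt (K : Matrix (Fin n) (Fin n) ℝ) (z : Matrix (Fin n) (Fin n) ℤ)
    (color : Fin n → Fin p) (σ : State) : Prop where
  row : ∀ k : Fin n, ListAt σ 0 k (rowSupp K k) fun j => z k j
  col : ∀ k : Fin n, ListAt σ 3 k (colSupp K k) fun i => z i k
  size : ∀ l : Fin p, σ.mem 6 (l : ℕ) 0 = (block color l).length
  elem : ∀ (l : Fin p) j (h : j < (block color l).length),
    σ.mem 7 (l : ℕ) j = ((block color l)[j] : ℕ)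

lemma InputAt.of_agree {σ' : State} (h : InputAt K z color σ) (h' : ∀ a < 8, σ'.mem a = σ.mem a) :
    InputAt K z color σ' := by
  constructor
  · intro k
    constructor
    · rw [h' _ (by norm_num)]; exact (h.row k).length
    · rw [h' _ (by norm_num)]; exact (h.row k).index
    · rw [h' _ (by norm_num)]; exact (h.row k).value
  · intro k
    constructor
    · rw [h' _ (by norm_num)]; exact (h.col k).length
    · rw [h' _ (by norm_num)]; exact (h.col k).index
    · rw [h' _ (by norm_num)]; exact (h.col k).value
  · rw [h' _ (by norm_num)]; exact h.size
  · rw [h' _ (by norm_num)]; exact h.elem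

lemma sum_rowSupp (k : Fin n) (g : Fin n → ℝ) :
    ((rowSupp K k).map g).sum = ∑ j with 0 < K k j, g j := by
  rw [rowSupp, ← List.sum_toFinset _ (Finset.sort_nodup _ _), Finset.sort_toFinset]

lemma sum_colSupp (k : Fin n) (g : Fin n → ℝ) :
    ((colSupp K k).map g).sum = ∑ i with 0 < K i k, g i := by
  rw [colSupp, ← List.sum_toFinset _ (Finset.sort_nodup _ _), Finset.sort_toFinset]

lemma Setup.exp_ell (hs : Setup f b K z u q E H c) {i j : Fin n} (h : 0 < K i j) :
    Real.exp (f.ell q (z i j)) = Real.exp (-c) * K i j := by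
  have := hs.log_eq i j h
  rw [show f.ell q (z i j) = -c + Real.log (K i j) by linarith, Real.exp_add, Real.exp_log h]

lemma Setup.expSum_row (hs : Setup f b K z u q E H c) (X : Fin n → ℤ) (k : Fin n) :
    expSum f u q Op.sub.sgn (fun j => z k j) X (rowSupp K k)
      = Real.exp (-c - fixedPoint u X k) * rowSum (scaling K (fixedPoint u X)) k := by
  have h1 : rowSum (scaling K (fixedPoint u X)) k
      = ∑ j with 0 < K k j, scaling K (fixedPoint u X) k j := by
    rw [rowSum, Finset.sum_filter_of_ne]
    intro j _ hj
    by_contra hcon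
    exact hj (by rw [scaling_eq, le_antisymm (not_lt.1 hcon) (hs.nonneg k j), mul_zero])
  rw [expSum, sum_rowSupp, h1, Finset.mul_sum]
  refine Finset.sum_congr rfl fun j hj => ?_
  rw [Real.exp_add, hs.exp_ell (Finset.mem_filter.1 hj).2, scaling_eq]
  have e : Real.exp (-c - fixedPoint u X k) * (Real.exp (fixedPoint u X k - fixedPoint u X j))
      = Real.exp (-c) * Real.exp (Op.sub.sgn * X j / u) := by
    rw [← Real.exp_add, ← Real.exp_add]
    congr 1
    simp [fixedPoint, Op.sgn]
    ring
  linear_combination (-K k j) * e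

lemma Setup.expSum_col (hs : Setup f b K z u q E H c) (X : Fin n → ℤ) (k : Fin n) :
    expSum f u q Op.add.sgn (fun i => z i k) X (colSupp K k)
      = Real.exp (-c + fixedPoint u X k) * colSum (scaling K (fixedPoint u X)) k := by
  have h1 : colSum (scaling K (fixedPoint u X)) k
      = ∑ i with 0 < K i k, scaling K (fixedPoint u X) i k := by
    rw [colSum, Finset.sum_filter_of_ne]
    intro j _ hj
    by_contra hcon
    exact hj (by rw [scaling_eq, le_antisymm (not_lt.1 hcon) (hs.nonneg j k), mul_zero])
  rw [expSum, sum_colSupp, h1, Finset.mul_sum]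
  refine Finset.sum_congr rfl fun j hj => ?_
  rw [Real.exp_add, hs.exp_ell (Finset.mem_filter.1 hj).2, scaling_eq]
  have e : Real.exp (-c + fixedPoint u X k) * (Real.exp (fixedPoint u X j - fixedPoint u X k))
      = Real.exp (-c) * Real.exp (Op.add.sgn * X j / u) := by
    rw [← Real.exp_add, ← Real.exp_add]
    congr 1
    simp [fixedPoint, Op.sgn]
  linear_combination (-K j k) * e

lemma abs_add_sgn_mul_le {o : Op} (ho : o = .add ∨ o = .sub) {y : ℝ} {x H : ℤ}
    (hy : 2 * |y| ≤ H) (hx : 2 * |x| ≤ H) : |y + o.sgn * x| ≤ H := by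
  have h1 := abs_le.1 (show |y| ≤ (H : ℝ) / 2 by linarith)
  have hx' : 2 * |(x : ℝ)| ≤ H := by exact_mod_cast hx
  have h2 := abs_le.1 (show |(x : ℝ)| ≤ (H : ℝ) / 2 by linarith)
  rcases ho with rfl | rfl <;> simp only [Op.sgn] <;> push_cast <;> rw [abs_le] <;>
    constructor <;> linarith

/-- The integer `y` approximates from below the logarithm of the positive number `S`, up to the
constant `c`. -/
def ApproxLine (n : ℕ) (u : ℤ) (c : ℝ) (y : ℤ) (S : ℝ) : Prop :=
  (y : ℝ) ≤ u * (Real.log S - c) ∧ u * (Real.log S - c) ≤ y + 2 * n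

lemma Setup.rowSupp_ne_nil (hs : Setup f b K z u q E H c) (k : Fin n) : rowSupp K k ≠ [] := by
  intro h
  have h1 := hs.expSum_row (fun _ => 0) k
  rw [h] at h1
  have := (hs.pos (fixedPoint u fun _ => 0) k).1
  have h2 := mul_pos (Real.exp_pos (-c - fixedPoint u (fun _ => 0) k)) this
  rw [← h1] at h2
  simp [expSum] at h2

lemma Setup.colSupp_ne_nil (hs : Setup f b K z u q E H c) (k : Fin n) : colSupp K k ≠ [] := by
  intro h
  have h1 := hs.expSum_col (fun _ => 0) k
  rw [h] at h1
  have := (hs.pos (fixedPoint u fun _ => 0) k).2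
  have h2 := mul_pos (Real.exp_pos (-c + fixedPoint u (fun _ => 0) k)) this
  rw [← h1] at h2
  simp [expSum] at h2

lemma length_rowSupp_le (k : Fin n) : (rowSupp K k).length ≤ n := by
  rw [rowSupp, Finset.length_sort]
  exact (Finset.card_le_univ _).trans (by simp)

lemma length_colSupp_le (k : Fin n) : (colSupp K k).length ≤ n := by
  rw [colSupp, Finset.length_sort]
  exact (Finset.card_le_univ _).trans (by simp)

lemma logRow_spec (hs : Setup f b K z u q E H c) (hc : Consts n u q E σ)
    (hI : InputAt K z color σ) (hX : ∀ i : Fin n, σ.mem 8 (i : ℕ) 0 = X i)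
    (hXH : ∀ i, 2 * |X i| ≤ H) (hk : σ.reg 16 = (k : ℕ)) :
    Runs b (logLine f 0 .sub .add) σ (20 * (rowSupp K k).length + 2) fun σ' =>
      ApproxLine n u c (σ'.reg 27) (rowSum (scaling K (fixedPoint u X)) k) ∧
      |σ'.reg 27| ≤ 3 * H ∧ σ'.reg 18 = X k ∧ (∀ r < 18, σ'.reg r = σ.reg r) ∧
      (∀ r < 20, r ≠ 18 → σ'.reg r = σ.reg r) ∧ σ'.mem = σ.mem := by
  have hp := hs.params
  have hW := hp.le_word
  have hu0 : (0 : ℝ) < u := by exact_mod_cast (by have := hp.u_pos; omega : 0 < u)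
  have hmem : ∀ i ∈ rowSupp K k, 0 < K k i := fun i hi => by simpa [rowSupp] using hi
  have hspec := logSum_spec (f := f) (o := .sub) hp hc (Or.inr rfl) hk (hI.row k) hX
    (hs.rowSupp_ne_nil k) (length_rowSupp_le k) (fun i hi => hs.entry k i (hmem i hi))
    (fun i hi => abs_add_sgn_mul_le (Or.inr rfl) (hs.small k i (hmem i hi)) (hXH i))
  refine Runs.cons (T₂ := 2) hspec ?_
  rintro σ₁ ⟨happ, habs, hsame, hm⟩
  refine Runs.cons (T₁ := 1) (T₂ := 1) (Runs.load (Q := fun σ' => σ' = σ₁.setReg 18 (X k)) ?_) ?_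
  · rw [hsame 16 (by norm_num), hk, hsame 8 (by norm_num), hc.r8, hm, hX]
  rintro _ rfl
  have hXk := hXH k
  have e : Op.add.eval ((σ₁.setReg 18 (X k)).reg 27) ((σ₁.setReg 18 (X k)).reg 18)
      = σ₁.reg 27 + X k := by simp [reg_setReg, Op.eval]
  refine Runs.op ?_ ?_
  · rw [e]
    have := abs_add_le (σ₁.reg 27) (X k)
    have := hp.H_pos
    omega
  · rw [e]
    refine ⟨?_, ?_, by simp [reg_setReg], fun r hr => ?_, fun r hr hr' => ?_, hm⟩
    · rw [hs.expSum_row] at happ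
      obtain ⟨h1, h2⟩ := happ
      have hr := (hs.pos (fixedPoint u X) k).1
      rw [Real.log_mul (Real.exp_pos _).ne' hr.ne', Real.log_exp] at h1 h2
      have e2 : u * (-c - fixedPoint u X k + Real.log (rowSum (scaling K (fixedPoint u X)) k))
          = u * (Real.log (rowSum (scaling K (fixedPoint u X)) k) - c) - X k := by
        unfold fixedPoint; field_simp; ring
      rw [e2] at h1 h2
      simp only [reg_setReg, if_true, ApproxLine]
      push_cast
      constructor <;> linarith
    · simp only [reg_setReg, if_true]
      have := abs_add_le (σ₁.reg 27) (X k)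
      have := hp.H_pos
      omega
    · simp only [reg_setReg]; rw [if_neg (by omega), if_neg (by omega), hsame r (by omega)]
    · simp only [reg_setReg]; rw [if_neg (by omega), if_neg hr', hsame r hr]

lemma logCol_spec (hs : Setup f b K z u q E H c) (hc : Consts n u q E σ)
    (hI : InputAt K z color σ) (hX : ∀ i : Fin n, σ.mem 8 (i : ℕ) 0 = X i)
    (hXH : ∀ i, 2 * |X i| ≤ H) (hk : σ.reg 16 = (k : ℕ)) :
    Runs b (logLine f 3 .add .sub) σ (20 * (colSupp K k).length + 2) fun σ' =>
      ApproxLine n u c (σ'.reg 27) (colSum (scaling K (fixedPoint u X)) k) ∧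
      |σ'.reg 27| ≤ 3 * H ∧
      (∀ r < 20, r ≠ 18 → σ'.reg r = σ.reg r) ∧ σ'.mem = σ.mem := by
  have hp := hs.params
  have hW := hp.le_word
  have hu0 : (0 : ℝ) < u := by exact_mod_cast (by have := hp.u_pos; omega : 0 < u)
  have hmem : ∀ i ∈ colSupp K k, 0 < K i k := fun i hi => by simpa [colSupp] using hi
  have hspec := logSum_spec (f := f) (o := .add) hp hc (Or.inl rfl) hk (hI.col k) hX
    (hs.colSupp_ne_nil k) (length_colSupp_le k) (fun i hi => hs.entry i k (hmem i hi))
    (fun i hi => abs_add_sgn_mul_le (Or.inl rfl) (hs.small i k (hmem i hi)) (hXH i))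
  refine Runs.cons (T₂ := 2) hspec ?_
  rintro σ₁ ⟨happ, habs, hsame, hm⟩
  refine Runs.cons (T₁ := 1) (T₂ := 1) (Runs.load (Q := fun σ' => σ' = σ₁.setReg 18 (X k)) ?_) ?_
  · rw [hsame 16 (by norm_num), hk, hsame 8 (by norm_num), hc.r8, hm, hX]
  rintro _ rfl
  have hXk := hXH k
  have e : Op.sub.eval ((σ₁.setReg 18 (X k)).reg 27) ((σ₁.setReg 18 (X k)).reg 18)
      = σ₁.reg 27 - X k := by simp [reg_setReg, Op.eval]
  have habs' : |σ₁.reg 27 - X k| ≤ 3 * H := by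
    have := abs_sub (σ₁.reg 27) (X k)
    have := hp.H_pos
    omega
  refine Runs.op ?_ ?_
  · rw [e]
    have := hp.H_pos
    omega
  · rw [e]
    refine ⟨?_, ?_, fun r hr hr' => ?_, hm⟩
    · rw [hs.expSum_col] at happ
      obtain ⟨h1, h2⟩ := happ
      have hr := (hs.pos (fixedPoint u X) k).2
      rw [Real.log_mul (Real.exp_pos _).ne' hr.ne', Real.log_exp] at h1 h2
      have e2 : u * (-c + fixedPoint u X k + Real.log (colSum (scaling K (fixedPoint u X)) k))
          = u * (Real.log (colSum (scaling K (fixedPoint u X)) k) - c) + X k := by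
        unfold fixedPoint; field_simp; ring
      rw [e2] at h1 h2
      simp only [reg_setReg, if_true, ApproxLine]
      push_cast
      constructor <;> linarith
    · simpa only [reg_setReg, if_true] using habs'
    · simp only [reg_setReg]; rw [if_neg (by omega), if_neg hr', hsame r hr]

/-- The movement of a coordinate for the computed difference `w` of the logarithms of its column
and row sum: half of `w`, after `w` has been shortened by its maximal error `2 n`. -/
def move (n : ℕ) (w : ℤ) : ℤ :=
  if 0 < w - 2 * n then (w - 2 * n) / 2
  else if 0 < -(w + 2 * n) then -(-(w + 2 * n) / 2) else 0

lemma move_spec {n : ℕ} (hn : 1 ≤ n) {w : ℤ} {d : ℝ} (h : |(w : ℝ) - 2 * d| ≤ 2 * n) :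
    ((0 ≤ (move n w : ℝ) ∧ (move n w : ℝ) ≤ d) ∨ (d ≤ move n w ∧ (move n w : ℝ) ≤ 0)) ∧
      |(move n w : ℝ) - d| ≤ 3 * n := by
  obtain ⟨h1, h2⟩ := abs_le.1 h
  have hn' : (1 : ℝ) ≤ n := by exact_mod_cast hn
  unfold move
  split_ifs with h3 h4
  · have a1 : 0 ≤ (w - 2 * n) / 2 := by omega
    have a2 : 2 * ((w - 2 * n) / 2) ≤ w - 2 * n := by omega
    have a3 : w - 2 * n ≤ 2 * ((w - 2 * n) / 2) + 1 := by omega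
    set t := (w - 2 * n) / 2
    have b1 : (0 : ℝ) ≤ t := by exact_mod_cast a1
    have b2 : (2 * t : ℝ) ≤ w - 2 * n := by exact_mod_cast a2
    have b3 : (w - 2 * n : ℝ) ≤ 2 * t + 1 := by exact_mod_cast a3
    refine ⟨Or.inl ⟨b1, by linarith⟩, ?_⟩
    rw [abs_le]; constructor <;> linarith
  · have a1 : 0 ≤ -(w + 2 * n) / 2 := by omega
    have a2 : 2 * (-(w + 2 * n) / 2) ≤ -(w + 2 * n) := by omega
    have a3 : -(w + 2 * n) ≤ 2 * (-(w + 2 * n) / 2) + 1 := by omega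
    set t := -(w + 2 * n) / 2
    have b1 : (0 : ℝ) ≤ t := by exact_mod_cast a1
    have b2 : (2 * t : ℝ) ≤ -(w + 2 * n) := by exact_mod_cast a2
    have b3 : (-(w + 2 * n) : ℝ) ≤ 2 * t + 1 := by exact_mod_cast a3
    push_cast
    refine ⟨Or.inr ⟨by linarith, by linarith⟩, ?_⟩
    rw [abs_le]; constructor <;> linarith
  · have a1 : w ≤ 2 * n := by omega
    have a2 : -(2 * n) ≤ w := by omega
    have b1 : (w : ℝ) ≤ 2 * n := by exact_mod_cast a1
    have b2 : (-(2 * n) : ℝ) ≤ w := by exact_mod_cast a2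
    push_cast
    refine ⟨?_, ?_⟩
    · rcases le_total 0 d with h | h
      · exact Or.inl ⟨le_rfl, h⟩
      · exact Or.inr ⟨h, le_rfl⟩
    · rw [abs_le]; constructor <;> linarith

/-- The program performs a damped update of accuracy `3 n / u`. The computed logarithms are off by at most
`2 n` units, and so is their difference, since both are rounded down. -/
lemma updateCoord_spec (hs : Setup f b K z u q E H c) (hc : Consts n u q E σ)
    (hI : InputAt K z color σ) (hX : ∀ i : Fin n, σ.mem 8 (i : ℕ) 0 = X i)
    (hXH : ∀ i, 2 * |X i| ≤ H) (hk : σ.reg 16 = (k : ℕ)) :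
    Runs b (updateCoord f) σ (20 * ((rowSupp K k).length + (colSupp K k).length) + 20) fun σ' =>
      ∃ X' : Fin n → ℤ, (∀ i : Fin n, σ'.mem 8 (i : ℕ) 0 = X' i) ∧
        Damped K (3 * n / u) k (fixedPoint u X) (fixedPoint u X') ∧
        (∀ r < 17, σ'.reg r = σ.reg r) ∧ ∀ a < 8, σ'.mem a = σ.mem a := by
  have hp := hs.params
  have hW := hp.le_word
  have hH := hp.H_pos
  have hnH := hp.n_le
  have hu0 : (0 : ℝ) < u := by exact_mod_cast (by have := hp.u_pos; omega : 0 < u)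
  have hXk := hXH k
  refine Runs.mono (T₁ := (20 * (colSupp K k).length + 2) + (1 + ((20 * (rowSupp K k).length + 2)
    + (1 + (1 + ((6 + 1) + 1)))))) ?_ (by omega) (fun _ h => h)
  refine Runs.cons (logCol_spec hs hc hI hX hXH hk) ?_
  rintro σ₁ ⟨hcol, hcabs, hsame1, hmem1⟩
  have h8 : σ₁.reg 8 = 0 := by rw [hsame1 8 (by norm_num) (by norm_num), hc.r8]
  refine Runs.cons (Runs.op (Q := fun σ' => σ' = σ₁.setReg 17 (σ₁.reg 27)) ?_ ?_) ?_
  · simp only [h8, Op.eval, add_zero]; omega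
  · simp only [h8, Op.eval, add_zero]
  rintro _ rfl
  set y := σ₁.reg 27 with hy
  set σ₂ := σ₁.setReg 17 y with hσ₂
  have hs2 : ∀ r < 17, σ₂.reg r = σ.reg r := fun r hr => by
    rw [hσ₂, reg_setReg, if_neg (by omega), hsame1 r (by omega) (by omega)]
  have hm2 : σ₂.mem = σ.mem := hmem1
  refine Runs.cons (logRow_spec hs (hc.of_agree fun r hr => hs2 r (by omega))
    (hI.of_agree fun a _ => by rw [hm2]) (X := X) (by rw [hm2]; exact hX) hXH (k := k)
    (by rw [hs2 16 (by norm_num), hk])) ?_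
  rintro σ₃ ⟨hrow, hrabs, h18, hsame3, -, hmem3⟩
  have h17 : σ₃.reg 17 = y := by rw [hsame3 17 (by norm_num), hσ₂]; simp [reg_setReg]
  set w := y - σ₃.reg 27 with hw
  refine Runs.cons (Runs.op (Q := fun σ' => σ' = σ₃.setReg 17 w) ?_ ?_) ?_
  · rw [h17]
    change |y - σ₃.reg 27| ≤ _
    have := abs_sub y (σ₃.reg 27)
    omega
  · rw [h17]; rfl
  rintro _ rfl
  have hwabs : |w| ≤ 6 * H := by
    have : |w| ≤ |y| + |σ₃.reg 27| := abs_sub y (σ₃.reg 27)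
    omega
  have hw' := abs_le.1 hwabs
  have h10 : σ₃.reg 10 = 2 * n := by
    rw [hsame3 10 (by norm_num), hs2 10 (by norm_num), hc.r10]
  have h8' : σ₃.reg 8 = 0 := by
    rw [hsame3 8 (by norm_num), hs2 8 (by norm_num), hc.r8]
  have h16 : σ₃.reg 16 = (k : ℕ) := by rw [hsame3 16 (by norm_num), hs2 16 (by norm_num), hk]
  have hXk' := abs_le.1 (show |X k| ≤ H by omega)
  refine Runs.cons (Runs.op (Q := fun σ' => σ' = (σ₃.setReg 17 w).setReg 19 (w - 2 * n)) ?_ ?_) ?_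
  · simp only [reg_setReg, if_true, if_neg (by norm_num : ¬ (10 = 17)), h10, Op.eval]
    rw [abs_le]; constructor <;> omega
  · simp only [reg_setReg, if_true, if_neg (by norm_num : ¬ (10 = 17)), h10, Op.eval]
  rintro _ rfl
  set σ₄ := (σ₃.setReg 17 w).setReg 19 (w - 2 * n) with hσ₄
  have g19 : σ₄.reg 19 = w - 2 * n := by simp [hσ₄, reg_setReg]
  have g17 : σ₄.reg 17 = w := by simp [hσ₄, reg_setReg]
  have g18 : σ₄.reg 18 = X k := by simp [hσ₄, reg_setReg, h18]
  have g10 : σ₄.reg 10 = 2 * n := by simp [hσ₄, reg_setReg, h10]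
  have g8 : σ₄.reg 8 = 0 := by simp [hσ₄, reg_setReg, h8']
  have glow : ∀ r < 17, σ₄.reg r = σ.reg r := fun r hr => by
    simp only [hσ₄, reg_setReg]
    rw [if_neg (by omega), if_neg (by omega), hsame3 r (by omega), hs2 r hr]
  have gmem : σ₄.mem = σ.mem := by rw [← hm2, ← hmem3]; rfl
  have htwo : |(2 : ℤ)| ≤ 2 ^ b - 1 := by rw [abs_of_nonneg (by norm_num)]; omega
  refine Runs.cons (T₁ := 6 + 1) (T₂ := 1) (R := fun σ' => σ'.reg 18 = X k + move n w ∧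
    (∀ r < 17, σ'.reg r = σ.reg r) ∧ σ'.mem = σ.mem) (Runs.branch (fun hlt => ?_) fun hlt => ?_) ?_
  · rw [g19] at hlt
    refine Runs.mono (T₁ := 1 + (1 + 1)) ?_ (by norm_num) (fun _ h => h)
    refine Runs.cons (Runs.const (Q := fun σ' => σ' = σ₄.setReg 17 2) htwo rfl) ?_
    rintro _ rfl
    refine Runs.cons (Runs.op (Q := fun σ' => σ' =
      (σ₄.setReg 17 2).setReg 19 ((w - 2 * n) / 2)) ?_ ?_) ?_
    · simp only [reg_setReg, if_true, if_neg (by norm_num : ¬ (19 = 17)), g19, Op.eval]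
      rw [abs_le]; constructor <;> omega
    · simp only [reg_setReg, if_true, if_neg (by norm_num : ¬ (19 = 17)), g19, Op.eval]
    rintro _ rfl
    have e : Op.add.eval (((σ₄.setReg 17 2).setReg 19 ((w - 2 * n) / 2)).reg 18)
        (((σ₄.setReg 17 2).setReg 19 ((w - 2 * n) / 2)).reg 19) = X k + (w - 2 * n) / 2 := by
      simp [reg_setReg, g18, Op.eval]
    refine Runs.op ?_ ?_
    · rw [e, abs_le]; constructor <;> omega
    · rw [e]
      refine ⟨by simp only [reg_setReg, if_true, move, if_pos hlt], fun r hr => ?_, gmem⟩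
      simp only [reg_setReg]
      rw [if_neg (by omega), if_neg (by omega), if_neg (by omega), glow r hr]
  · rw [g19] at hlt
    refine Runs.mono (T₁ := 1 + (1 + (3 + 1))) ?_ (by norm_num) (fun _ h => h)
    refine Runs.cons (Runs.op (Q := fun σ' => σ' = σ₄.setReg 19 (w + 2 * n)) ?_ ?_) ?_
    · simp only [g17, g10, Op.eval]
      rw [abs_le]; constructor <;> omega
    · simp only [g17, g10, Op.eval]
    rintro _ rfl
    refine Runs.cons (Runs.op (Q := fun σ' => σ' =
      (σ₄.setReg 19 (w + 2 * n)).setReg 19 (-(w + 2 * n))) ?_ ?_) ?_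
    · simp only [reg_setReg, if_true, if_neg (by norm_num : ¬ (8 = 19)), g8, Op.eval]
      rw [abs_le]; constructor <;> omega
    · simp only [reg_setReg, if_true, if_neg (by norm_num : ¬ (8 = 19)), g8, Op.eval, zero_sub]
    rintro _ rfl
    set σ₅ := (σ₄.setReg 19 (w + 2 * n)).setReg 19 (-(w + 2 * n)) with hσ₅
    have j19 : σ₅.reg 19 = -(w + 2 * n) := by simp [hσ₅, reg_setReg]
    have j18 : σ₅.reg 18 = X k := by simp [hσ₅, reg_setReg, g18]
    have jlow : ∀ r < 17, σ₅.reg r = σ.reg r := fun r hr => by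
      simp only [hσ₅, reg_setReg]
      rw [if_neg (by omega), if_neg (by omega), glow r hr]
    refine Runs.branch (fun hlt' => ?_) fun hlt' => ?_
    · rw [j19] at hlt'
      refine Runs.mono (T₁ := 1 + (1 + 1)) ?_ (by norm_num) (fun _ h => h)
      refine Runs.cons (Runs.const (Q := fun σ' => σ' = σ₅.setReg 17 2) htwo rfl) ?_
      rintro _ rfl
      refine Runs.cons (Runs.op (Q := fun σ' => σ' =
        (σ₅.setReg 17 2).setReg 19 (-(w + 2 * n) / 2)) ?_ ?_) ?_
      · simp only [reg_setReg, if_true, if_neg (by norm_num : ¬ (19 = 17)), j19, Op.eval]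
        rw [abs_le]; constructor <;> omega
      · simp only [reg_setReg, if_true, if_neg (by norm_num : ¬ (19 = 17)), j19, Op.eval]
      rintro _ rfl
      have e : Op.sub.eval (((σ₅.setReg 17 2).setReg 19 (-(w + 2 * n) / 2)).reg 18)
          (((σ₅.setReg 17 2).setReg 19 (-(w + 2 * n) / 2)).reg 19)
          = X k - (-(w + 2 * n) / 2) := by
        simp [reg_setReg, j18, Op.eval]
      refine Runs.op ?_ ?_
      · rw [e, abs_le]; constructor <;> omega
      · rw [e]
        refine ⟨?_, fun r hr => ?_, gmem⟩
        · simp only [reg_setReg, if_true, move, if_neg hlt, if_pos hlt']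
          ring
        · simp only [reg_setReg]
          rw [if_neg (by omega), if_neg (by omega), if_neg (by omega), jlow r hr]
    · rw [j19] at hlt'
      refine (Runs.const (Q := _) ?_ ?_).mono (T₁ := 1) (by norm_num) (fun _ h => h)
      · simp; omega
      · refine ⟨?_, fun r hr => ?_, gmem⟩
        · simp only [reg_setReg, if_neg (by norm_num : ¬ (18 = 17)), j18, move, if_neg hlt,
            if_neg hlt', add_zero]
        · rw [reg_setReg, if_neg (by omega), jlow r hr]
  rintro σ₅ ⟨k18, ksame, kmem⟩
  refine Runs.store ?_
  rw [k18, ksame 16 (by norm_num), hk, ksame 8 (by norm_num), hc.r8]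
  refine ⟨Function.update X k (X k + move n w), fun i => ?_, ?_, ?_, fun a ha => ?_⟩
  · rw [mem_setMem, kmem]
    by_cases hi : i = k
    · subst hi; simp
    · rw [if_neg, hX, Function.update_of_ne hi]
      rintro ⟨-, h, -⟩
      exact hi (Fin.ext (by exact_mod_cast h))
  · obtain ⟨c1, c2⟩ := hcol
    obtain ⟨r1, r2⟩ := hrow
    have hd : |(w : ℝ) - 2 * (u * exactStep K (fixedPoint u X) k)| ≤ 2 * n := by
      have e : 2 * (u * exactStep K (fixedPoint u X) k)
          = u * (Real.log (colSum (scaling K (fixedPoint u X)) k) - c)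
            - u * (Real.log (rowSum (scaling K (fixedPoint u X)) k) - c) := by
        unfold exactStep; ring
      rw [e, hw]
      push_cast
      rw [abs_le]; constructor <;> linarith
    obtain ⟨m1, m2⟩ := move_spec hp.n_pos hd
    refine ⟨move n w / u, ?_, ?_, ?_⟩
    · ext i
      by_cases hi : i = k
      · subst hi; simp [fixedPoint, add_div]
      · simp [fixedPoint, Function.update_of_ne hi]
    · rcases m1 with ⟨m3, m4⟩ | ⟨m3, m4⟩
      · refine Or.inl ⟨div_nonneg m3 hu0.le, ?_⟩
        rw [div_le_iff₀ hu0]; linarith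
      · refine Or.inr ⟨?_, div_nonpos_of_nonpos_of_nonneg m4 hu0.le⟩
        rw [le_div_iff₀ hu0]; linarith
    · have e : (move n w : ℝ) / u - exactStep K (fixedPoint u X) k
          = (move n w - u * exactStep K (fixedPoint u X) k) / u := by field_simp
      rw [e, abs_div, abs_of_pos hu0]
      gcongr
  · intro r hr
    rw [reg_setMem, ksame r hr]
  · ext i j
    rw [mem_setMem, kmem, if_neg (by omega)]

end Osborne

namespace Osborne

/-! ### The program: the stopping test -/

lemma Runs.op_eq {b : ℕ} {σ : State} {o : Op} {r r₁ r₂ : ℕ} {v : ℤ}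
    (h : o.eval (σ.reg r₁) (σ.reg r₂) = v) (hv : |v| ≤ 2 ^ b - 1) :
    Runs b (.op o r r₁ r₂) σ 1 fun σ' => σ' = σ.setReg r v := by
  subst h
  exact Runs.op hv rfl

/-- The sum of `g i` over the indices `i ≥ m`. -/
noncomputable def tailSum {n : ℕ} (m : ℕ) (g : Fin n → ℝ) : ℝ := 
  ∑ i ∈ Finset.univ.filter fun i : Fin n => m ≤ (i : ℕ), g i

lemma tailSum_self {n : ℕ} (g : Fin n → ℝ) : tailSum n g = 0 := by
  rw [tailSum, Finset.filter_false_of_mem (fun i _ => by have := i.2; omega), Finset.sum_empty]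

lemma tailSum_zero {n : ℕ} (g : Fin n → ℝ) : tailSum 0 g = ∑ i, g i := by
  rw [tailSum, Finset.filter_true_of_mem (fun i _ => Nat.zero_le _)]

lemma tailSum_succ {n m : ℕ} (hm : m < n) (g : Fin n → ℝ) :
    tailSum m g = g ⟨m, hm⟩ + tailSum (m + 1) g := by
  rw [tailSum, tailSum, ← Finset.sum_insert (by simp)]
  congr 1
  ext i
  simp [Fin.ext_iff]
  omega

lemma tailSum_le {n : ℕ} (m : ℕ) {g : Fin n → ℝ} (hg : ∀ i, 0 ≤ g i) : tailSum m g ≤ ∑ i, g i :=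
  Finset.sum_le_univ_sum_of_nonneg hg

variable {f : InputFormat} {b n p : ℕ} {u q E H : ℤ} {σ : State} {K : Matrix (Fin n) (Fin n) ℝ}
  {z : Matrix (Fin n) (Fin n) ℤ} {X : Fin n → ℤ} {k : Fin n} {color : Fin n → Fin p} {c : ℝ}

lemma sum_length_rowSupp : ∑ k, (rowSupp K k).length = nnz K := by
  simp only [rowSupp, Finset.length_sort, nnz_eq_sum]

lemma sum_length_colSupp : ∑ k, (colSupp K k).length = nnz K := by
  simp only [colSupp, Finset.length_sort, nnz_eq_sum, Finset.card_eq_sum_ones, Finset.sum_filter]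
  exact Finset.sum_comm

/-- A function on `Fin n`, extended by zero. -/
def extend0 {n : ℕ} (g : Fin n → ℕ) (m : ℕ) : ℕ := if h : m < n then g ⟨m, h⟩ else 0

lemma sum_extend0 {n : ℕ} (g : Fin n → ℕ) (a : ℕ) :
    ∑ m ∈ Finset.range n, (extend0 g m + a) = ∑ i, g i + n * a := by
  rw [Finset.sum_range, Finset.sum_add_distrib]
  simp [extend0]

/-- The integer `M` is the maximal logarithm of a row sum, up to the errors of `ApproxLine`. -/
structure IsMaxRow (K : Matrix (Fin n) (Fin n) ℝ) (u : ℤ) (c : ℝ) (X : Fin n → ℤ) (M : ℤ) :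
    Prop where
  upper : ∀ i, u * (Real.log (rowSum (scaling K (fixedPoint u X)) i) - c) ≤ M + 2 * n
  attained : ∃ i, (M : ℝ) ≤ u * (Real.log (rowSum (scaling K (fixedPoint u X)) i) - c)

/-- Row `0` is evaluated twice, first to initialize the maximum. -/
lemma maxRow_spec (hs : Setup f b K z u q E H c) (hc : Consts n u q E σ)
    (hI : InputAt K z color σ) (hX : ∀ i : Fin n, σ.mem 8 (i : ℕ) 0 = X i)
    (hXH : ∀ i, 2 * |X i| ≤ H) :
    Runs b (maxRow f) σ (40 * nnz K + 8 * n + 6) fun σ' =>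
      IsMaxRow K u c X (σ'.reg 13) ∧ |σ'.reg 13| ≤ 3 * H ∧
      (∀ r < 12, σ'.reg r = σ.reg r) ∧ σ'.mem = σ.mem := by
  have hp := hs.params
  have hW := hp.le_word
  have hH := hp.H_pos
  have hn := hp.n_pos
  have hnH := hp.n_le
  have hu0 : (0 : ℝ) < u := by exact_mod_cast (by have := hp.u_pos; omega : 0 < u)
  have hlen0 : (rowSupp K ⟨0, hn⟩).length ≤ nnz K := by
    rw [← sum_length_rowSupp]
    exact Finset.single_le_sum (f := fun k => (rowSupp K k).length) (fun _ _ => Nat.zero_le _)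
      (Finset.mem_univ _)
  set ρ : Fin n → ℝ := fun i => u * (Real.log (rowSum (scaling K (fixedPoint u X)) i) - c) with hρ
  let I : ℕ → State → Prop := fun m τ => τ.reg 12 = m ∧ m ≤ n ∧
    (∀ i : Fin n, m ≤ (i : ℕ) → ρ i ≤ τ.reg 13 + 2 * n) ∧ (∃ i, (τ.reg 13 : ℝ) ≤ ρ i) ∧
    |τ.reg 13| ≤ 3 * H ∧ (∀ r < 12, τ.reg r = σ.reg r) ∧ τ.mem = σ.mem
  refine Runs.mono (T₁ := 1 + ((20 * (rowSupp K ⟨0, hn⟩).length + 2) + (1 + (1 +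
    (∑ m ∈ Finset.range n, (extend0 (fun k => 20 * (rowSupp K k).length) m + 7 + 1) + 1))))) ?_ ?_
    (fun _ h => h)
  rotate_left
  · simp only [add_assoc]
    rw [sum_extend0, ← Finset.mul_sum, sum_length_rowSupp]
    omega
  refine Runs.cons (Runs.const (Q := fun σ' => σ' = σ.setReg 16 0) (by simp; omega) rfl) ?_
  rintro _ rfl
  have hsame0 : ∀ r < 16, (σ.setReg 16 0).reg r = σ.reg r := fun r hr => by
    rw [reg_setReg, if_neg (by omega)]
  refine Runs.cons (logRow_spec hs (hc.of_agree fun r hr => hsame0 r (by omega))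
    (hI.of_agree fun a _ => rfl) (X := X) hX hXH (k := ⟨0, hn⟩) (by simp [reg_setReg])) ?_
  rintro σ₁ ⟨happ, habs, -, hsame1, -, hmem1⟩
  have hlow1 : ∀ r < 12, σ₁.reg r = σ.reg r := fun r hr => by
    rw [hsame1 r (by omega), hsame0 r (by omega)]
  refine Runs.cons (Runs.op_eq (v := σ₁.reg 27)
    (by rw [hlow1 8 (by norm_num), hc.r8]; simp [Op.eval]) (by omega)) ?_
  rintro _ rfl
  refine Runs.cons (Runs.op_eq (v := n) (by
    simp [reg_setReg, Op.eval, hlow1 0 (by norm_num), hlow1 8 (by norm_num), hc.r8, hc.r0])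
    (by rw [abs_of_nonneg (by positivity)]; omega)) ?_
  rintro _ rfl
  refine (Runs.loop (t := fun m => extend0 (fun k => 20 * (rowSupp K k).length) m + 7) (I := I)
    (fun c τ h => h.1) n ?_ ?_).mono le_rfl ?_
  · intro m hm τ hτ
    obtain ⟨i1, i2, i3, ⟨i₀, i4⟩, i5, i6, i7⟩ := hτ
    rw [show extend0 (fun k => 20 * (rowSupp K k).length) m = 20 * (rowSupp K ⟨m, hm⟩).length by
      simp [extend0, hm]]
    refine Runs.mono (T₁ := 1 + (1 + ((20 * (rowSupp K ⟨m, hm⟩).length + 2) + (1 + (1 + 1))))) ?_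
      (by omega) (fun _ h => h)
    refine Runs.cons (Runs.op_eq (v := m) (by
      rw [i1, i6 9 (by norm_num), hc.r9]; simp [Op.eval])
      (by rw [abs_of_nonneg (by positivity)]; omega)) ?_
    rintro _ rfl
    refine Runs.cons (Runs.op_eq (v := m) (by
      simp [reg_setReg, i6 8 (by norm_num), hc.r8, Op.eval])
      (by rw [abs_of_nonneg (by positivity)]; omega)) ?_
    rintro _ rfl
    set τ₁ := (τ.setReg 12 m).setReg 16 m with hτ₁
    have t1 : ∀ r < 12, τ₁.reg r = σ.reg r := fun r hr => by
      simp only [hτ₁, reg_setReg]; rw [if_neg (by omega), if_neg (by omega), i6 r hr]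
    have tm : τ₁.mem = σ.mem := i7
    refine Runs.cons (logRow_spec hs (hc.of_agree fun r hr => t1 r (by omega))
      (hI.of_agree fun a _ => by rw [tm]) (X := X) (by rw [tm]; exact hX) hXH (k := ⟨m, hm⟩)
      (by simp [hτ₁, reg_setReg])) ?_
    rintro τ₂ ⟨happ', habs', -, s2, -, m2⟩
    have e12 : τ₂.reg 12 = m := by rw [s2 12 (by norm_num)]; simp [hτ₁, reg_setReg]
    have e13 : τ₂.reg 13 = τ.reg 13 := by rw [s2 13 (by norm_num)]; simp [hτ₁, reg_setReg]
    have e8 : τ₂.reg 8 = 0 := by rw [s2 8 (by norm_num), t1 8 (by norm_num), hc.r8]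
    have elow : ∀ r < 12, τ₂.reg r = σ.reg r := fun r hr => by rw [s2 r (by omega), t1 r hr]
    have habs₁ := abs_le.1 habs'
    have habs₂ := abs_le.1 i5
    refine Runs.cons (Runs.op_eq (v := τ₂.reg 27 - τ.reg 13) (by rw [e13]; rfl)
      (by rw [abs_le]; constructor <;> omega)) ?_
    rintro _ rfl
    refine Runs.branch (fun hlt => ?_) fun hlt => ?_
    · simp only [reg_setReg, if_true] at hlt
      refine (Runs.op_eq (v := τ₂.reg 27) (by simp [reg_setReg, e8, Op.eval]) (by omega)).mono
        le_rfl ?_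
      rintro _ rfl
      refine ⟨by simp [reg_setReg, e12], by omega, fun i hi => ?_, ⟨⟨m, hm⟩, ?_⟩, ?_, ?_, ?_⟩
      · simp only [reg_setReg, if_true]
        rcases eq_or_lt_of_le hi with h | h
        · have : i = ⟨m, hm⟩ := Fin.ext h.symm
          rw [this]; exact happ'.2
        · have h1 := i3 i h
          have h2 : (τ.reg 13 : ℝ) ≤ τ₂.reg 27 := by exact_mod_cast (by omega)
          linarith
      · simp only [reg_setReg, if_true]; exact happ'.1
      · simpa only [reg_setReg, if_true] using habs'
      · intro r hr
        simp only [reg_setReg]; rw [if_neg (by omega), if_neg (by omega), elow r hr]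
      · rw [mem_setReg, mem_setReg, m2, tm]
    · simp only [reg_setReg, if_true] at hlt
      refine Runs.const (by simp; omega) ?_
      refine ⟨by simp [reg_setReg, e12], by omega, fun i hi => ?_, ⟨i₀, ?_⟩, ?_, ?_, ?_⟩
      · simp only [reg_setReg, if_neg (by norm_num : ¬ (13 = 28)), e13]
        rcases eq_or_lt_of_le hi with h | h
        · have : i = ⟨m, hm⟩ := Fin.ext h.symm
          have h2 : (τ₂.reg 27 : ℝ) ≤ τ.reg 13 := by exact_mod_cast (by omega)
          have h3 : ρ i ≤ τ₂.reg 27 + 2 * n := by rw [this]; exact happ'.2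
          linarith
        · exact i3 i h
      · simpa only [reg_setReg, if_neg (by norm_num : ¬ (13 = 28)), e13] using i4
      · simpa only [reg_setReg, if_neg (by norm_num : ¬ (13 = 28)), e13] using i5
      · intro r hr
        simp only [reg_setReg]; rw [if_neg (by omega), if_neg (by omega), elow r hr]
      · rw [mem_setReg, mem_setReg, m2, tm]
  · refine ⟨by simp [reg_setReg], le_rfl, fun i hi => ?_, ⟨⟨0, hn⟩, ?_⟩, ?_, ?_, ?_⟩
    · have := i.2; omega
    · simp only [reg_setReg, if_true, if_neg (by norm_num : ¬ (13 = 12))]; exact happ.1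
    · simpa only [reg_setReg, if_true, if_neg (by norm_num : ¬ (13 = 12))] using habs
    · intro r hr
      simp only [reg_setReg]; rw [if_neg (by omega), if_neg (by omega), hlow1 r hr]
    · rw [mem_setReg, mem_setReg, hmem1]; rfl
  · rintro τ ⟨-, -, i3, i4, i5, i6, i7⟩
    exact ⟨⟨fun i => i3 i (Nat.zero_le _), i4⟩, i5, i6, i7⟩

/-- Exponentiation of an approximate logarithm, relative to the reference value `M`. -/
lemma ApproxLine.exp_bounds {y M : ℤ} {S : ℝ} (hu : 1 ≤ u) (hS : 0 < S)
    (h : ApproxLine n u c y S) :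
    (Op.eval .exp (y - M) u : ℝ) ≤ u * (Real.exp (-c - M / u) * S) ∧
      u * (Real.exp (-c - M / u) * S) - 2 * n * (Real.exp (-c - M / u) * S) - 1
        ≤ Op.eval .exp (y - M) u ∧ 0 ≤ Op.eval .exp (y - M) u := by
  have hu0 : (0 : ℝ) < u := by exact_mod_cast hu
  obtain ⟨h1, h2⟩ := h
  have e : Real.exp (-c - M / u) * S = Real.exp (Real.log S - c - M / u) := by
    rw [show Real.log S - c - M / u = (-c - M / u) + Real.log S by ring, Real.exp_add,
      Real.exp_log hS]
  rw [e]
  set t := Real.log S - c - M / u with ht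
  have hv : (((y - M : ℤ) : ℝ)) / u = (y : ℝ) / u - M / u := by push_cast; ring
  have hle : (((y - M : ℤ) : ℝ)) / u ≤ t := by
    rw [hv]
    have : (y : ℝ) / u ≤ Real.log S - c := by rw [div_le_iff₀ hu0]; linarith
    linarith
  have hge : t ≤ (((y - M : ℤ) : ℝ)) / u + 2 * n / u := by
    rw [hv]
    have : Real.log S - c ≤ (y : ℝ) / u + 2 * n / u := by
      rw [← add_div, le_div_iff₀ hu0]; linarith
    linarith
  have f1 := Int.floor_le ((u : ℝ) * Real.exp (((y - M : ℤ) : ℝ) / u))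
  have f2 := (Int.lt_floor_add_one ((u : ℝ) * Real.exp (((y - M : ℤ) : ℝ) / u))).le
  refine ⟨?_, ?_, Int.floor_nonneg.2 (by positivity)⟩
  · exact f1.trans (mul_le_mul_of_nonneg_left (Real.exp_le_exp.2 hle) hu0.le)
  · have g1 : Real.exp t * Real.exp (-(2 * n / u)) ≤ Real.exp (((y - M : ℤ) : ℝ) / u) := by
      rw [← Real.exp_add]; exact Real.exp_le_exp.2 (by linarith)
    have g2 : 1 - 2 * n / u ≤ Real.exp (-(2 * n / u : ℝ)) := by
      have := Real.add_one_le_exp (-(2 * n / u : ℝ)); linarith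
    have g3 : u * (Real.exp t * (1 - 2 * n / u)) ≤ u * Real.exp (((y - M : ℤ) : ℝ) / u) :=
      mul_le_mul_of_nonneg_left
        ((mul_le_mul_of_nonneg_left g2 (Real.exp_pos t).le).trans g1) hu0.le
    have g4 : u * (Real.exp t * (1 - 2 * n / u)) = u * Real.exp t - 2 * n * Real.exp t := by
      field_simp
    have : (Op.eval .exp (y - M) u : ℝ) = (⌊(u : ℝ) * Real.exp (((y - M : ℤ) : ℝ) / u)⌋ : ℤ) := rfl
    rw [this]
    linarith

/-- The error of a difference, for approximations from below. -/
lemma abs_sub_abs_le_of_bounds {u N r t a a' : ℝ} (hu : 0 ≤ u) (hN : 0 ≤ N) (hr : 0 ≤ r)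
    (ht : 0 ≤ t) (h1 : a ≤ u * r) (h2 : u * r - 2 * N * r - 1 ≤ a) (h3 : a' ≤ u * t)
    (h4 : u * t - 2 * N * t - 1 ≤ a') :
    |a - a'| ≤ u * |r - t| + 2 * N * (r + t) + 1 ∧
      u * |r - t| - 2 * N * (r + t) - 1 ≤ |a - a'| := by
  have hNr := mul_nonneg hN hr
  have hNt := mul_nonneg hN ht
  have h5 : |(a - a') - u * (r - t)| ≤ 2 * N * (r + t) + 1 := by
    rw [abs_le]; constructor <;> linarith
  have h6 := abs_sub_abs_le_abs_sub (a - a') (u * (r - t))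
  have h7 := abs_sub_abs_le_abs_sub (u * (r - t)) (a - a')
  rw [abs_sub_comm (u * (r - t))] at h7
  rw [abs_mul, abs_of_nonneg hu] at h6 h7
  constructor <;> linarith

/-- The computed row sums add up to `S`, and their distances from the computed column sums add up
to `D`; here the exact sums are scaled by the factor `s` and by `u`. -/
structure LineSums (K : Matrix (Fin n) (Fin n) ℝ) (u : ℤ) (s : ℝ) (x : Fin n → ℝ) (S D : ℤ) :
    Prop where
  S_le : (S : ℝ) ≤ u * (s * total K x)
  le_S : u * (s * total K x) - 2 * n * (s * total K x) - n ≤ S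
  D_le : (D : ℝ) ≤ u * (s * imbalance K x) + 4 * n * (s * total K x) + n
  le_D : u * (s * imbalance K x) - 4 * n * (s * total K x) - n ≤ D
  abs_S : |S| ≤ 2 * (u * n)
  abs_D : |D| ≤ 4 * (u * n)

set_option maxHeartbeats 1000000 in
lemma sumLines_spec (hs : Setup f b K z u q E H c) (hc : Consts n u q E σ)
    (hI : InputAt K z color σ) (hX : ∀ i : Fin n, σ.mem 8 (i : ℕ) 0 = X i)
    (hXH : ∀ i, 2 * |X i| ≤ H) {M : ℤ} (h13 : σ.reg 13 = M) (hM : |M| ≤ 3 * H)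
    (hF : Real.exp (-c - M / u) * total K (fixedPoint u X) ≤ 2 * n) :
    Runs b (sumLines f) σ (40 * nnz K + 15 * n + 4) fun σ' =>
      LineSums K u (Real.exp (-c - M / u)) (fixedPoint u X) (σ'.reg 14) (σ'.reg 15) ∧
      (∀ r < 12, σ'.reg r = σ.reg r) ∧ σ'.mem = σ.mem := by
  have hp := hs.params
  have hW := hp.le_word
  have hH := hp.H_pos
  have hn := hp.n_pos
  have hnH := hp.n_le
  have hunH : u * n ≤ H := by have := hp.size; omega
  have hu0 : (0 : ℝ) < u := by exact_mod_cast (by have := hp.u_pos; omega : 0 < u)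
  set x := fixedPoint u X with hx
  set s := Real.exp (-c - M / u) with hsdef
  have hs0 : 0 < s := Real.exp_pos _
  have hpos := hs.pos x
  set r : Fin n → ℝ := fun i => s * rowSum (scaling K x) i with hr
  set t : Fin n → ℝ := fun i => s * colSum (scaling K x) i with ht
  have hr0 : ∀ i, 0 ≤ r i := fun i => (mul_pos hs0 (hpos i).1).le
  have ht0 : ∀ i, 0 ≤ t i := fun i => (mul_pos hs0 (hpos i).2).le
  have hrs : ∑ i, r i = s * total K x := by rw [← sum_rowSum, Finset.mul_sum]
  have hts : ∑ i, t i = s * total K x := by rw [← sum_colSum, Finset.mul_sum]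
  have hN : ((u * n : ℤ) : ℝ) = u * n := by push_cast; ring
  -- no partial sum overflows
  have hbS : ∀ (m : ℕ) (S : ℤ), 0 ≤ S → (S : ℝ) ≤ tailSum m (fun i => u * r i) →
      |S| ≤ 2 * (u * n) := by
    intro m S h0 h1
    have h2 := h1.trans (tailSum_le m fun i => mul_nonneg hu0.le (hr0 i))
    rw [← Finset.mul_sum, hrs] at h2
    rw [abs_of_nonneg h0]
    have : (S : ℝ) ≤ 2 * (u * n) := by nlinarith
    exact_mod_cast this
  have hbD : ∀ (m : ℕ) (D : ℤ), 0 ≤ D → (D : ℝ) ≤ tailSum m (fun i => u * (r i + t i)) →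
      |D| ≤ 4 * (u * n) := by
    intro m D h0 h1
    have h2 := h1.trans (tailSum_le m fun i => mul_nonneg hu0.le (add_nonneg (hr0 i) (ht0 i)))
    rw [← Finset.mul_sum, Finset.sum_add_distrib, hrs, hts] at h2
    rw [abs_of_nonneg h0]
    have : (D : ℝ) ≤ 4 * (u * n) := by nlinarith
    exact_mod_cast this
  let I : ℕ → State → Prop := fun m τ => τ.reg 12 = m ∧ m ≤ n ∧
    0 ≤ τ.reg 14 ∧ 0 ≤ τ.reg 15 ∧
    (τ.reg 14 : ℝ) ≤ tailSum m (fun i => u * r i) ∧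
    tailSum m (fun i => u * r i - 2 * n * r i - 1) ≤ τ.reg 14 ∧
    (τ.reg 15 : ℝ) ≤ tailSum m (fun i => u * (r i + t i)) ∧
    (τ.reg 15 : ℝ) ≤ tailSum m (fun i => u * |r i - t i| + 2 * n * (r i + t i) + 1) ∧
    tailSum m (fun i => u * |r i - t i| - 2 * n * (r i + t i) - 1) ≤ τ.reg 15 ∧
    τ.reg 13 = M ∧ (∀ r < 12, τ.reg r = σ.reg r) ∧ τ.mem = σ.mem
  refine Runs.mono (T₁ := 1 + (1 + (1 + (∑ m ∈ Finset.range n, (extend0 (fun k =>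
    20 * (rowSupp K k).length + 20 * (colSupp K k).length) m + 14 + 1) + 1)))) ?_ ?_ (fun _ h => h)
  rotate_left
  · simp only [add_assoc]
    rw [sum_extend0, Finset.sum_add_distrib, ← Finset.mul_sum, ← Finset.mul_sum,
      sum_length_rowSupp, sum_length_colSupp]
    omega
  refine Runs.cons (Runs.const (Q := fun σ' => σ' = σ.setReg 14 0) (by simp; omega) rfl) ?_
  rintro _ rfl
  refine Runs.cons (Runs.const (Q := fun σ' => σ' = (σ.setReg 14 0).setReg 15 0)
    (by simp; omega) rfl) ?_
  rintro _ rfl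
  refine Runs.cons (Runs.op_eq (v := n) (by
    simp [reg_setReg, Op.eval, hc.r8, hc.r0])
    (by rw [abs_of_nonneg (by positivity)]; omega)) ?_
  rintro _ rfl
  refine (Runs.loop (t := fun m => extend0 (fun k =>
    20 * (rowSupp K k).length + 20 * (colSupp K k).length) m + 14) (I := I)
    (fun c τ h => h.1) n ?_ ?_).mono le_rfl ?_
  · intro m hm τ hτ
    obtain ⟨i1, i2, i3, i4, i5, i6, i7, i8, i9, i13, ilow, imem⟩ := hτ
    have bS := abs_le.1 (hbS _ _ i3 i5)
    have bD := abs_le.1 (hbD _ _ i4 i7)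
    have hbM := abs_le.1 hM
    rw [show extend0 (fun k => 20 * (rowSupp K k).length + 20 * (colSupp K k).length) m
      = 20 * (rowSupp K ⟨m, hm⟩).length + 20 * (colSupp K ⟨m, hm⟩).length by simp [extend0, hm]]
    set k : Fin n := ⟨m, hm⟩ with hk
    refine Runs.mono (T₁ := 1 + (1 + ((20 * (rowSupp K k).length + 2) + (1 + (1 + (1 +
      ((20 * (colSupp K k).length + 2) + (1 + (1 + (1 + (1 + 1))))))))))) ?_
      (by omega) (fun _ h => h)
    refine Runs.cons (Runs.op_eq (v := m) (by
      rw [i1, ilow 9 (by norm_num), hc.r9]; simp [Op.eval])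
      (by rw [abs_of_nonneg (by positivity)]; omega)) ?_
    rintro _ rfl
    refine Runs.cons (Runs.op_eq (v := m) (by
      simp [reg_setReg, ilow 8 (by norm_num), hc.r8, Op.eval])
      (by rw [abs_of_nonneg (by positivity)]; omega)) ?_
    rintro _ rfl
    set τ₁ := (τ.setReg 12 m).setReg 16 m with hτ₁
    have t1 : ∀ r < 12, τ₁.reg r = σ.reg r := fun r hr => by
      simp only [hτ₁, reg_setReg]; rw [if_neg (by omega), if_neg (by omega), ilow r hr]
    have tm : τ₁.mem = σ.mem := imem
    refine Runs.cons (logRow_spec hs (hc.of_agree fun r hr => t1 r (by omega))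
      (hI.of_agree fun a _ => by rw [tm]) (X := X) (by rw [tm]; exact hX) hXH (k := k)
      (by simp [hτ₁, reg_setReg, hk])) ?_
    rintro τ₂ ⟨happ, habs, -, s2, -, m2⟩
    obtain ⟨y1, y2, y3⟩ := happ.exp_bounds (M := M) hp.u_pos (hpos k).1
    set y := τ₂.reg 27 with hy
    set a := Op.eval .exp (y - M) u with ha
    have habs₁ := abs_le.1 habs
    have e12 : τ₂.reg 12 = m := by rw [s2 12 (by norm_num)]; simp [hτ₁, reg_setReg]
    have e13 : τ₂.reg 13 = M := by rw [s2 13 (by norm_num)]; simp [hτ₁, reg_setReg, i13]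
    have e14 : τ₂.reg 14 = τ.reg 14 := by rw [s2 14 (by norm_num)]; simp [hτ₁, reg_setReg]
    have e15 : τ₂.reg 15 = τ.reg 15 := by rw [s2 15 (by norm_num)]; simp [hτ₁, reg_setReg]
    have e16 : τ₂.reg 16 = m := by rw [s2 16 (by norm_num)]; simp [hτ₁, reg_setReg]
    have elow : ∀ r < 12, τ₂.reg r = σ.reg r := fun r hr => by rw [s2 r (by omega), t1 r hr]
    have e7 : τ₂.reg 7 = u := by rw [elow 7 (by norm_num), hc.r7]
    have hS0 : 0 ≤ τ.reg 14 + a := by omega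
    have hS1 : ((τ.reg 14 + a : ℤ) : ℝ) ≤ tailSum m (fun i => u * r i) := by
      rw [tailSum_succ hm]; push_cast; linarith
    have bS' := abs_le.1 (hbS _ _ hS0 hS1)
    refine Runs.cons (Runs.op_eq (v := y - M) (by rw [e13]; rfl)
      (by rw [abs_le]; constructor <;> omega)) ?_
    rintro _ rfl
    refine Runs.cons (Runs.op_eq (v := a) (by simp [reg_setReg, e7, ha])
      (by rw [abs_le]; constructor <;> omega)) ?_
    rintro _ rfl
    refine Runs.cons (Runs.op_eq (v := τ.reg 14 + a) (by simp [reg_setReg, e14, Op.eval])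
      (by rw [abs_le]; constructor <;> omega)) ?_
    rintro _ rfl
    set τ₃ := ((τ₂.setReg 27 (y - M)).setReg 17 a).setReg 14 (τ.reg 14 + a) with hτ₃
    have g1 : ∀ r < 12, τ₃.reg r = σ.reg r := fun r hr => by
      simp only [hτ₃, reg_setReg]
      rw [if_neg (by omega), if_neg (by omega), if_neg (by omega), elow r hr]
    have gm : τ₃.mem = σ.mem := by rw [← tm, ← m2]; rfl
    refine Runs.cons (logCol_spec hs (hc.of_agree fun r hr => g1 r (by omega))
      (hI.of_agree fun a _ => by rw [gm]) (X := X) (by rw [gm]; exact hX) hXH (k := k)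
      (by simp [hτ₃, reg_setReg, e16, hk])) ?_
    rintro τ₄ ⟨happ', habs', s4, m4⟩
    obtain ⟨w1, w2, w3⟩ := happ'.exp_bounds (M := M) hp.u_pos (hpos k).2
    set w := τ₄.reg 27 with hw
    set a' := Op.eval .exp (w - M) u with ha'
    have habs₂ := abs_le.1 habs'
    have d12 : τ₄.reg 12 = m := by
      rw [s4 12 (by norm_num) (by norm_num)]; simp [hτ₃, reg_setReg, e12]
    have d13 : τ₄.reg 13 = M := by
      rw [s4 13 (by norm_num) (by norm_num)]; simp [hτ₃, reg_setReg, e13]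
    have d14 : τ₄.reg 14 = τ.reg 14 + a := by
      rw [s4 14 (by norm_num) (by norm_num)]; simp [hτ₃, reg_setReg]
    have d15 : τ₄.reg 15 = τ.reg 15 := by
      rw [s4 15 (by norm_num) (by norm_num)]; simp [hτ₃, reg_setReg, e15]
    have d17 : τ₄.reg 17 = a := by
      rw [s4 17 (by norm_num) (by norm_num)]; simp [hτ₃, reg_setReg]
    have dlow : ∀ r < 12, τ₄.reg r = σ.reg r := fun r hr => by
      rw [s4 r (by omega) (by omega), g1 r hr]
    have d7 : τ₄.reg 7 = u := by rw [dlow 7 (by norm_num), hc.r7]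
    have hua : |a'| ≤ 2 * (u * n) := by
      rw [abs_of_nonneg w3]
      have h1 : t k ≤ s * total K x := by
        rw [← hts]; exact Finset.single_le_sum (fun i _ => ht0 i) (Finset.mem_univ k)
      have : (a' : ℝ) ≤ 2 * (u * n) := by
        have : u * t k ≤ u * (2 * n) := mul_le_mul_of_nonneg_left (h1.trans hF) hu0.le
        linarith
      exact_mod_cast this
    have hua' := abs_le.1 hua
    refine Runs.cons (Runs.op_eq (v := w - M) (by rw [d13]; rfl)
      (by rw [abs_le]; constructor <;> omega)) ?_
    rintro _ rfl
    refine Runs.cons (Runs.op_eq (v := a') (by simp [reg_setReg, d7, ha'])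
      (by rw [abs_le]; constructor <;> omega)) ?_
    rintro _ rfl
    refine Runs.cons (Runs.op_eq (v := a - a') (by simp [reg_setReg, d17, Op.eval])
      (by rw [abs_le]; constructor <;> omega)) ?_
    rintro _ rfl
    -- whichever branch is taken, `|a - a'|` is added to register `15`
    have hfin : ∀ D' : ℤ, D' = τ.reg 15 + |a - a'| → |D'| ≤ 4 * (u * n) ∧
        I m ((((τ₄.setReg 27 (w - M)).setReg 19 a').setReg 17 (a - a')).setReg 15 D') := by
      rintro _ rfl
      have hR1 : (a : ℝ) ≤ u * r k := y1
      have hR2 : u * r k - 2 * n * r k - 1 ≤ a := y2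
      have hT1 : (a' : ℝ) ≤ u * t k := w1
      have hT2 : u * t k - 2 * n * t k - 1 ≤ a' := w2
      have hA : ((|a - a'| : ℤ) : ℝ) = |(a : ℝ) - a'| := by push_cast; rfl
      have hA0 : |a - a'| ≤ a + a' := by rw [abs_le]; constructor <;> omega
      have hA0' : ((|a - a'| : ℤ) : ℝ) ≤ a + a' := by exact_mod_cast hA0
      obtain ⟨hA1, hA2⟩ := abs_sub_abs_le_of_bounds hu0.le (Nat.cast_nonneg n) (hr0 k) (ht0 k)
        hR1 hR2 hT1 hT2
      have hD0 : 0 ≤ τ.reg 15 + |a - a'| := by positivity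
      have hD1 : ((τ.reg 15 + |a - a'| : ℤ) : ℝ) ≤ tailSum m (fun i => u * (r i + t i)) := by
        rw [tailSum_succ hm]; push_cast at hA0' ⊢; linarith
      refine ⟨hbD _ _ hD0 hD1, ?_⟩
      refine ⟨by simp [reg_setReg, d12], by omega, ?_, ?_, ?_, ?_, ?_, ?_, ?_, ?_, ?_, ?_⟩
      · simpa [reg_setReg, d14] using hS0
      · simpa [reg_setReg] using hD0
      · simpa [reg_setReg, d14] using hS1
      · simp only [reg_setReg, d14, if_neg (by norm_num : ¬ (14 = 15)),
          if_neg (by norm_num : ¬ (14 = 17)), if_neg (by norm_num : ¬ (14 = 19)),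
          if_neg (by norm_num : ¬ (14 = 27))]
        rw [tailSum_succ hm]; push_cast; linarith
      · simpa [reg_setReg] using hD1
      · simp only [reg_setReg, if_true]
        rw [tailSum_succ hm]; push_cast; linarith
      · simp only [reg_setReg, if_true]
        rw [tailSum_succ hm]; push_cast; linarith
      · simp [reg_setReg, d13]
      · intro r hr
        simp only [reg_setReg]
        rw [if_neg (by omega), if_neg (by omega), if_neg (by omega), if_neg (by omega), dlow r hr]
      · rw [← gm, ← m4]; rfl
    refine Runs.branch (fun hlt => ?_) fun hlt => ?_
    · simp only [reg_setReg, if_true] at hlt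
      obtain ⟨h1, h2⟩ := hfin (τ.reg 15 + (a - a')) (by rw [abs_of_pos hlt])
      refine (Runs.op_eq (v := τ.reg 15 + (a - a')) (by simp [reg_setReg, d15, Op.eval])
        (by omega)).mono le_rfl ?_
      rintro _ rfl
      exact h2
    · simp only [reg_setReg, if_true] at hlt
      obtain ⟨h1, h2⟩ := hfin (τ.reg 15 - (a - a')) (by rw [abs_of_nonpos (not_lt.1 hlt)]; ring)
      refine (Runs.op_eq (v := τ.reg 15 - (a - a')) (by simp [reg_setReg, d15, Op.eval])
        (by omega)).mono le_rfl ?_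
      rintro _ rfl
      exact h2
  · refine ⟨by simp [reg_setReg], le_rfl, by simp [reg_setReg], by simp [reg_setReg], ?_, ?_, ?_,
      ?_, ?_, by simp [reg_setReg, h13], fun r hr => ?_, rfl⟩
    · simp [reg_setReg, tailSum_self]
    · simp [reg_setReg, tailSum_self]
    · simp [reg_setReg, tailSum_self]
    · simp [reg_setReg, tailSum_self]
    · simp [reg_setReg, tailSum_self]
    · simp only [reg_setReg]; rw [if_neg (by omega), if_neg (by omega), if_neg (by omega)]
  · rintro τ ⟨-, -, i3, i4, i5, i6, i7, i8, i9, -, ilow, imem⟩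
    have bS := hbS _ _ i3 i5
    have bD := hbD _ _ i4 i7
    have himb : ∑ i, |r i - t i| = s * imbalance K x := by
      rw [imbalance, Finset.mul_sum]
      refine Finset.sum_congr rfl fun i _ => ?_
      rw [hr, ht, ← mul_sub, abs_mul, abs_of_pos hs0]
    rw [tailSum_zero] at i5 i6 i8 i9
    simp only [Finset.sum_sub_distrib, Finset.sum_add_distrib, ← Finset.mul_sum, hrs, hts, himb,
      Finset.sum_const, Finset.card_univ, Fintype.card_fin, nsmul_eq_mul, mul_one] at i5 i6 i8 i9
    refine ⟨⟨i5, i6, ?_, ?_, bS, bD⟩, ilow, imem⟩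
    · linarith
    · linarith

/-- What the stopping test `2 E D ≤ S` says about the exact sums. -/
lemma LineSums.test {S D : ℤ} {s : ℝ} {x : Fin n → ℝ} (h : LineSums K u s x S D) (hn : 1 ≤ n)
    (hE : 1 ≤ E) (hu : 30 * (n * E) ≤ u) (hs : 0 < s) (hF : 1 ≤ s * total K x) :
    (2 * (E * D) ≤ S → E * imbalance K x ≤ total K x) ∧
      (S < 2 * (E * D) → total K x ≤ 4 * (E * imbalance K x)) := by
  obtain ⟨h1, h2, h3, h4, -, -⟩ := h
  have hn' : (1 : ℝ) ≤ n := by exact_mod_cast hn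
  have hE' : (1 : ℝ) ≤ E := by exact_mod_cast hE
  have hu' : 30 * (n * E : ℝ) ≤ u := by exact_mod_cast hu
  have hu0 : (0 : ℝ) < u := by nlinarith
  set F := s * total K x with hFdef
  set G := s * imbalance K x with hGdef
  have hnF : (n : ℝ) ≤ n * F := by nlinarith
  have hEnF : 30 * (E * (n * F)) ≤ u * F := by nlinarith
  have hnF' : n * F ≤ E * (n * F) := by nlinarith [mul_nonneg (by linarith : (0 : ℝ) ≤ n) (by linarith : 0 ≤ F)]
  constructor
  · intro h5
    have h5' : 2 * (E * D : ℝ) ≤ S := by exact_mod_cast h5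
    have h6 : (E : ℝ) * (u * G - 5 * (n * F)) ≤ E * D :=
      mul_le_mul_of_nonneg_left (by linarith) (by linarith)
    have h7 : u * (E * G) ≤ u * F := by nlinarith
    have h8 : E * G ≤ F := le_of_mul_le_mul_left h7 hu0
    have h9 : s * (E * imbalance K x) ≤ s * total K x := by rw [hGdef, hFdef] at h8; linarith
    exact le_of_mul_le_mul_left h9 hs
  · intro h5
    have h5' : (S : ℝ) ≤ 2 * (E * D) := by exact_mod_cast h5.le
    have h6 : (E : ℝ) * D ≤ E * (u * G + 5 * (n * F)) :=
      mul_le_mul_of_nonneg_left (by linarith) (by linarith)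
    have h7 : u * F ≤ u * (4 * (E * G)) := by nlinarith
    have h8 : F ≤ 4 * (E * G) := le_of_mul_le_mul_left h7 hu0
    have h9 : s * total K x ≤ s * (4 * (E * imbalance K x)) := by
      rw [hGdef, hFdef] at h8; linarith
    exact le_of_mul_le_mul_left h9 hs

lemma check_spec (hs : Setup f b K z u q E H c) (hu : 30 * (n * E) ≤ u) (hc : Consts n u q E σ)
    (hI : InputAt K z color σ) (hX : ∀ i : Fin n, σ.mem 8 (i : ℕ) 0 = X i)
    (hXH : ∀ i, 2 * |X i| ≤ H) :
    Runs b (check f) σ (80 * nnz K + 23 * n + 16) fun σ' =>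
      ((σ'.reg 6 = 1 ∧ E * imbalance K (fixedPoint u X) ≤ total K (fixedPoint u X)) ∨
        (σ'.reg 6 = σ.reg 6 ∧ total K (fixedPoint u X) ≤ 4 * (E * imbalance K (fixedPoint u X)))) ∧
      (∀ r < 12, r ≠ 6 → σ'.reg r = σ.reg r) ∧ σ'.mem = σ.mem := by
  have hp := hs.params
  have hW := hp.le_word
  have hH := hp.H_pos
  have hn := hp.n_pos
  have hE := hp.E_pos
  have hunH : u * n ≤ H := by have := hp.size; omega
  have hu0 : (0 : ℝ) < u := by exact_mod_cast (by have := hp.u_pos; omega : 0 < u)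
  set x := fixedPoint u X with hx
  have hpos := hs.pos x
  refine Runs.mono (T₁ := (40 * nnz K + 8 * n + 6) + ((40 * nnz K + 15 * n + 4) +
    (1 + (1 + (1 + (1 + (1 + 1))))))) ?_ (by omega) (fun _ h => h)
  refine Runs.cons (maxRow_spec hs hc hI hX hXH) ?_
  rintro σ₁ ⟨hmax, habs, s1, m1⟩
  set M := σ₁.reg 13 with hM
  set s := Real.exp (-c - M / u) with hsdef
  have hs0 : 0 < s := Real.exp_pos _
  have hexp : ∀ i, s * rowSum (scaling K x) i
      = Real.exp ((u * (Real.log (rowSum (scaling K x) i) - c) - M) / u) := by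
    intro i
    rw [show (u * (Real.log (rowSum (scaling K x) i) - c) - M) / u
      = (-c - M / u) + Real.log (rowSum (scaling K x) i) by field_simp; ring, Real.exp_add,
      Real.exp_log (hpos i).1]
  have hF2 : s * total K x ≤ 2 * n := by
    rw [← sum_rowSum, Finset.mul_sum]
    refine (Finset.sum_le_card_nsmul _ _ 2 fun i _ => ?_).trans (by simp [mul_comm])
    rw [hexp]
    have h1 : (u * (Real.log (rowSum (scaling K x) i) - c) - M) / u ≤ 1 / 2 := by
      rw [div_le_iff₀ hu0]
      have h2 := hmax.upper i
      have h3 : 30 * (n * E : ℝ) ≤ u := by exact_mod_cast hu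
      have h4 : (1 : ℝ) ≤ E := by exact_mod_cast hE
      have h5 : (0 : ℝ) ≤ n := Nat.cast_nonneg n
      nlinarith
    refine (Real.exp_le_exp.2 h1).trans ?_
    have h2 : Real.exp (1 / 2) ^ 2 = Real.exp 1 := by rw [← Real.exp_nat_mul]; norm_num
    have h3 := Real.exp_one_lt_d9
    nlinarith [Real.exp_pos (1 / 2)]
  have hF1 : 1 ≤ s * total K x := by
    obtain ⟨i, hi⟩ := hmax.attained
    calc (1 : ℝ) ≤ s * rowSum (scaling K x) i := by
          rw [hexp]
          exact Real.one_le_exp (div_nonneg (by linarith) hu0.le)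
      _ ≤ s * total K x := by
          gcongr
          exact rowSum_le_total hs.nonneg x i
  refine Runs.cons (sumLines_spec hs (hc.of_agree fun r hr => s1 r (by omega))
    (hI.of_agree fun a _ => by rw [m1]) (X := X) (by rw [m1]; exact hX) hXH rfl habs hF2) ?_
  rintro σ₂ ⟨hsums, s2, m2⟩
  have htest := hsums.test hn hE hu hs0 hF1
  set S := σ₂.reg 14 with hS
  set D := σ₂.reg 15 with hD
  have hlow : ∀ r < 12, σ₂.reg r = σ.reg r := fun r hr => by rw [s2 r hr, s1 r hr]
  have bS := abs_le.1 hsums.abs_S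
  have bD : |D| ≤ 4 * H := hsums.abs_D.trans (by omega)
  have bED : |E * D| ≤ 4 * (E * H) := by
    rw [abs_mul, abs_of_pos (by omega)]; nlinarith
  have bED' := abs_le.1 bED
  have hEH : H ≤ E * H := by nlinarith
  have hword := hp.word
  refine Runs.cons (Runs.op_eq (v := E * D) (by
    rw [hlow 2 (by norm_num), hc.r2]; simp [Op.eval, hD, mul_comm])
    (by rw [abs_le]; constructor <;> omega)) ?_
  rintro _ rfl
  refine Runs.cons (Runs.op_eq (v := 2 * (E * D)) (by
    simp [reg_setReg, Op.eval]; ring) (by rw [abs_le]; constructor <;> omega)) ?_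
  rintro _ rfl
  refine Runs.cons (Runs.op_eq (v := S - 2 * (E * D)) (by
    simp [reg_setReg, Op.eval, hS]) (by rw [abs_le]; constructor <;> omega)) ?_
  rintro _ rfl
  refine Runs.cons (Runs.op_eq (v := S - 2 * (E * D) + 1) (by
    simp [reg_setReg, Op.eval, hlow 9 (by norm_num), hc.r9])
    (by rw [abs_le]; constructor <;> omega)) ?_
  rintro _ rfl
  refine Runs.branch (fun hlt => ?_) fun hlt => ?_
  · simp only [reg_setReg, if_true] at hlt
    refine Runs.const (by simp; omega) ⟨Or.inl ⟨by simp [reg_setReg], htest.1 (by omega)⟩, ?_, ?_⟩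
    · intro r hr hr6
      simp only [reg_setReg]
      rw [if_neg hr6, if_neg (by omega), if_neg (by omega), if_neg (by omega), if_neg (by omega),
        hlow r hr]
    · rw [← m1, ← m2]; rfl
  · simp only [reg_setReg, if_true] at hlt
    refine Runs.const (by simp; omega) ⟨Or.inr ⟨?_, htest.2 (by omega)⟩, ?_, ?_⟩
    · simp [reg_setReg, hlow 6 (by norm_num)]
    · intro r hr hr6
      simp only [reg_setReg]
      rw [if_neg (by omega), if_neg (by omega), if_neg (by omega), if_neg (by omega),
        if_neg (by omega), hlow r hr]
    · rw [← m1, ← m2]; rfl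

end Osborne

namespace Osborne

/-! ### The program: rounds and preprocessing -/

/-- One round: updates the coordinates of the block in register `5`, and then, if this is block
`0`, performs the stopping test. -/
def roundProg (f : InputFormat) : Cmd :=
  prog [.load 11 6 5 8,
    .loop 11 (prog [.op .sub 11 11 9, .load 16 7 5 11, updateCoord f]),
    .branch 5 (.const 28 0) (check f)]

/-- Preprocessing: the scale of the fixed-point numbers is `3000 n ^ 2 ⌈1 / ε⌉`. -/
def initProg : Cmd :=
  prog [.const 9 1, .op .mul 7 0 0, .op .mul 7 7 2, .const 10 3000, .op .mul 7 7 10,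
    .op .add 10 0 0]

/-- The implementation of Osborne's algorithm for the given input format. -/
def implementation (f : InputFormat) : Implementation where
  init := initProg
  step := roundProg f

variable {f : InputFormat} {b n p : ℕ} {u q E H : ℤ} {σ : State} {K : Matrix (Fin n) (Fin n) ℝ}
  {z : Matrix (Fin n) (Fin n) ℤ} {X : Fin n → ℤ} {k : Fin n} {color : Fin n → Fin p} {c : ℝ}
  {l : Fin p} {w : Fin n → ℝ} {M : ℝ}

lemma Consts.of_agree_of_ne {σ' : State} (h : Consts n u q E σ)
    (h' : ∀ r < 11, r ≠ 5 → r ≠ 6 → σ'.reg r = σ.reg r) : Consts n u q E σ' := by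
  constructor <;> rw [h' _ (by norm_num) (by norm_num) (by norm_num)]
  exacts [h.r0, h.r2, h.r4, h.r7, h.r8, h.r9, h.r10]

/-- Points in a box around a minimizer give numbers that fit into the words. -/
lemma two_mul_abs_le_of_box (hu : 1 ≤ u) (hw : ∀ i, |w i| ≤ M) (hM : 4 * (u * M) ≤ H)
    (hbox : ∀ i, |fixedPoint u X i - w i| ≤ M) (i : Fin n) : 2 * |X i| ≤ H := by
  have hu0 : (0 : ℝ) < u := by exact_mod_cast hu
  have h1 : |(X i : ℝ) / u| ≤ 2 * M := by
    have h2 := abs_add_le (fixedPoint u X i - w i) (w i)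
    rw [sub_add_cancel] at h2
    change |fixedPoint u X i| ≤ _
    linarith [hbox i, hw i]
  rw [abs_div, abs_of_pos hu0, div_le_iff₀ hu0] at h1
  have : 2 * |(X i : ℝ)| ≤ H := by linarith
  exact_mod_cast this

/-- The number of operations of the stopping test. -/
noncomputable def checkCost (K : Matrix (Fin n) (Fin n) ℝ) : ℕ := 80 * nnz K + 23 * n + 16

/-- The number of nonzero entries in row and column `k`. -/
noncomputable def lineLength (K : Matrix (Fin n) (Fin n) ℝ) (k : Fin n) : ℕ :=
  (rowSupp K k).length + (colSupp K k).length

/-- A bound on the number of operations of a round. -/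
noncomputable def roundCost (K : Matrix (Fin n) (Fin n) ℝ) (color : Fin n → Fin p) (l : Fin p) :
    ℕ :=
  ((block color l).map fun k => 20 * lineLength K k + 23).sum + 4 +
    if (l : ℕ) = 0 then checkCost K else 0

/-- The loop visits the block from its last element to its first, hence the reversed list. -/
lemma round_spec (hs : Setup f b K z u q E H c) (hu : 30 * (n * E) ≤ u) (hc : Consts n u q E σ)
    (hI : InputAt K z color σ) (hX : ∀ i : Fin n, σ.mem 8 (i : ℕ) 0 = X i)
    (hmin : ∀ k, exactStep K w k = 0) (hw : ∀ i, |w i| ≤ M) (hM : 4 * (u * M) ≤ H)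
    (hbox : ∀ i, |fixedPoint u X i - w i| ≤ M) (h5 : σ.reg 5 = (l : ℕ)) :
    Runs b (roundProg f) σ (roundCost K color l) fun σ' =>
      ∃ X' : Fin n → ℤ, (∀ i : Fin n, σ'.mem 8 (i : ℕ) 0 = X' i) ∧
        (∀ i, |fixedPoint u X' i - w i| ≤ M) ∧
        Sweep K (3 * n / u) (block color l).reverse (fixedPoint u X) (fixedPoint u X') ∧
        Consts n u q E σ' ∧ InputAt K z color σ' ∧
        ((l : ℕ) = 0 →
          ((σ'.reg 6 = 1 ∧ E * imbalance K (fixedPoint u X') ≤ total K (fixedPoint u X')) ∨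
          (σ'.reg 6 = σ.reg 6 ∧
            total K (fixedPoint u X') ≤ 4 * (E * imbalance K (fixedPoint u X'))))) ∧
        ((l : ℕ) ≠ 0 → σ'.reg 6 = σ.reg 6) := by
  have hp := hs.params
  have hW := hp.le_word
  have hH := hp.H_pos
  have hn := hp.n_pos
  have hnH := hp.n_le
  set L := block color l with hL
  have hLn : L.length ≤ n := by
    have := (nodup_block color l).length_le_card
    simpa using this
  let I : ℕ → State → Prop := fun m τ => τ.reg 11 = m ∧ m ≤ L.length ∧
    (∃ X' : Fin n → ℤ, (∀ i : Fin n, τ.mem 8 (i : ℕ) 0 = X' i) ∧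
      (∀ i, |fixedPoint u X' i - w i| ≤ M) ∧
      Sweep K (3 * n / u) (L.drop m).reverse (fixedPoint u X) (fixedPoint u X')) ∧
    (∀ r < 11, τ.reg r = σ.reg r) ∧ (∀ a < 8, τ.mem a = σ.mem a)
  let g : Fin L.length → ℕ := fun m => 20 * lineLength K L[m]
  refine Runs.mono (T₁ := 1 + ((∑ m ∈ Finset.range L.length, (extend0 g m + 22 + 1) + 1)
    + ((if (l : ℕ) = 0 then checkCost K else 1) + 1))) ?_ ?_ (fun _ h => h)
  rotate_left
  · simp only [add_assoc]
    rw [sum_extend0]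
    have : ∑ i, g i = (L.map fun k => 20 * lineLength K k).sum :=
      Fin.sum_univ_fun_getElem L fun k => 20 * lineLength K k
    rw [this, roundCost, ← hL, List.sum_map_add, List.map_const', List.sum_replicate, smul_eq_mul]
    split_ifs <;> omega
  refine Runs.cons (R := fun σ' => σ' = σ.setReg 11 L.length) (Runs.load ?_) ?_
  · rw [h5, hc.r8, hI.size]
  rintro _ rfl
  refine Runs.cons (R := I 0) (Runs.loop (t := fun m => extend0 g m + 22) (I := I)
    (fun c τ h => h.1) L.length ?_ ?_) ?_
  · intro m hm τ hτ
    obtain ⟨i1, i2, ⟨X', i3, i4, i5⟩, i6, i7⟩ := hτ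
    rw [show extend0 g m = 20 * lineLength K L[m] by simp [extend0, hm, g]]
    refine Runs.mono (T₁ := 1 + (1 + (20 * lineLength K L[m] + 20))) ?_ (by omega) (fun _ h => h)
    refine Runs.cons (Runs.op_eq (v := m) (by
      rw [i1, i6 9 (by norm_num), hc.r9]; simp [Op.eval])
      (by rw [abs_of_nonneg (by positivity)]; omega)) ?_
    rintro _ rfl
    have hmem : (τ.setReg 11 m).mem 7 ((τ.setReg 11 m).reg 5) ((τ.setReg 11 m).reg 11)
        = ((L[m] : Fin n) : ℕ) := by
      simp only [mem_setReg, reg_setReg, if_true, if_neg (by norm_num : ¬ (5 = 11))]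
      rw [i6 5 (by norm_num), h5, i7 7 (by norm_num), hI.elem l m hm]
    refine Runs.cons (R := fun σ' => σ' = (τ.setReg 11 m).setReg 16 ((L[m] : Fin n) : ℕ))
      (Runs.load (by rw [hmem])) ?_
    rintro _ rfl
    have hlow : ∀ r < 11,
        ((τ.setReg 11 m).setReg 16 ((L[m] : Fin n) : ℕ)).reg r = σ.reg r := fun r hr => by
      simp only [reg_setReg]; rw [if_neg (by omega), if_neg (by omega), i6 r hr]
    refine (updateCoord_spec hs (hc.of_agree hlow) (hI.of_agree fun a ha => i7 a ha)
      (X := X') i3 (two_mul_abs_le_of_box hp.u_pos hw hM i4) (k := L[m])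
      (by simp [reg_setReg])).mono le_rfl ?_
    rintro τ₁ ⟨X'', j1, j2, j3, j4⟩
    refine ⟨?_, hm.le, ⟨X'', j1, ?_, ?_⟩, fun r hr => ?_, fun a ha => ?_⟩
    · rw [j3 11 (by norm_num)]; simp [reg_setReg]
    · exact j2.abs_sub_le hs.nonneg hs.pos (hmin _) i4
    · rw [List.drop_eq_getElem_cons hm, List.reverse_cons]
      exact i5.append (.cons j2 (.nil _))
    · rw [j3 r (by omega), hlow r hr]
    · rw [j4 a ha]; exact i7 a ha
  · refine ⟨by simp [reg_setReg], le_rfl, ⟨X, hX, hbox, ?_⟩, fun r hr => ?_, fun a _ => rfl⟩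
    · rw [List.drop_length]; exact .nil _
    · simp only [reg_setReg]; rw [if_neg (by omega)]
  rintro τ ⟨-, -, ⟨X', i3, i4, i5⟩, i6, i7⟩
  have hτc : Consts n u q E τ := hc.of_agree i6
  have hτI : InputAt K z color τ := hI.of_agree i7
  have h5' : τ.reg 5 = (l : ℕ) := by rw [i6 5 (by norm_num), h5]
  rw [List.drop_zero] at i5
  refine Runs.branch (fun hlt => ?_) fun hlt => ?_
  · rw [h5'] at hlt
    have hl : (l : ℕ) ≠ 0 := by omega
    rw [if_neg hl]
    refine Runs.const (by simp; omega) ⟨X', i3, i4, i5, ?_, hτI.of_agree fun a _ => rfl,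
      fun h => absurd h hl, fun _ => ?_⟩
    · refine hτc.of_agree fun r hr => ?_
      rw [reg_setReg, if_neg (by omega)]
    · rw [reg_setReg, if_neg (by omega), i6 6 (by norm_num)]
  · rw [h5'] at hlt
    have hl : (l : ℕ) = 0 := by omega
    rw [if_pos hl]
    refine (check_spec hs hu hτc hτI i3 (two_mul_abs_le_of_box hp.u_pos hw hM i4)).mono
      le_rfl ?_
    rintro τ₁ ⟨j1, j2, j3⟩
    refine ⟨X', by rw [j3]; exact i3, i4, i5, hτc.of_agree_of_ne fun r hr _ h6 => j2 r (by omega) h6,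
      hτI.of_agree fun a _ => by rw [j3], fun _ => ?_, fun h => absurd hl h⟩
    rwa [i6 6 (by norm_num)] at j1

lemma init_spec (hp : Params b n u q E H) (hu : u = 3000 * (n * n * E)) (h0 : σ.reg 0 = n)
    (h2 : σ.reg 2 = E) (h4 : σ.reg 4 = q) (h8 : σ.reg 8 = 0) :
    Runs b initProg σ 6 fun σ' => Consts n u q E σ' ∧ σ'.reg 6 = σ.reg 6 ∧ σ'.mem = σ.mem := by
  have hW := hp.le_word
  have hH := hp.H_pos
  have hn : (1 : ℤ) ≤ n := by exact_mod_cast hp.n_pos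
  have hE := hp.E_pos
  have hnH := hp.n_le
  have huH := hp.u_le
  have hnn : 1 ≤ (n : ℤ) * n := by nlinarith
  have hnE : (n : ℤ) * n ≤ n * n * E := by nlinarith
  refine Runs.mono (T₁ := 1 + (1 + (1 + (1 + (1 + 1))))) ?_ le_rfl (fun _ h => h)
  refine Runs.cons (Runs.const (Q := fun σ' => σ' = σ.setReg 9 1)
    (by rw [abs_of_nonneg (by norm_num)]; omega) rfl) ?_
  rintro _ rfl
  refine Runs.cons (Runs.op_eq (v := n * n) (by simp [reg_setReg, Op.eval, h0])
    (by rw [abs_of_nonneg (by omega)]; omega)) ?_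
  rintro _ rfl
  refine Runs.cons (Runs.op_eq (v := n * n * E) (by simp [reg_setReg, Op.eval, h2])
    (by rw [abs_of_nonneg (by omega)]; omega)) ?_
  rintro _ rfl
  refine Runs.cons (Runs.const (Q := fun σ' => σ' =
    (((σ.setReg 9 1).setReg 7 (n * n)).setReg 7 (n * n * E)).setReg 10 3000)
    (by rw [abs_of_nonneg (by norm_num)]; omega) rfl) ?_
  rintro _ rfl
  refine Runs.cons (Runs.op_eq (v := u) (by simp [reg_setReg, Op.eval, hu]; ring)
    (by rw [abs_of_nonneg (by omega)]; omega)) ?_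
  rintro _ rfl
  refine (Runs.op_eq (v := 2 * n) (by simp [reg_setReg, Op.eval, h0]; ring)
    (by rw [abs_of_nonneg (by omega)]; omega)).mono le_rfl ?_
  rintro _ rfl
  refine ⟨?_, by simp [reg_setReg], rfl⟩
  constructor <;> simp [reg_setReg, h0, h2, h4, h8]

lemma table_apply {n : ℕ} (F : Fin n → List ℤ) (i : Fin n) {j : ℕ} (hj : j < (F i).length) :
    table n F ((i : ℕ) : ℤ) (j : ℤ) = (F i)[j] := by
  have h : 0 ≤ ((i : ℕ) : ℤ) ∧ ((i : ℕ) : ℤ).toNat < n ∧ 0 ≤ (j : ℤ) :=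
    ⟨by positivity, by simp, by positivity⟩
  rw [table, dif_pos h]
  simp [hj]

lemma bind_pure_val {n : ℕ} (l : List (Fin n)) :
    (do let a ← l; pure (a : ℕ) : List ℕ) = l.map Fin.val := by
  induction l with
  | nil => rfl
  | cons a l ih => simpa using ih

lemma inputAt_inputState {ε : ℝ} (hp : Params b n u q E H) (hK : ∀ i j, 0 < K i j → |z i j * u| ≤ H) :
    InputAt K z color (inputState b K ε color z q) := by
  have hW := hp.le_word
  have hH := hp.H_pos
  have hnH := hp.n_le
  have hz : ∀ i j, 0 < K i j → |z i j| ≤ 2 ^ b - 1 := by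
    intro i j h
    have h1 := hK i j h
    rw [abs_mul, abs_of_pos (by have := hp.u_pos; omega : 0 < u)] at h1
    have h2 := abs_nonneg (z i j)
    have := hp.u_pos
    nlinarith
  have hnat : ∀ a : ℕ, a ≤ n → |(a : ℤ)| ≤ 2 ^ b - 1 := fun a ha => by
    rw [abs_of_nonneg (by positivity)]; omega
  have hrow : ∀ k, ∀ i ∈ rowSupp K k, 0 < K k i := fun k i hi => by simpa [rowSupp] using hi
  have hcol : ∀ k, ∀ i ∈ colSupp K k, 0 < K i k := fun k i hi => by simpa [colSupp] using hi
  have hlen : ∀ l, (block color l).length ≤ n := fun l => by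
    simpa using (nodup_block color l).length_le_card
  constructor
  · intro k
    constructor
    · have h := table_apply (fun k => [((rowSupp K k).length : ℤ)]) k (j := 0) (by simp)
      simp only [inputState]
      rw [Nat.cast_zero] at h
      rw [h]
      exact clamp_eq (hnat _ (length_rowSupp_le k))
    · intro j hj
      simp only [inputState, zero_add, bind_pure_val, List.map_map]
      rw [table_apply _ k (by simpa using hj), List.getElem_map]
      exact clamp_eq (hnat _ (Fin.is_lt _).le)
    · intro j hj
      simp only [inputState, zero_add]
      rw [table_apply _ k (by simpa using hj), List.getElem_map]
      exact clamp_eq (hz _ _ (hrow k _ (List.getElem_mem hj)))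
  · intro k
    constructor
    · have h := table_apply (fun k => [((colSupp K k).length : ℤ)]) k (j := 0) (by simp)
      simp only [inputState]
      rw [Nat.cast_zero] at h
      rw [h]
      exact clamp_eq (hnat _ (length_colSupp_le k))
    · intro j hj
      simp only [inputState, Nat.reduceAdd, bind_pure_val, List.map_map]
      rw [table_apply _ k (by simpa using hj), List.getElem_map]
      exact clamp_eq (hnat _ (Fin.is_lt _).le)
    · intro j hj
      simp only [inputState, Nat.reduceAdd]
      rw [table_apply _ k (by simpa using hj), List.getElem_map]
      exact clamp_eq (hz _ _ (hcol k _ (List.getElem_mem hj)))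
  · intro l
    have h := table_apply (fun l => [((block color l).length : ℤ)]) l (j := 0) (by simp)
    simp only [inputState]
    rw [Nat.cast_zero] at h
    rw [h]
    exact clamp_eq (hnat _ (hlen l))
  · intro l j hj
    simp only [inputState, bind_pure_val, List.map_map]
    rw [table_apply _ l (by simpa using hj), List.getElem_map]
    exact clamp_eq (hnat _ (Fin.is_lt _).le)

end Osborne

namespace Osborne

/-! ### Runs of the implementation -/

variable {f : InputFormat} {b n p : ℕ} {u q E H : ℤ} {σ : State} {K : Matrix (Fin n) (Fin n) ℝ}
  {z : Matrix (Fin n) (Fin n) ℤ} {color : Fin n → Fin p} {c : ℝ} {w : Fin n → ℝ} {M ε η : ℝ}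

/-- The Osborne update of a coordinate depends only on its neighbors and on itself. -/
lemma osborneUpdate_congr (hK : ∀ i j, 0 ≤ K i j) {x y : Fin n → ℝ} {k : Fin n} (hk : y k = x k)
    (h : ∀ i, 0 < K k i ∨ 0 < K i k → y i = x i) : osborneUpdate K y k = osborneUpdate K x k := by
  have h1 : rowSum (scaling K y) k = rowSum (scaling K x) k := by
    refine Finset.sum_congr rfl fun i _ => ?_
    rcases eq_or_lt_of_le (hK k i) with h0 | h0
    · simp [scaling, ← h0]
    · simp [scaling, hk, h i (Or.inl h0)]
  have h2 : colSum (scaling K y) k = colSum (scaling K x) k := by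
    refine Finset.sum_congr rfl fun i _ => ?_
    rcases eq_or_lt_of_le (hK i k) with h0 | h0
    · simp [scaling, ← h0]
    · simp [scaling, hk, h i (Or.inr h0)]
  rw [osborneUpdate, osborneUpdate, h1, h2, hk]

/-- On a block without edges, a sequential sweep performs all updates of the block as if they were
simultaneous. -/
lemma Sweep.abs_sub_osborneUpdate_le (hK : ∀ i j, 0 ≤ K i j) {ks : List (Fin n)} {x y : Fin n → ℝ}
    (h : Sweep K η ks x y) (hnd : ks.Nodup)
    (hind : ∀ i ∈ ks, ∀ j ∈ ks, i ≠ j → ¬ 0 < K i j) :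
    (∀ k ∉ ks, y k = x k) ∧ ∀ k ∈ ks, |y k - osborneUpdate K x k| ≤ η := by
  induction h with
  | nil => simp
  | @cons k ks x x' y hd _ ih =>
    obtain ⟨hk, hnd'⟩ := List.nodup_cons.1 hnd
    obtain ⟨ih1, ih2⟩ := ih hnd' fun i hi j hj =>
      hind i (List.mem_cons_of_mem _ hi) j (List.mem_cons_of_mem _ hj)
    refine ⟨fun j hj => ?_, fun j hj => ?_⟩
    · rw [List.mem_cons, not_or] at hj
      rw [ih1 j hj.2, hd.apply_ne hj.1]
    · rcases List.mem_cons.1 hj with rfl | hj'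
      · obtain ⟨s, rfl, -, hs⟩ := hd
        rw [ih1 j hk, Function.update_self]
        convert hs using 2
        rw [osborneUpdate, exactStep]
        ring
      · have hne : j ≠ k := fun h => hk (h ▸ hj')
        rw [← osborneUpdate_congr hK (hd.apply_ne hne) fun i hi => hd.apply_ne ?_]
        · exact ih2 j hj'
        · rintro rfl
          rcases hi with hi | hi
          · exact hind j hj i List.mem_cons_self hne hi
          · exact hind i List.mem_cons_self j hj hne.symm hi

lemma Variant.IsBlocks.color_ne {v : Variant} (h : v.IsBlocks K color) {i j : Fin n} (hij : i ≠ j)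
    (hK : 0 < K i j) : color i ≠ color j := by
  have key : (∀ k, (color k : ℕ) = (k : ℕ)) → color i ≠ color j := fun h he =>
    hij (Fin.ext (by rw [← h i, ← h j, he]))
  cases v with
  | random => exact key h.2
  | cyclic => exact key h.2
  | randomBlock => exact h.2 i j hij hK
  | cyclicBlock => exact h.2 i j hij hK

lemma Variant.IsBlocks.le {v : Variant} (h : v.IsBlocks K color) : p ≤ n := by
  have key : Function.Surjective color → p ≤ n := fun h => by
    simpa using Fintype.card_le_of_surjective color h
  cases v with
  | random => exact h.1.le
  | cyclic => exact h.1.le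
  | randomBlock => exact key h.1
  | cyclicBlock => exact key h.1

lemma Variant.one_le_slowdown (v : Variant) (hp : 1 ≤ p) : 1 ≤ v.slowdown p := by
  have key : 1 ≤ √(p : ℝ) := Real.one_le_sqrt.2 (by exact_mod_cast hp)
  cases v
  exacts [le_rfl, key, le_rfl, key]

lemma iterate_eq_fixedPoint (h : σ.reg 7 = u) :
    σ.iterate n = fixedPoint u fun i => σ.mem 8 (i : ℕ) 0 := by
  ext i
  rw [State.iterate, fixedPoint, ← h]

/-- The invariant of the rounds. -/
structure RoundInv (K : Matrix (Fin n) (Fin n) ℝ) (z : Matrix (Fin n) (Fin n) ℤ)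
    (color : Fin n → Fin p) (u q E : ℤ) (w : Fin n → ℝ) (M : ℝ) (σ : State) : Prop where
  consts : Consts n u q E σ
  input : InputAt K z color σ
  box : ∀ i, |σ.iterate n i - w i| ≤ M
  total_le : total K (σ.iterate n) ≤ total K 0
  done : σ.reg 6 = 0 ∨ E * imbalance K (σ.iterate n) ≤ total K (σ.iterate n)

/-- From a state that satisfies the invariant and has not stopped, a round can be executed. -/
lemma exists_round (hs : Setup f b K z u q E H c) (hu : 30 * (n * E) ≤ u)
    (hmin : ∀ k, exactStep K w k = 0) (hw : ∀ i, |w i| ≤ M) (hM : 4 * (u * M) ≤ H)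
    (hσ : RoundInv K z color u q E w M σ) (h6 : σ.reg 6 = 0) (l : Fin p) :
    ∃ (σ' : State) (t : ℕ), Exec b (roundProg f) (σ.setReg selReg ((l : ℕ) : ℤ)) t σ' ∧
      t ≤ roundCost K color l ∧ RoundInv K z color u q E w M σ' ∧
      Sweep K (3 * n / u) (block color l).reverse (σ.iterate n) (σ'.iterate n) ∧
      ((l : ℕ) = 0 → σ'.reg 6 = 0 →
        total K (σ'.iterate n) ≤ 4 * (E * imbalance K (σ'.iterate n))) := by
  have hit := iterate_eq_fixedPoint (n := n) hσ.consts.r7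
  have hreg : ∀ r ≠ 5, (σ.setReg selReg ((l : ℕ) : ℤ)).reg r = σ.reg r := fun r hr => by
    rw [reg_setReg, if_neg hr]
  obtain ⟨t, σ', hex, ht, X', hX', hbox', hsweep, hc', hI', h1, h2⟩ :=
    round_spec (σ := σ.setReg selReg ((l : ℕ) : ℤ)) hs hu
    (hσ.consts.of_agree_of_ne fun r _ hr _ => hreg r hr)
    (hσ.input.of_agree fun _ _ => rfl) (X := fun i => σ.mem 8 (i : ℕ) 0) (fun _ => rfl) hmin hw hM
    (by rw [← hit]; exact hσ.box) (l := l) (by simp [reg_setReg])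
  have hit' : σ'.iterate n = fixedPoint u X' := by
    rw [iterate_eq_fixedPoint hc'.r7]
    congr 1
    ext i
    exact hX' i
  rw [hreg 6 (by norm_num), h6] at h1 h2
  rw [← hit, ← hit'] at hsweep
  rw [← hit'] at hbox' h1
  refine ⟨σ', t, hex, ht, ⟨hc', hI', hbox', ?_, ?_⟩, hsweep, fun hl h6' => ?_⟩
  · exact (hsweep.total_le hs.nonneg hs.pos).trans hσ.total_le
  · by_cases hl : (l : ℕ) = 0
    · rcases h1 hl with h | h
      · exact Or.inr h.2
      · exact Or.inl h.1
    · exact Or.inl (h2 hl)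
  · rcases h1 hl with h | h
    · rw [h6'] at h; norm_num at h
    · exact h.2

instance : Nonempty State := ⟨⟨fun _ => 0, fun _ _ _ => 0⟩⟩

/-- The number of operations of a cycle of rounds, one for each block, is of order `m`. -/
lemma sum_roundCost_le (hpn : p ≤ n) (hn : n ≤ nnz K) (hn1 : 1 ≤ n) :
    ∑ l, (roundCost K color l + 2) ≤ 200 * nnz K := by
  have h1 : ∑ l, ((block color l).map fun k => 20 * lineLength K k + 23).sum
      = 40 * nnz K + 23 * n := by
    rw [sum_sum_block color fun k => 20 * lineLength K k + 23]
    simp only [lineLength, Finset.sum_add_distrib, ← Finset.mul_sum, sum_length_rowSupp,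
      sum_length_colSupp]
    simp
    omega
  have h2 : (∑ l : Fin p, if (l : ℕ) = 0 then checkCost K else 0) ≤ checkCost K := by
    rcases Nat.eq_zero_or_pos p with rfl | hp
    · simp
    · rw [Finset.sum_eq_single (⟨0, hp⟩ : Fin p)]
      · simp
      · intro l _ hl
        exact if_neg fun h => hl (Fin.ext h)
      · simp
  simp only [roundCost, Finset.sum_add_distrib, h1]
  simp only [Finset.sum_const, Finset.card_univ, Fintype.card_fin, smul_eq_mul]
  unfold checkCost at *
  omega

/-- Correctness and running time on words that are large enough for the numbers that occur. -/
theorem implementation_spec (v : Variant) (hn : 2 ≤ n) (hK : K.IsIrreducible) (hε : 0 < ε)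
    (hε1 : ε ≤ 1) (hv : v.IsBlocks K color) (hs : Setup f b K z u q E H c) (hE : E = ⌈1 / ε⌉)
    (hu : u = 3000 * (n * n * E)) (hq : q ≤ H) (hM : 4 * (u * spread K) ≤ H)
    {Ω : Type*} [MeasurableSpace Ω] {μ : Measure Ω} [IsProbabilityMeasure μ] {s : ℕ → Ω → Fin p}
    (hsel : v.IsSelection μ s) :
    ∃ T R : Ω → ℕ, Measurable T ∧ Measurable R ∧
      (∀ᵐ ω ∂μ, ∃ σ : ℕ → State,
        IsRun b (implementation f) (inputState b K ε color z q) (fun t => s t ω) (R ω) (T ω) σ ∧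
        (∀ t ≤ R ω, 0 < (σ t).reg scaleReg) ∧
        IsOsborneTrace K ε color (fun t => s t ω) (R ω) (fun t => (σ t).iterate n) ∧
        IsApproxBalancing K ε ((σ (R ω)).iterate n)) ∧
      Guarantee μ T (2 * 10 ^ 9 * v.workBound p K ε) ∧
      Guarantee μ R (2 * 10 ^ 9 * v.roundBound p K ε) := by
  have hp := hs.params
  have hW := hp.le_word
  have hH := hp.H_pos
  have hnH := hp.n_le
  have huH := hp.u_le
  have hP := hs.pos
  have hn0 : (0 : ℝ) < n := by exact_mod_cast (by omega : 0 < n)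
  have hpn := hv.le
  have hp1 : 1 ≤ p := Nat.pos_of_ne_zero fun h => by
    subst h; exact (color ⟨0, by omega⟩).elim0
  have : NeZero p := ⟨by omega⟩
  have hp0 : (0 : ℝ) < p := by exact_mod_cast hp1
  have hm := le_nnz hn hK
  have hm0 : (1 : ℝ) ≤ nnz K := by exact_mod_cast (by omega : 1 ≤ nnz K)
  have hrate := half_le_rate hn hK hε hε1
  have hslow := v.one_le_slowdown hp1
  -- the accuracy
  have hEε : 1 / ε ≤ E := by rw [hE]; exact Int.le_ceil _
  have hEε' : (E : ℝ) ≤ 2 / ε := by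
    have h1 := (Int.ceil_lt_add_one (1 / ε)).le
    rw [← hE] at h1
    have h2 : 1 ≤ 1 / ε := by rw [le_div_iff₀ hε]; linarith
    have h3 : 2 / ε = 1 / ε + 1 / ε := by ring
    linarith
  have hE0 : (0 : ℝ) < E := lt_of_lt_of_le (by positivity) hEε
  have hE1 := hp.E_pos
  have hεE : 1 / (E : ℝ) ≤ ε := by
    rw [div_le_iff₀ hE0]
    rw [div_le_iff₀ hε] at hEε
    linarith
  have huE : 30 * (n * E) ≤ u := by
    have h1 : (1 : ℤ) ≤ n := by exact_mod_cast hp.n_pos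
    have h2 : n * E ≤ n * (n * E) := le_mul_of_one_le_left (by positivity) h1
    rw [hu, mul_assoc (n : ℤ)]
    have h3 : 0 ≤ n * E := by positivity
    omega
  have hη : (3 * n / u : ℝ) ≤ ε / (1000 * n) := by
    have e : (3 * n / u : ℝ) = 1 / E / (1000 * n) := by
      rw [hu]; push_cast; field_simp; norm_num
    rw [e]
    gcongr
  have hu0 : (0 : ℝ) < u := by exact_mod_cast (by have := hp.u_pos; omega : 0 < u)
  have hη0 : (0 : ℝ) ≤ 3 * n / u := by positivity
  have hηn : (3 * n / u : ℝ) ≤ ε / n := by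
    refine hη.trans ?_
    gcongr
    linarith
  -- preprocessing
  obtain ⟨w, hwM, hwmin⟩ := exists_minimizer hn hK
  have hmin := fun k => exactStep_eq_zero_of_min hs.nonneg hP hwmin k
  set σin := inputState b K ε color z q with hσin
  have hclamp : ∀ v : ℤ, 0 ≤ v → v ≤ H → clamp b v = v := fun v h1 h2 =>
    clamp_eq (by rw [abs_of_nonneg h1]; omega)
  have hEH : E ≤ H := by nlinarith [hp.word, hp.n_pos, (by positivity : 0 ≤ (n : ℤ))]
  have hin0 : σin.reg 0 = n := hclamp n (by positivity) (by omega)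
  have hin2 : σin.reg 2 = E := by
    rw [hE]; exact hclamp ⌈1 / ε⌉ (by omega) (by omega)
  obtain ⟨t₀, σ₀, hex₀, ht₀, hc₀, h6₀, hm₀⟩ := init_spec (σ := σin) hp hu hin0 hin2
    (hclamp q hp.q_pos.le hq) (hclamp 0 le_rfl (by omega))
  have hit₀ : σ₀.iterate n = 0 := by
    ext i
    have : σin.mem 8 (i : ℕ) 0 = 0 := hclamp 0 le_rfl (by omega)
    rw [State.iterate, hm₀, this]
    simp
  have h6in : σ₀.reg 6 = 0 := by
    rw [h6₀]; exact hclamp 0 le_rfl (by omega)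
  have hinv₀ : RoundInv K z color u q E w (spread K) σ₀ := by
    refine ⟨hc₀, ?_, fun i => ?_, by rw [hit₀], Or.inl h6in⟩
    · exact (inputAt_inputState hp fun i j h => (hs.entry i j h).le).of_agree
        fun a _ => by rw [hm₀]
    · rw [hit₀]; simpa using hwM i
  -- the rounds
  choose! step cost hexec hcost hinv hsweep hunb using
    fun (σ : State) (hσ : RoundInv K z color u q E w (spread K) σ) (h6 : σ.reg 6 = 0)
      (l : Fin p) => exists_round hs huE hmin hwM hM hσ h6 l
  let halt : State → Prop := fun σ => σ.reg 6 ≠ 0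
  have hnst : ∀ {σ : State}, ¬ halt σ → σ.reg 6 = 0 := fun h => not_not.1 h
  have hR : Rounds K ε (3 * n / u) color step halt (fun σ => σ.iterate n)
      (RoundInv K z color u q E w (spread K)) := by
    refine ⟨fun σ h h' l => hinv σ h (hnst h') l, fun σ h => h.total_le,
      fun σ h h' l => hsweep σ h (hnst h') l, fun σ h h' l hl h'' => ?_⟩
    have h1 := hunb σ h (hnst h') l hl (hnst h'')
    have h2 := imbalance_nonneg K ((step σ l).iterate n)
    have h3 : (E : ℝ) * imbalance K ((step σ l).iterate n)
        ≤ 2 / ε * imbalance K ((step σ l).iterate n) := by gcongr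
    have h4 : ε / 8 * total K ((step σ l).iterate n)
        ≤ ε / 8 * (4 * (2 / ε * imbalance K ((step σ l).iterate n))) := by
      gcongr; linarith
    have h5 : ε / 8 * (4 * (2 / ε * imbalance K ((step σ l).iterate n)))
        = imbalance K ((step σ l).iterate n) := by field_simp; norm_num
    linarith
  let R : Ω → ℕ := fun ω => stopTime step halt σ₀ fun i => s i ω
  let T : Ω → ℕ := fun ω =>
    t₀ + 1 + costTo step (fun σ l => cost σ l + 2) σ₀ (fun i => s i ω) (R ω)
  have hmeas : ∀ t, Measurable (s t) := by
    cases v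
    exacts [hsel.1, measurable_of_isCyclicSelection hsel, hsel.1,
      measurable_of_isCyclicSelection hsel]
  have hRcost : R = fun ω => 0 + costTo step (fun _ _ => 1) σ₀ (fun i => s i ω) (R ω) := by
    ext ω; simp [costTo]
  have hsumT : ∑ l, ((roundCost K color l + 2 : ℕ) : ℝ) ≤ 200 * nnz K := by
    exact_mod_cast sum_roundCost_le hpn hm (by omega)
  have hcT : ∀ σ, RoundInv K z color u q E w (spread K) σ → ¬ halt σ → ∀ l,
      ((cost σ l + 2 : ℕ) : ℝ) ≤ (roundCost K color l + 2 : ℕ) := fun σ h h' l => by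
    exact_mod_cast Nat.add_le_add_right (hcost σ h (hnst h') l) 2
  have hAT : ((t₀ + 1 : ℕ) : ℝ) ≤ 200 * nnz K := by
    exact_mod_cast (by omega : t₀ + 1 ≤ 200 * nnz K)
  have hBT : 10 ^ 7 * (200 * nnz K) * rate K ε ≤ 2 * 10 ^ 9 * v.workBound p K ε := by
    have h1 : (nnz K : ℝ) * rate K ε ≤ v.slowdown p * (nnz K * rate K ε) :=
      le_mul_of_one_le_left (by positivity) hslow
    unfold Variant.workBound
    linarith
  have hBR : 10 ^ 7 * p * rate K ε ≤ 2 * 10 ^ 9 * v.roundBound p K ε := by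
    have h1 : (p : ℝ) * rate K ε ≤ v.slowdown p * (p * rate K ε) :=
      le_mul_of_one_le_left (by positivity) hslow
    have h2 : 0 ≤ (p : ℝ) * rate K ε := by positivity
    unfold Variant.roundBound
    linarith
  have hmain : (∀ᵐ ω ∂μ, ∃ t, halt (path step σ₀ (fun i => s i ω) t)) ∧
      Guarantee μ T (2 * 10 ^ 9 * v.workBound p K ε) ∧
      Guarantee μ R (2 * 10 ^ 9 * v.roundBound p K ε) := by
    have hran : IsUniformSelection μ s → (∀ᵐ ω ∂μ, ∃ t, halt (path step σ₀ (fun i => s i ω) t)) ∧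
        Guarantee μ T (2 * 10 ^ 9 * v.workBound p K ε) ∧
        Guarantee μ R (2 * 10 ^ 9 * v.roundBound p K ε) := by
      intro h
      refine ⟨hR.random_ae_stop hn hK hε hε1 hη0 hη h hinv₀,
        hR.random_guarantee hn hK hε hε1 hη0 hη h hinv₀ hcT hsumT (by positivity) hAT hBT, ?_⟩
      rw [hRcost]
      exact hR.random_guarantee hn hK hε hε1 hη0 hη h hinv₀ (c := fun _ => 1) (S := p) (A := 0)
        (by simp) (by simp) hp0 (by simp) hBR
    have hcyc : IsCyclicSelection μ s → (∀ᵐ ω ∂μ, ∃ t, halt (path step σ₀ (fun i => s i ω) t)) ∧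
        Guarantee μ T (2 * 10 ^ 9 * v.workBound p K ε) ∧
        Guarantee μ R (2 * 10 ^ 9 * v.roundBound p K ε) := by
      intro h
      refine ⟨?_, hR.cyclic_guarantee hn hK hε hε1 hη0 hη h hinv₀ (fun _ => Nat.cast_nonneg _) hcT
        hsumT (by positivity) hAT hBT, ?_⟩
      · obtain ⟨τ, -, -, -, hsτ⟩ := h
        obtain ⟨N, hN⟩ := exists_nat_gt (2 * 10 ^ 5 * rate K ε)
        refine Filter.Eventually.of_forall fun ω => ?_
        obtain ⟨t, -, ht⟩ := hR.cyclic_exists_stop hn hK hε hε1 hη0 hη hinv₀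
          (a := fun i => s i ω) (τ := fun c => τ c ω) (fun c i => hsτ c ω i) hN
        exact ⟨t, ht⟩
      · rw [hRcost]
        exact hR.cyclic_guarantee hn hK hε hε1 hη0 hη h hinv₀ (c := fun _ => 1) (S := p) (A := 0)
          (by simp) (by simp) (by simp) hp0 (by simp) hBR
    cases v
    exacts [hran hsel, hcyc hsel, hran hsel, hcyc hsel]
  refine ⟨T, R, measurable_const.add (measurable_costTo_stopTime hmeas _),
    measurable_stopTime hmeas, ?_, hmain.2⟩
  filter_upwards [hmain.1] with ω hω
  set x := path step σ₀ (fun i => s i ω) with hx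
  have hlt : ∀ t < R ω, (x t).reg 6 = 0 := fun t ht => hnst (not_stop_of_lt_stopTime ht)
  have hI : ∀ t ≤ R ω, RoundInv K z color u q E w (spread K) (x t) := by
    intro t
    induction t with
    | zero => intro _; exact hinv₀
    | succ t ih => intro ht; exact hinv _ (ih (by omega)) (hlt t (by omega)) _
  have hhalt : (x (R ω)).reg 6 ≠ 0 := Nat.sInf_mem (s := {t | halt (x t)}) hω
  let ct : ℕ → ℕ
    | 0 => t₀
    | t + 1 => cost (x t) (s t ω)
  refine ⟨x, ⟨ct, hex₀, fun t ht =>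
    ⟨hlt t ht, hexec _ (hI t ht.le) (hlt t ht) _⟩, hhalt, ?_⟩, fun t ht => ?_, ⟨hit₀, ?_⟩, ?_⟩
  · rw [Finset.sum_range_succ', show ct 0 = t₀ from rfl]
    have hxt : ∀ t, path step σ₀ (fun i => s i ω) t = x t := fun _ => rfl
    simp only [ct, T, costTo, hxt, Finset.sum_add_distrib, Finset.sum_const, Finset.card_range, smul_eq_mul]
    omega
  · have := (hI t ht).consts.r7
    have := hp.u_pos
    change 0 < (x t).reg 7
    omega
  · intro t ht k
    have hsw := hsweep _ (hI t ht.le) (hlt t ht) (s t ω)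
    obtain ⟨h1, h2⟩ := hsw.abs_sub_osborneUpdate_le hs.nonneg
      (List.nodup_reverse.2 (nodup_block color _)) fun i hi j hj hij hKij => by
        rw [List.mem_reverse, mem_block] at hi hj
        exact hv.color_ne hij hKij (hi.trans hj.symm)
    refine ⟨fun h => ?_, fun h => ?_⟩
    · exact (h2 k (by rw [List.mem_reverse, mem_block]; exact h)).trans hηn
    · exact h1 k (by rw [List.mem_reverse, mem_block]; exact h)
  · have h1 := ((hI _ le_rfl).done).resolve_left hhalt
    have h2 : 0 < total K ((x (R ω)).iterate n) := total_pos hn hP _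
    have h3 := imbalance_nonneg K ((x (R ω)).iterate n)
    change imbalance K ((x (R ω)).iterate n) / total K ((x (R ω)).iterate n) ≤ ε
    rw [div_le_iff₀ h2]
    have h4 : 1 / ε * imbalance K ((x (R ω)).iterate n) ≤ total K ((x (R ω)).iterate n) :=
      le_trans (by gcongr) h1
    rwa [div_mul_eq_mul_div, one_mul, div_le_iff₀ hε, mul_comm] at h4

end Osborne

namespace Osborne

/-! ### The size of the words -/

variable {f : InputFormat} {n p : ℕ} {q : ℤ} {K : Matrix (Fin n) (Fin n) ℝ}
  {z : Matrix (Fin n) (Fin n) ℤ} {a ε : ℝ}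

lemma exists_entry_pos (hn : 2 ≤ n) (hK : K.IsIrreducible) : ∃ i j, 0 < K i j := by
  by_contra hcon
  push Not at hcon
  have h := (posSums_of_isIrreducible hn hK 0 ⟨0, by omega⟩).1
  refine h.not_ge (Finset.sum_nonpos fun j _ => ?_)
  have : K ⟨0, by omega⟩ j = 0 := le_antisymm (hcon _ _) (hK.nonneg _ _)
  simp [scaling, this]

lemma one_le_Kmax_div_Kmin (hn : 2 ≤ n) (hK : K.IsIrreducible) : 1 ≤ Kmax K / Kmin K := by
  obtain ⟨i, j, hij⟩ := exists_entry_pos hn hK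
  rw [le_div_iff₀ (Kmin_pos hn hK), one_mul]
  exact (Kmin_le hij).trans (le_Kmax K i j)

lemma log_cond_le (hn : 2 ≤ n) (hK : K.IsIrreducible) :
    Real.log (cond K) ≤ 2 * Real.log n + Real.log (Kmax K / Kmin K) := by
  have hn0 : (0 : ℝ) < n := by exact_mod_cast (by omega : 0 < n)
  have h1 := one_le_Kmax_div_Kmin hn hK
  have h2 : cond K ≤ n ^ 2 * (Kmax K / Kmin K) := by
    rw [cond, ← mul_div_assoc]
    refine div_le_div_of_nonneg_right ?_ (Kmin_pos hn hK).le
    calc ∑ i, ∑ j, K i j ≤ ∑ _i : Fin n, ∑ _j : Fin n, Kmax K :=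
          Finset.sum_le_sum fun i _ => Finset.sum_le_sum fun j _ => le_Kmax K i j
      _ = n ^ 2 * Kmax K := by simp; ring
  have h3 : 0 < cond K := by linarith [two_le_cond hn hK]
  have h4 := Real.log_le_log h3 h2
  rwa [Real.log_mul (by positivity) (by linarith), Real.log_pow, Nat.cast_ofNat] at h4

lemma InputFormat.log_div_le_bitBound (f : InputFormat) (hn : 2 ≤ n) (hK : K.IsIrreducible) :
    Real.log (n / ε) ≤ f.bitBound K ε := by
  cases f with
  | plain =>
    have := Real.log_nonneg (one_le_Kmax_div_Kmin hn hK)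
    change _ ≤ _ + _
    linarith
  | logarithmic =>
    have := Real.posLog_nonneg (x := Real.log (Kmax K / Kmin K))
    change _ ≤ _ + _
    linarith

lemma InputFormat.log_ratio_le_exp_bitBound (f : InputFormat) (hn : 2 ≤ n)
    (hε : 0 < ε) (hε1 : ε ≤ 1) : Real.log (Kmax K / Kmin K) ≤ Real.exp (f.bitBound K ε) := by
  have hnε : 0 ≤ Real.log (n / ε) := by
    refine Real.log_nonneg ?_
    have : (2 : ℝ) ≤ n := by exact_mod_cast hn
    rw [le_div_iff₀ hε]; linarith
  cases f with
  | plain =>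
    have h1 := Real.add_one_le_exp (Real.log (n / ε) + Real.log (Kmax K / Kmin K))
    change _ ≤ Real.exp (_ + _)
    linarith
  | logarithmic =>
    change _ ≤ Real.exp (_ + _)
    rcases le_or_gt (Real.log (Kmax K / Kmin K)) 0 with h | h
    · exact h.trans (Real.exp_pos _).le
    · calc Real.log (Kmax K / Kmin K) = Real.exp (Real.log (Real.log (Kmax K / Kmin K))) :=
            (Real.exp_log h).symm
        _ ≤ _ := by
            apply Real.exp_le_exp.2
            have : Real.log (Real.log (Kmax K / Kmin K))
              ≤ Real.posLog (Real.log (Kmax K / Kmin K)) := le_max_right _ _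
            linarith

lemma InputFormat.Encodes.exists_log_eq (hz : f.Encodes a K ε z q) : 0 < q ∧ ∃ c : ℝ, ∀ i j,
    0 < K i j → Real.log (K i j) = c + f.ell q (z i j) ∧ |f.ell q (z i j)| ≤ |(z i j : ℝ)| := by
  obtain ⟨-, -, h⟩ := hz
  cases f with
  | plain =>
    obtain ⟨rfl, c, hc, h⟩ := h
    refine ⟨one_pos, Real.log c, fun i j hij => ?_⟩
    have hz0 : (0 : ℝ) < z i j := by
      rw [h] at hij
      exact pos_of_mul_pos_right hij hc.le
    have hz1 : 1 ≤ z i j := by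
      have : 0 < z i j := by exact_mod_cast hz0
      omega
    have hz1' : (1 : ℝ) ≤ z i j := by exact_mod_cast hz1
    refine ⟨?_, ?_⟩
    · rw [h, Real.log_mul hc.ne' hz0.ne']; rfl
    · change |Real.log (z i j)| ≤ _
      rw [abs_of_nonneg (Real.log_nonneg hz1'), abs_of_pos hz0]
      linarith [Real.log_le_sub_one_of_pos hz0]
  | logarithmic =>
    obtain ⟨hq, c, h⟩ := h
    refine ⟨hq, c, fun i j hij => ⟨h i j hij, ?_⟩⟩
    change |(z i j : ℝ) / q| ≤ _
    have hq1 : (1 : ℝ) ≤ q := by exact_mod_cast hq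
    rw [abs_div, abs_of_pos (by linarith : (0 : ℝ) < q)]
    exact div_le_self (abs_nonneg _) hq1

/-- In terms of `y = e ^ L`, the numbers that occur are polynomially bounded. -/
lemma twenty_mul_le_pow_mul {y Y N u D E H : ℝ} (hy : 2 ≤ y) (hY : 1 ≤ Y) (hN : 2 ≤ N)
    (hNy : N ≤ y) (huy : u ≤ 6000 * y ^ 3) (hD : 0 ≤ D) (hDy : D ≤ 3 * y ^ 2)
    (hE : 0 ≤ E) (hEy : E ≤ 2 * y) (hH : H ≤ u * (2 * Y + N + 4 + 4 * D) + 1) :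
    20 * (E * H) + 1 ≤ y ^ 29 * Y := by
  have h1 : H ≤ 102001 * (y ^ 5 * Y) := by
    have h2 : 2 * Y + N + 4 + 4 * D ≤ 17 * (y ^ 2 * Y) := by
      have h3 : 4 ≤ y ^ 2 := by nlinarith
      have h4 : y ^ 2 ≤ y ^ 2 * Y := le_mul_of_one_le_right (by positivity) hY
      have h5 : 4 * Y ≤ y ^ 2 * Y := by gcongr
      have h6 : y ≤ y ^ 2 := by nlinarith
      linarith
    have h6 : u * (2 * Y + N + 4 + 4 * D) ≤ 6000 * y ^ 3 * (17 * (y ^ 2 * Y)) := by gcongr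
    have h7 : 1 ≤ y ^ 5 * Y := one_le_mul_of_one_le_of_one_le (one_le_pow₀ (by linarith)) hY
    linarith
  have h2 : 20 * (E * H) + 1 ≤ 2 ^ 23 * (y ^ 6 * Y) := by
    have h3 : E * H ≤ 2 * y * (102001 * (y ^ 5 * Y)) := by
      refine (mul_le_mul_of_nonneg_left h1 hE).trans ?_
      gcongr
    have h4 : 1 ≤ y ^ 6 * Y := one_le_mul_of_one_le_of_one_le (one_le_pow₀ (by linarith)) hY
    linarith
  calc 20 * (E * H) + 1 ≤ 2 ^ 23 * (y ^ 6 * Y) := h2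
    _ ≤ y ^ 23 * (y ^ 6 * Y) := by gcongr
    _ = y ^ 29 * Y := by ring

/-- The number of bits per unit of `InputFormat.bitBound`. -/
noncomputable def wordFactor (a : ℝ) : ℝ := (29 + |a|) / Real.log 2

/-- Words of the claimed size can hold all the numbers that occur. -/
lemma exists_setup (hn : 2 ≤ n) (hK : K.IsIrreducible) (hε : 0 < ε) (hε1 : ε ≤ 1)
    (hz : f.Encodes a K ε z q) {u E : ℤ} (hE : E = ⌈1 / ε⌉) (hu : u = 3000 * (n * n * E)) :
    ∃ (c : ℝ) (H : ℤ), Setup f ⌈wordFactor a * f.bitBound K ε⌉₊ K z u q E H c ∧ q ≤ H ∧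
      4 * (u * spread K) ≤ H := by
  obtain ⟨hq, c, hc⟩ := hz.exists_log_eq
  set L := f.bitBound K ε with hL
  set y := Real.exp L with hy
  set Y := Real.exp (|a| * L) with hY
  have hn2 : (2 : ℝ) ≤ n := by exact_mod_cast hn
  have hnε : (n : ℝ) / ε ≤ y := by
    rw [hy, ← Real.log_le_iff_le_exp (by positivity)]
    exact f.log_div_le_bitBound hn hK
  have hny : (n : ℝ) ≤ y := le_trans (by rw [le_div_iff₀ hε]; nlinarith) hnε
  have hεy : 1 / ε ≤ y := le_trans (by gcongr; linarith) hnε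
  have hy2 : 2 ≤ y := hn2.trans hny
  have hL0 : 0 ≤ L := by
    by_contra h
    have : y ≤ 1 := Real.exp_le_one_iff.2 (not_le.1 h).le
    linarith
  have hY1 : 1 ≤ Y := Real.one_le_exp (mul_nonneg (abs_nonneg a) hL0)
  have hEy : (E : ℝ) ≤ 2 * y := by
    have h1 := (Int.ceil_lt_add_one (1 / ε)).le
    rw [← hE] at h1
    linarith
  have hE1 : 1 ≤ E := by rw [hE]; exact Int.one_le_ceil_iff.2 (by positivity)
  have hE1' : (1 : ℝ) ≤ E := by exact_mod_cast hE1
  have huR : (u : ℝ) = 3000 * (n * n * E) := by rw [hu]; push_cast; ring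
  have huy : (u : ℝ) ≤ 6000 * y ^ 3 := by
    have h1 : (n : ℝ) * n * E ≤ y * y * (2 * y) := by gcongr
    rw [huR]
    nlinarith
  have hun : 3000 * (n : ℝ) ≤ u := by
    have h1 : (n : ℝ) * 1 * 1 ≤ n * n * E := by gcongr; linarith
    rw [huR]; linarith
  have hu0 : (0 : ℝ) < u := by linarith
  have hu1 : 1 ≤ u := by
    have : 0 < u := by exact_mod_cast hu0
    omega
  have hs0 := spread_pos hn hK
  have hspread : spread K ≤ 3 * y ^ 2 := by
    have h1 : (diam K : ℝ) ≤ y := le_trans (by exact_mod_cast diam_le hK) hny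
    have h2 : Real.log (cond K) ≤ 3 * y := by
      have h3 := log_cond_le hn hK
      have h4 := f.log_ratio_le_exp_bitBound (K := K) hn hε hε1
      have h5 := Real.log_le_sub_one_of_pos (by linarith : (0 : ℝ) < n)
      linarith
    have h3 := half_le_log_cond hn hK
    unfold spread
    have h4 : (diam K : ℝ) * Real.log (cond K) ≤ y * (3 * y) := by gcongr
    linarith
  have hpow : (2 : ℝ) ^ (a * L) ≤ Y := by
    rw [hY, Real.rpow_def_of_pos two_pos]
    apply Real.exp_le_exp.2
    have h1 : Real.log 2 ≤ 1 := by linarith [Real.log_two_lt_d9]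
    have h2 := Real.log_pos one_lt_two
    have h3 : a * L ≤ |a| * L := mul_le_mul_of_nonneg_right (le_abs_self a) hL0
    have h4 : 0 ≤ |a| * L := mul_nonneg (abs_nonneg a) hL0
    nlinarith
  have hzY : ∀ i j, |(z i j : ℝ)| ≤ Y := fun i j => (hz.1 i j).trans hpow
  have hqY : (q : ℝ) ≤ Y := hz.2.1.trans hpow
  set h : ℝ := u * (2 * Y + n + 4 + 4 * spread K) with hh
  set H : ℤ := ⌈h⌉ with hH
  have hhH : h ≤ H := Int.le_ceil _
  have hHh : (H : ℝ) ≤ h + 1 := (Int.ceil_lt_add_one h).le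
  have huY : u * Y * 2 ≤ H := by
    have : 0 ≤ u * (n + 4 + 4 * spread K) := by positivity
    linarith
  have huY0 : 0 < u * Y := by positivity
  have hell : ∀ i j, 0 < K i j → 2 * |u * f.ell q (z i j)| ≤ H := fun i j hij => by
    have h1 := ((hc i j hij).2).trans (hzY i j)
    have h2 : u * |f.ell q (z i j)| ≤ u * Y := by gcongr
    rw [abs_mul, abs_of_pos hu0]
    linarith
  refine ⟨c, H, ⟨⟨by omega, hu1, hq, hE1, ?_, ?_⟩, hK.nonneg, posSums_of_isIrreducible hn hK,
    fun i j hij => (hc i j hij).1, fun i j hij => ⟨?_, ?_⟩, hell⟩, ?_, ?_⟩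
  · have h1 : (u * n + 2 * n + 2 : ℝ) ≤ H := by
      have : 0 ≤ u * (4 * spread K) := by positivity
      linarith
    exact_mod_cast h1
  · have h3 := twenty_mul_le_pow_mul hy2 hY1 hn2 hny huy hs0.le hspread (by linarith) hEy
      (hHh.trans_eq (by rw [hh]))
    have h4 : y ^ 29 * Y = (2 : ℝ) ^ (wordFactor a * L) := by
      rw [hy, hY, ← Real.exp_nat_mul, ← Real.exp_add, Real.rpow_def_of_pos two_pos, wordFactor]
      congr 1
      have := (Real.log_pos one_lt_two).ne'
      field_simp
      push_cast
      ring
    have h5 : (2 : ℝ) ^ (wordFactor a * L) ≤ 2 ^ ⌈wordFactor a * L⌉₊ := by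
      rw [← Real.rpow_natCast]
      exact Real.rpow_le_rpow_of_exponent_le one_le_two (Nat.le_ceil _)
    have h6 : 20 * (E * H : ℝ) ≤ 2 ^ ⌈wordFactor a * L⌉₊ - 1 := by linarith
    exact_mod_cast h6
  · have h1 : |(z i j * u : ℝ)| ≤ H := by
      have : |(z i j : ℝ)| * u ≤ Y * u := by gcongr; exact hzY i j
      rw [abs_mul, abs_of_pos hu0]
      linarith
    exact_mod_cast h1
  · have h1 := hell i j hij
    have h2 := abs_nonneg (u * f.ell q (z i j))
    linarith
  · have h1 : (q : ℝ) ≤ H := by nlinarith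
    exact_mod_cast h1
  · have : 0 ≤ u * (2 * Y + n + 4) := by positivity
    linarith

end Osborne

theorem theorem8p1 (v : Variant) (f : InputFormat) :
    ∃ (I : Implementation) (C : ℝ), ∀ a : ℝ, ∃ B : ℝ,
      ∀ (n p : ℕ) (K : Matrix (Fin n) (Fin n) ℝ) (ε : ℝ) (color : Fin n → Fin p)
        (z : Matrix (Fin n) (Fin n) ℤ) (q : ℤ),
        2 ≤ n → K.IsIrreducible → 0 < ε → ε ≤ 1 → v.IsBlocks K color → f.Encodes a K ε z q →
        ∀ (Ω : Type*) [MeasurableSpace Ω] (μ : Measure Ω) [IsProbabilityMeasure μ]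
          (s : ℕ → Ω → Fin p), v.IsSelection μ s →
          ∃ T R : Ω → ℕ, Measurable T ∧ Measurable R ∧
            (∀ᵐ ω ∂μ, ∃ σ : ℕ → State,
              IsRun ⌈B * f.bitBound K ε⌉₊ I (inputState ⌈B * f.bitBound K ε⌉₊ K ε color z q)
                (fun t => s t ω) (R ω) (T ω) σ ∧
              (∀ t ≤ R ω, 0 < (σ t).reg scaleReg) ∧
              IsOsborneTrace K ε color (fun t => s t ω) (R ω) (fun t => (σ t).iterate n) ∧
              IsApproxBalancing K ε ((σ (R ω)).iterate n)) ∧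
            Guarantee μ T (C * v.workBound p K ε) ∧
            Guarantee μ R (C * v.roundBound p K ε) := by
  refine ⟨implementation f, 2 * 10 ^ 9, fun a => ⟨wordFactor a, ?_⟩⟩
  intro n p K ε color z q hn hK hε hε1 hv hz Ω _ μ _ s hsel
  obtain ⟨c, H, hs, hq, hM⟩ := exists_setup hn hK hε hε1 hz rfl rfl
  exact implementation_spec v hn hK hε hε1 hv hs rfl rfl hq hM hsel
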